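/- Let $K$ be an algebraically closed field of characteristic $0$ (for instance $\overline{\mathbb Q}$), and fix $i,\sqrt{-3}\in K$ with $i^2=-1$ and $(\sqrt{-3})^2=-3$. For $p=[A,B,C,D,E]\in\mathbb P^4_K$ let $X_p\subset\mathbb P^3_K$ be the quartic surface $$A(x^4+y^4+z^4+w^4)+Bxyzw+C(x^2y^2+z^2w^2)+D(x^2z^2+y^2w^2)+E(x^2w^2+y^2z^2)=0 .$$ A family is a subset of the parameter space $\mathbb P^4$. A property is said to hold for a general member of a family if it holds for all parameters in some relatively Zariski-open and Zariski-dense subset of the family (so that it holds, in particular, for a very general member). **Lines.** 1. A general member of $\mathcal X_{C,D,E}=\{[A,(DE-2AC)/A,C,D,E] : A\ne0\}$ contains exactly $8$ lines. 2. A general member of $\mathcal X_{C,D}=\{[A,0,C,D,2AC/D] : A,D\neq 0\}$ contains exactly $16$ lines. 3. A general member of $\mathcal X_{B}=\{[A,B(2A-B)/A,B,B,B] : A\ne0\}$ contains exactly $24$ lines. 4. A general member of $\mathcal X_{C}=\{[A,0,C,0,0] : A\ne0\}$ contains exactly $32$ lines. 5. The surface $Y=[\sqrt{-3},12(\sqrt{-3}-1),6,6,-6]$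 contains exactly $32$ lines. 6. The Fermat quartic $F_4=[1,0,0,0,0]$ contains exactly $48$ lines. **Completeness of the list.** Let $q_1,\dots,q_{10}\in\mathbb P^4$ be the nodes $$[1,0,-2,-2,2],\ [1,0,-2,2,-2],\ [1,0,2,-2,-2],\ [1,0,2,2,2],\ [0,\mp2,1,0,0],\ [0,\mp2,0,1,0],\ [0,\mp2,0,0,1]$$ of the Segre cubic $16A^3+AB^2-4A(C^2+D^2+E^2)+4CDE=0$, and let $T_i$ be the (projective) tangent cone to this cubic at $q_i$. Let $\Omega$ be the group acting on $\mathbb P^3\times\mathbb P^4$ generated by the five transformations sending $([x,y,z,w],[A,B,C,D,E])$ to - $([x,y,z,-w],[A,-B,C,D,E])$, - $([x,y,w,z],[A,B,C,E,D])$, - $([x,z,y,w],[A,B,D,C,E])$, - $([x,y,iz,iw],[A,-B,C,-D,-E])$, - $([x-y,x+y,z-w,z+w],[2A+C,\,8(D-E),\,12A-2C,\,B+2D+2E,\,-B+2D+2E])$. The Zariski closure of each of the six families $\mathcal X_{C,D,E},\mathcal X_{C,D},\mathcal X_B,\mathcal X_C,\{Y\},\{F_4\}$ is an irreducible component of $\bigcap_{i\in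 S}T_i$ for some nonempty $S\subseteq\{1,\dots,10\}$, and its general member is smooth. Conversely, if $S\subseteq\{1,\dots,10\}$ is nonempty and $Z$ is an irreducible component of $\bigcap_{i\in S}T_i$ that has a smooth member $X_p$, $p\in Z$ (in particular, if a general or very general member of $Z$ is smooth), then $Z$ is the image under some element of $\Omega$ of the Zariski closure of one of these six families. -/

import Mathlib

open scoped LinearAlgebra.Projectivization MatrixGroups

noncomputable section

namespace InvariantQuartics

/-- Projective 3-space, with homogeneous coordinates `[x, y, z, w]`. -/
abbrev P3 (K : Type*) [Field K] := ℙ K (Fin 4 → K)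

/-- The parameter space, projective 4-space with homogeneous coordinates `[A, B, C, D, E]`. -/
abbrev P4 (K : Type*) [Field K] := ℙ K (Fin 5 → K)

/-- The Zariski topology on the parameter space: it is generated by the sets `f ≠ 0` with `f` a
homogeneous polynomial (whether `f` vanishes does not depend on the representative). -/
instance zariskiTopology (K : Type*) [Field K] : TopologicalSpace (P4 K) :=
  TopologicalSpace.generateFrom
    {U | ∃ (f : MvPolynomial (Fin 5) K) (d : ℕ), f.IsHomogeneous d ∧
      U = {p : P4 K | MvPolynomial.eval p.rep f ≠ 0}}

section Surfaces

variable {K : Type*} [Field K]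

open MvPolynomial in
/-- The quartic form with coefficient vector `c = (A, B, C, D, E)`. -/
def quarticForm (c : Fin 5 → K) : MvPolynomial (Fin 4) K :=
  C (c 0) * (X 0 ^ 4 + X 1 ^ 4 + X 2 ^ 4 + X 3 ^ 4)
    + C (c 1) * (X 0 * X 1 * X 2 * X 3)
    + C (c 2) * (X 0 ^ 2 * X 1 ^ 2 + X 2 ^ 2 * X 3 ^ 2)
    + C (c 3) * (X 0 ^ 2 * X 2 ^ 2 + X 1 ^ 2 * X 3 ^ 2)
    + C (c 4) * (X 0 ^ 2 * X 3 ^ 2 + X 1 ^ 2 * X 2 ^ 2)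

/-- The quartic surface `X_p` in projective 3-space. -/
def surface (p : P4 K) : Set (P3 K) :=
  {x | MvPolynomial.eval x.rep (quarticForm p.rep) = 0}

/-- `X_p` is smooth: the partial derivatives of its equation have no common zero on it. -/
def IsSmooth (p : P4 K) : Prop :=
  ∀ x ∈ surface p, ∃ i : Fin 4,
    MvPolynomial.eval x.rep (MvPolynomial.pderiv i (quarticForm p.rep)) ≠ 0

/-- The lines of projective 3-space (given by the two-dimensional subspaces of `K⁴`) all of whose
points lie on `X_p`. -/
def linesOn (p : P4 K) : Set (Submodule K (Fin 4 → K)) :=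
  {L | Module.finrank K L = 2 ∧ ∀ x : P3 K, x.submodule ≤ L → x ∈ surface p}

/-- The property `P` holds for a general member of the family `F` (a set of parameters):
it holds on a relatively Zariski-open and Zariski-dense subset of `F`. -/
def ForGeneralMember (F : Set (P4 K)) (P : P4 K → Prop) : Prop :=
  ∃ U : Set (P4 K), IsOpen U ∧ F ⊆ closure (U ∩ F) ∧ ∀ p ∈ U ∩ F, P p

end Surfaces

section TangentCones

variable {K : Type*} [Field K]

open MvPolynomial in
/-- The Segre cubic form `16A³ + AB² - 4A(C² + D² + E²) + 4CDE`. -/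
def segreCubic (K : Type*) [Field K] : MvPolynomial (Fin 5) K :=
  C 16 * X 0 ^ 3 + X 0 * X 1 ^ 2 - C 4 * X 0 * (X 2 ^ 2 + X 3 ^ 2 + X 4 ^ 2)
    + C 4 * X 2 * X 3 * X 4

/-- The polynomial `f (q + T v)` in the variable `T`. -/
def expansionAt (f : MvPolynomial (Fin 5) K) (q v : Fin 5 → K) : Polynomial K :=
  MvPolynomial.aeval (fun i => Polynomial.C (q i) + Polynomial.X * Polynomial.C (v i)) f

/-- The multiplicity of the hypersurface `f = 0` at `q`: the order of vanishing of `f` there. -/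
def multiplicityAt (f : MvPolynomial (Fin 5) K) (q : Fin 5 → K) : ℕ :=
  sInf {m | ∃ v : Fin 5 → K, (expansionAt f q v).coeff m ≠ 0}

/-- The (projective, embedded) tangent cone at the point `q` of the hypersurface `f = 0`, for `f`
homogeneous: the zero locus of the lowest-order form of `f` at `q`. -/
def tangentCone (f : MvPolynomial (Fin 5) K) (q : P4 K) : Set (P4 K) :=
  {p | (expansionAt f q.rep p.rep).coeff (multiplicityAt f q.rep) = 0}

/-- Coordinates of the ten singular points of the Segre cubic. -/
def nodeVec (K : Type*) [Field K] : Fin 10 → Fin 5 → K :=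
  ![![1, 0, -2, -2, 2], ![1, 0, -2, 2, -2], ![1, 0, 2, -2, -2], ![1, 0, 2, 2, 2],
    ![0, -2, 1, 0, 0], ![0, 2, 1, 0, 0], ![0, -2, 0, 1, 0], ![0, 2, 0, 1, 0],
    ![0, -2, 0, 0, 1], ![0, 2, 0, 0, 1]]

theorem nodeVec_ne_zero (i : Fin 10) : nodeVec K i ≠ 0 := by
  intro h
  have h0 := congrFun h 0
  have h2 := congrFun h 2
  have h3 := congrFun h 3
  have h4 := congrFun h 4
  fin_cases i <;> simp [nodeVec] at h0 h2 h3 h4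

/-- The ten nodes `q₁, …, q₁₀` of the Segre cubic. -/
def node (i : Fin 10) : P4 K := Projectivization.mk K (nodeVec K i) (nodeVec_ne_zero i)

/-- The tangent cone to the Segre cubic at its `i`-th node. -/
def nodeCone (i : Fin 10) : Set (P4 K) := tangentCone (segreCubic K) (node i)

/-- `Z` is an irreducible component of the intersection of the tangent cones at some nonempty set
of nodes. -/
def IsConeFamily (Z : Set (P4 K)) : Prop :=
  ∃ S : Set (Fin 10), S.Nonempty ∧
    Maximal (fun Z' : Set (P4 K) => IsIrreducible Z' ∧ Z' ⊆ ⋂ i ∈ S, nodeCone i) Z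

end TangentCones

section Families

variable {K : Type*} [Field K]

/-- The point `[A, B, C, D, E]`, for `A ≠ 0`. -/
def point (A B C D E : K) (hA : A ≠ 0) : P4 K :=
  Projectivization.mk K ![A, B, C, D, E] (fun h => hA (congrFun h 0))

/-- The family `[A, (DE - 2AC)/A, C, D, E]`. -/
def familyCDE (K : Type*) [Field K] : Set (P4 K) :=
  {p | ∃ (A C D E : K) (hA : A ≠ 0), p = point A ((D * E - 2 * A * C) / A) C D E hA}

/-- The family `[A, 0, C, D, 2AC/D]`. -/
def familyCD (K : Type*) [Field K] : Set (P4 K) :=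
  {p | ∃ (A C D : K) (hA : A ≠ 0), D ≠ 0 ∧ p = point A 0 C D (2 * A * C / D) hA}

/-- The family `[A, B(2A - B)/A, B, B, B]`. -/
def familyB (K : Type*) [Field K] : Set (P4 K) :=
  {p | ∃ (A B : K) (hA : A ≠ 0), p = point A (B * (2 * A - B) / A) B B B hA}

/-- The family `[A, 0, C, 0, 0]`. -/
def familyC (K : Type*) [Field K] : Set (P4 K) :=
  {p | ∃ (A C : K) (hA : A ≠ 0), p = point A 0 C 0 0 hA}

theorem ne_zero_of_sq_eq [CharZero K] {s : K} (hs : s ^ 2 = -3) : s ≠ 0 := by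
  rintro rfl
  norm_num at hs

/-- The point `[s, 12(s - 1), 6, 6, -6]` of the surface `Y`, where `s = √-3`. -/
def pointY [CharZero K] (s : K) (hs : s ^ 2 = -3) : P4 K :=
  point s (12 * (s - 1)) 6 6 (-6) (ne_zero_of_sq_eq hs)

/-- The point `[1, 0, 0, 0, 0]` of the Fermat quartic. -/
def pointF4 (K : Type*) [Field K] : P4 K := point 1 0 0 0 0 one_ne_zero

/-- The six families, the last two being single surfaces. -/
def listedFamilies [CharZero K] (s : K) (hs : s ^ 2 = -3) : Set (Set (P4 K)) :=
  {familyCDE K, familyCD K, familyB K, familyC K, {pointY s hs}, {pointF4 K}}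

end Families

section Omega

variable {K : Type*} [Field K]

/-- The action `[x, y, z, w] ↦ …` of the generators `φ₁, …, φ₅` on projective 3-space. -/
def genMat4 (i : K) : Fin 5 → Matrix (Fin 4) (Fin 4) K :=
  ![!![1, 0, 0, 0; 0, 1, 0, 0; 0, 0, 1, 0; 0, 0, 0, -1],
    !![1, 0, 0, 0; 0, 1, 0, 0; 0, 0, 0, 1; 0, 0, 1, 0],
    !![1, 0, 0, 0; 0, 0, 1, 0; 0, 1, 0, 0; 0, 0, 0, 1],
    !![1, 0, 0, 0; 0, 1, 0, 0; 0, 0, i, 0; 0, 0, 0, i],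
    !![1, -1, 0, 0; 1, 1, 0, 0; 0, 0, 1, -1; 0, 0, 1, 1]]

/-- The action `[A, B, C, D, E] ↦ …` of the generators `φ₁, …, φ₅` on the parameter space. -/
def genMat5 (K : Type*) [Field K] : Fin 5 → Matrix (Fin 5) (Fin 5) K :=
  ![!![1, 0, 0, 0, 0; 0, -1, 0, 0, 0; 0, 0, 1, 0, 0; 0, 0, 0, 1, 0; 0, 0, 0, 0, 1],
    !![1, 0, 0, 0, 0; 0, 1, 0, 0, 0; 0, 0, 1, 0, 0; 0, 0, 0, 0, 1; 0, 0, 0, 1, 0],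
    !![1, 0, 0, 0, 0; 0, 1, 0, 0, 0; 0, 0, 0, 1, 0; 0, 0, 1, 0, 0; 0, 0, 0, 0, 1],
    !![1, 0, 0, 0, 0; 0, -1, 0, 0, 0; 0, 0, 1, 0, 0; 0, 0, 0, -1, 0; 0, 0, 0, 0, -1],
    !![2, 0, 1, 0, 0; 0, 0, 0, 8, -8; 12, 0, -2, 0, 0; 0, 1, 0, 2, 2; 0, -1, 0, 2, 2]]

theorem genMat4_det_ne_zero [CharZero K] {i : K} (hi : i ^ 2 = -1) (k : Fin 5) :
    (genMat4 i k).det ≠ 0 := by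
  have h0 : i ≠ 0 := by
    rintro rfl
    norm_num at hi
  fin_cases k <;>
    simp [genMat4, Matrix.det_succ_row_zero, Fin.sum_univ_succ, Fin.succAbove, h0]

theorem genMat5_det_ne_zero [CharZero K] (k : Fin 5) : (genMat5 K k).det ≠ 0 := by
  fin_cases k <;>
    simp [genMat5, Matrix.det_succ_row_zero, Fin.sum_univ_succ, Fin.succAbove]
  norm_num

/-- The generators `φ₁, …, φ₅`, as pairs of projective transformations, of projective 3-space and
of the parameter space. -/
def generator [CharZero K] (i : K) (hi : i ^ 2 = -1) (k : Fin 5) :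
    PGL(Fin 4, K) × PGL(Fin 5, K) :=
  (Matrix.ProjGenLinGroup.mk
      (Matrix.GeneralLinearGroup.mkOfDetNeZero (genMat4 i k) (genMat4_det_ne_zero hi k)),
    Matrix.ProjGenLinGroup.mk
      (Matrix.GeneralLinearGroup.mkOfDetNeZero (genMat5 K k) (genMat5_det_ne_zero k)))

/-- The group `Ω` of automorphisms of the product of projective 3-space and the parameter space. -/
def Omega [CharZero K] (i : K) (hi : i ^ 2 = -1) : Subgroup (PGL(Fin 4, K) × PGL(Fin 5, K)) :=
  Subgroup.closure (Set.range (generator i hi))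

end Omega

end InvariantQuartics

end

/-!
The parameter space carries six linear forms `λ₀, …, λ₅` (`lam`) with sum zero, in which the Segre
cubic is `∑ λᵢ³ = 0`. Its ten nodes correspond to the partitions of the six indices into two
triples, and the tangent cone at a node is `∑ ± λᵢ² = 0`, with opposite signs on the two triples
(`mem_nodeCone_iff`). The group `Ω` induces all permutations of the `λᵢ`
(`exists_mem_Omega_realizes`).

*Smoothness.* If `X_p` is smooth, then `λᵢ + λⱼ ≠ 0` for all `i ≠ j`
(`lam_add_ne_zero_of_isSmooth`); the converse holds off the Segre cubic (`isSmooth_of_ne_zero`).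

*Completeness.* On an irreducible set `Z` with a smooth member `λᵢ² = λⱼ²` therefore forces
`λᵢ = λⱼ`. Each of the six families is given by conditions on the `λᵢ` (`flat`). If `Z` satisfies
those of one family and lies on a further tangent cone, then it satisfies, up to a permutation of
the `λᵢ`, those of a later family in the list (`flat_step`). Starting with the tangent cone that
is the closure of the first family and choosing the last family that occurs, one finds that the
tangent cones containing `Z` all contain that family, up to a permutation, so the maximality of `Z`
makes it the closure of that family, transformed by `Ω`.

*Lines.* Up to the signs and the order of the coordinates, all families consist of quartics
`[1, DE - 2C, C, D, E]`. Identify the quadric `xy = zw` with `ℙ¹ × ℙ¹`, the point `(a, b)` being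
`a ⊗ b`. On the plane in `K⁴` spanned by `a ⊗ b` and `a' ⊗ b'` the quartic form is given by the
polarizations of the binary quartics `f = s⁴ + E s²t² + t⁴` and `g = s⁴ + D s²t² + t⁴`, apart from
the multiple `C - DE/6` of `(xy - zw)²` (`quarticVal_comb`). A line on the quartic is not tangent
to the quadric, and comparing coefficients one finds that, up to exchanging the two factors, either
the line is `a ⊗ K²` with `f(a) = 0`, or `a` and `a'` are roots of `f` and `b`, `b'` is one of
the three pairs of points at which both odd polarizations of `g` vanish. In the second case the
middle coefficient has to vanish, too, a condition that depends only on which of three involutions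
of the roots of `f` exchanges `a` and `a'` and on the pair `b`, `b'`. If `m` of the nine conditions
hold, the number of lines is `8 + 8m` (`encard_setOf_isLineOn`), and
`m = 0, 1, 2, 3, 3, 5` for the six families.
-/

namespace InvariantQuartics

/-! ### Homogeneous conditions and the Zariski topology -/

section Forms

variable {K : Type*} [Field K]

/-- `h` is the function given by a polynomial in the variables indexed by `σ`. -/
def IsPoly {σ : Type*} (h : (σ → K) → K) : Prop :=
  ∃ f : MvPolynomial σ K, ∀ v, MvPolynomial.eval v f = h v

/-- `h` is the function on `K⁵` given by a form of degree `d`. -/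
def IsForm (h : (Fin 5 → K) → K) (d : ℕ) : Prop :=
  ∃ f : MvPolynomial (Fin 5) K, f.IsHomogeneous d ∧ ∀ v, MvPolynomial.eval v f = h v

theorem IsPoly.coord {σ : Type*} (i : σ) : IsPoly (fun v : σ → K => v i) :=
  ⟨MvPolynomial.X i, by simp⟩

theorem IsPoly.const {σ : Type*} (a : K) : IsPoly (fun _ : σ → K => a) :=
  ⟨MvPolynomial.C a, by simp⟩

theorem IsPoly.add {σ : Type*} {g h : (σ → K) → K} (hg : IsPoly g) (hh : IsPoly h) :
    IsPoly (fun v => g v + h v) := by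
  obtain ⟨f, hf⟩ := hg
  obtain ⟨f', hf'⟩ := hh
  exact ⟨f + f', by simp [hf, hf']⟩

theorem IsPoly.mul {σ : Type*} {g h : (σ → K) → K} (hg : IsPoly g) (hh : IsPoly h) :
    IsPoly (fun v => g v * h v) := by
  obtain ⟨f, hf⟩ := hg
  obtain ⟨f', hf'⟩ := hh
  exact ⟨f * f', by simp [hf, hf']⟩

theorem IsPoly.sub {σ : Type*} {g h : (σ → K) → K} (hg : IsPoly g) (hh : IsPoly h) :
    IsPoly (fun v => g v - h v) := by
  obtain ⟨f, hf⟩ := hg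
  obtain ⟨f', hf'⟩ := hh
  exact ⟨f - f', by simp [hf, hf']⟩

theorem IsPoly.pow {σ : Type*} {g : (σ → K) → K} (hg : IsPoly g) (n : ℕ) :
    IsPoly (fun v => g v ^ n) := by
  obtain ⟨f, hf⟩ := hg
  exact ⟨f ^ n, by simp [hf]⟩

/-- On an infinite field, two polynomial functions that are not identically zero have a common
point of nonvanishing. -/
theorem IsPoly.exists_mul_ne_zero [Infinite K] {σ : Type*} {g h : (σ → K) → K}
    (hg : IsPoly g) (hh : IsPoly h) (hg0 : ∃ v, g v ≠ 0) (hh0 : ∃ v, h v ≠ 0) :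
    ∃ v, g v ≠ 0 ∧ h v ≠ 0 := by
  obtain ⟨f, hf⟩ := hg
  obtain ⟨f', hf'⟩ := hh
  obtain ⟨a, ha⟩ := hg0
  obtain ⟨b, hb⟩ := hh0
  by_contra! hcon
  have hz : f * f' = 0 := by
    apply MvPolynomial.funext
    intro v
    rw [map_mul, map_zero, hf, hf']
    by_cases hv : g v = 0
    · rw [hv, zero_mul]
    · rw [hcon v hv, mul_zero]
  rcases mul_eq_zero.mp hz with h0 | h0
  · apply ha
    rw [← hf, h0, map_zero]
  · apply hb
    rw [← hf', h0, map_zero]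

theorem IsForm.coord (i : Fin 5) : IsForm (fun v : Fin 5 → K => v i) 1 :=
  ⟨MvPolynomial.X i, MvPolynomial.isHomogeneous_X _ _, by simp⟩

theorem IsForm.const_mul {h : (Fin 5 → K) → K} {d : ℕ} (a : K) (hh : IsForm h d) :
    IsForm (fun v => a * h v) d := by
  obtain ⟨f, hf, hf'⟩ := hh
  refine ⟨MvPolynomial.C a * f, ?_, by simp [hf']⟩
  simpa using (MvPolynomial.isHomogeneous_C _ a).mul hf

theorem IsForm.add {g h : (Fin 5 → K) → K} {d : ℕ} (hg : IsForm g d) (hh : IsForm h d) :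
    IsForm (fun v => g v + h v) d := by
  obtain ⟨f, hf, hf1⟩ := hg
  obtain ⟨f', hf', hf1'⟩ := hh
  exact ⟨f + f', hf.add hf', by simp [hf1, hf1']⟩

theorem IsForm.sub {g h : (Fin 5 → K) → K} {d : ℕ} (hg : IsForm g d) (hh : IsForm h d) :
    IsForm (fun v => g v - h v) d := by
  obtain ⟨f, hf, hf1⟩ := hg
  obtain ⟨f', hf', hf1'⟩ := hh
  exact ⟨f - f', hf.sub hf', by simp [hf1, hf1']⟩

theorem IsForm.mul {g h : (Fin 5 → K) → K} {d e : ℕ} (hg : IsForm g d) (hh : IsForm h e) :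
    IsForm (fun v => g v * h v) (d + e) := by
  obtain ⟨f, hf, hf1⟩ := hg
  obtain ⟨f', hf', hf1'⟩ := hh
  exact ⟨f * f', hf.mul hf', by simp [hf1, hf1']⟩

theorem IsForm.pow {g : (Fin 5 → K) → K} {d : ℕ} (hg : IsForm g d) (n : ℕ) :
    IsForm (fun v => g v ^ n) (d * n) := by
  obtain ⟨f, hf, hf1⟩ := hg
  exact ⟨f ^ n, hf.pow n, by simp [hf1]⟩

theorem IsForm.sum {ι : Type*} (s : Finset ι) {g : ι → (Fin 5 → K) → K} {d : ℕ}
    (hg : ∀ i ∈ s, IsForm (g i) d) : IsForm (fun v => ∑ i ∈ s, g i v) d := by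
  classical
  induction s using Finset.induction_on with
  | empty => exact ⟨0, MvPolynomial.isHomogeneous_zero _ _ _, by simp⟩
  | insert a s ha ih =>
    simp only [Finset.sum_insert ha]
    exact (hg a (Finset.mem_insert_self _ _)).add
      (ih fun i hi => hg i (Finset.mem_insert_of_mem hi))

theorem IsForm.eval_smul {h : (Fin 5 → K) → K} {d : ℕ} (hh : IsForm h d) (a : K)
    (v : Fin 5 → K) : h (a • v) = a ^ d * h v := by
  obtain ⟨f, hf, hf1⟩ := hh
  rw [← hf1, ← hf1, MvPolynomial.eval_eq, MvPolynomial.eval_eq, Finset.mul_sum]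
  refine Finset.sum_congr rfl fun m hm => ?_
  have hd : ∑ i ∈ m.support, m i = d := by
    have := hf (MvPolynomial.mem_support_iff.1 hm)
    simpa [Finsupp.weight_apply, Finsupp.sum] using this
  simp only [Pi.smul_apply, smul_eq_mul, mul_pow, Finset.prod_mul_distrib]
  rw [Finset.prod_pow_eq_pow_sum, hd]
  ring

/-- Forms pull back to forms along linear maps. -/
theorem IsForm.comp_mulVec {h : (Fin 5 → K) → K} {d : ℕ} (hh : IsForm h d)
    (M : Matrix (Fin 5) (Fin 5) K) : IsForm (fun v => h (M.mulVec v)) d := by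
  obtain ⟨f, hf, hf1⟩ := hh
  refine ⟨MvPolynomial.bind₁ (fun i => ∑ j, MvPolynomial.C (M i j) * MvPolynomial.X j) f, ?_, ?_⟩
  · rw [← mul_one d, mul_comm]
    refine hf.aeval _ fun i => ?_
    refine MvPolynomial.IsHomogeneous.sum _ _ _ fun j _ => ?_
    simpa using (MvPolynomial.isHomogeneous_C _ (M i j)).mul (MvPolynomial.isHomogeneous_X K j)
  · intro v
    change _ = h _
    rw [← hf1]
    change (MvPolynomial.eval₂Hom (RingHom.id K) v) _ = _
    rw [MvPolynomial.eval₂Hom_bind₁]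
    change MvPolynomial.eval _ f = _
    congr 2
    funext i
    simp [Matrix.mulVec, dotProduct]

theorem IsForm.mk_rep_eq_zero_iff {h : (Fin 5 → K) → K} {d : ℕ} (hh : IsForm h d)
    (v : Fin 5 → K) (hv : v ≠ 0) : h (Projectivization.mk K v hv).rep = 0 ↔ h v = 0 := by
  obtain ⟨a, ha⟩ := Projectivization.exists_smul_eq_mk_rep K v hv
  rw [← ha, Units.smul_def, hh.eval_smul]
  simp

theorem IsForm.isOpen_ne {h : (Fin 5 → K) → K} {d : ℕ} (hh : IsForm h d) :
    IsOpen {p : P4 K | h p.rep ≠ 0} := by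
  obtain ⟨f, hf, hf1⟩ := hh
  refine TopologicalSpace.isOpen_generateFrom_of_mem ⟨f, d, hf, ?_⟩
  simp [hf1]

theorem IsForm.isClosed_eq {h : (Fin 5 → K) → K} {d : ℕ} (hh : IsForm h d) :
    IsClosed {p : P4 K | h p.rep = 0} :=
  ⟨hh.isOpen_ne⟩

/-- The nonvanishing loci of forms are a basis of the Zariski topology. -/
theorem exists_form_of_isOpen {U : Set (P4 K)} (hU : IsOpen U) {p : P4 K} (hp : p ∈ U) :
    ∃ (h : (Fin 5 → K) → K) (d : ℕ), IsForm h d ∧ h p.rep ≠ 0 ∧ ∀ q : P4 K, h q.rep ≠ 0 → q ∈ U := by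
  have hU' : TopologicalSpace.GenerateOpen
    {U | ∃ (f : MvPolynomial (Fin 5) K) (d : ℕ), f.IsHomogeneous d ∧
      U = {p : P4 K | MvPolynomial.eval p.rep f ≠ 0}} U := hU
  clear hU
  induction hU' with
  | basic s hs =>
    obtain ⟨f, d, hf, rfl⟩ := hs
    exact ⟨fun v => MvPolynomial.eval v f, d, ⟨f, hf, fun _ => rfl⟩, hp, fun q hq => hq⟩
  | univ =>
    exact ⟨fun _ => 1, 0, ⟨1, MvPolynomial.isHomogeneous_one _ _, by simp⟩, one_ne_zero,
      fun _ _ => trivial⟩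
  | inter s t _ _ ihs iht =>
    obtain ⟨g, d, hg, hg0, hgs⟩ := ihs hp.1
    obtain ⟨h, e, hh, hh0, hhs⟩ := iht hp.2
    exact ⟨_, _, hg.mul hh, mul_ne_zero hg0 hh0, fun q hq =>
      ⟨hgs q (left_ne_zero_of_mul hq), hhs q (right_ne_zero_of_mul hq)⟩⟩
  | sUnion S _ ih =>
    obtain ⟨s, hs, hps⟩ := hp
    obtain ⟨g, d, hg, hg0, hgs⟩ := ih s hs hps
    exact ⟨g, d, hg, hg0, fun q hq => ⟨s, hs, hgs q hq⟩⟩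

theorem IsForm.comp_isPoly {h : (Fin 5 → K) → K} {d : ℕ} (hh : IsForm h d) {σ : Type*}
    {P : (σ → K) → Fin 5 → K} (hP : ∀ i, IsPoly (fun a => P a i)) :
    IsPoly (fun a => h (P a)) := by
  obtain ⟨f, hf, hf1⟩ := hh
  choose g hg using hP
  refine ⟨MvPolynomial.bind₁ g f, fun v => ?_⟩
  change _ = h _
  rw [← hf1]
  change (MvPolynomial.eval₂Hom (RingHom.id K) v) _ = _
  rw [MvPolynomial.eval₂Hom_bind₁]
  change MvPolynomial.eval _ f = _
  congr 2
  funext i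
  exact hg i v

/-- A family parametrized by polynomials on the complement of a hypersurface of an affine space is
irreducible. -/
theorem isIrreducible_of_param [Infinite K] {σ : Type*} {P : (σ → K) → Fin 5 → K}
    (hP : ∀ i, IsPoly (fun a => P a i)) {N : (σ → K) → K} (hN : IsPoly N)
    (hPN : ∀ a, N a ≠ 0 → P a ≠ 0) {F : Set (P4 K)} (hne : F.Nonempty)
    (hF : ∀ p, p ∈ F ↔ ∃ (a : σ → K) (ha : N a ≠ 0), p = Projectivization.mk K (P a) (hPN a ha)) :
    IsIrreducible F := by
  refine ⟨hne, fun U V hU hV ⟨p, hpF, hpU⟩ ⟨q, hqF, hqV⟩ => ?_⟩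
  obtain ⟨g, d, hg, hg0, hgU⟩ := exists_form_of_isOpen hU hpU
  obtain ⟨h, e, hh, hh0, hhV⟩ := exists_form_of_isOpen hV hqV
  obtain ⟨a, ha, rfl⟩ := (hF p).1 hpF
  obtain ⟨b, hb, rfl⟩ := (hF q).1 hqF
  have hg1 : g (P a) ≠ 0 := fun h0 => hg0 ((hg.mk_rep_eq_zero_iff _ _).2 h0)
  have hh1 : h (P b) ≠ 0 := fun h0 => hh0 ((hh.mk_rep_eq_zero_iff _ _).2 h0)
  obtain ⟨c, hc⟩ := (hg.comp_isPoly hP).exists_mul_ne_zero (hh.comp_isPoly hP) ⟨a, hg1⟩ ⟨b, hh1⟩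
  obtain ⟨x, hx1, hx2⟩ := ((hg.comp_isPoly hP).mul (hh.comp_isPoly hP)).exists_mul_ne_zero hN
    ⟨c, mul_ne_zero hc.1 hc.2⟩ ⟨a, ha⟩
  refine ⟨Projectivization.mk K (P x) (hPN x hx2), (hF _).2 ⟨x, hx2, rfl⟩, hgU _ ?_, hhV _ ?_⟩
  · exact fun h0 => left_ne_zero_of_mul hx1 ((hg.mk_rep_eq_zero_iff _ _).1 h0)
  · exact fun h0 => right_ne_zero_of_mul hx1 ((hh.mk_rep_eq_zero_iff _ _).1 h0)

/-- A property that holds where finitely many forms do not vanish holds for a general member of an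
irreducible family, if none of the forms vanishes identically on the family. -/
theorem forGeneralMember_of_forms {F : Set (P4 K)} (hF : IsIrreducible F) {P : P4 K → Prop}
    {ι : Type*} [Finite ι] (h : ι → (Fin 5 → K) → K) (d : ι → ℕ) (hh : ∀ k, IsForm (h k) (d k))
    (hne : ∀ k, ∃ p ∈ F, h k p.rep ≠ 0) (hP : ∀ p ∈ F, (∀ k, h k p.rep ≠ 0) → P p) :
    ForGeneralMember F P := by
  have hopen : IsOpen (⋂ k, {p : P4 K | h k p.rep ≠ 0}) :=
    isOpen_iInter_of_finite fun k => (hh k).isOpen_ne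
  refine ⟨_, hopen, ?_, fun p hp => hP p hp.2 fun k => Set.mem_iInter.1 hp.1 k⟩
  rw [Set.inter_comm]
  refine subset_closure_inter_of_isPreirreducible_of_isOpen hF.isPreirreducible hopen ?_
  have key := isIrreducible_iff_sInter.1 hF
    (Set.Finite.toFinset (Set.finite_range fun k => {p : P4 K | h k p.rep ≠ 0}))
    (by
      intro u hu
      obtain ⟨k, rfl⟩ := (Set.Finite.mem_toFinset _).1 hu
      exact (hh k).isOpen_ne)
    (by
      intro u hu
      obtain ⟨k, rfl⟩ := (Set.Finite.mem_toFinset _).1 hu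
      obtain ⟨p, hp, hp'⟩ := hne k
      exact ⟨p, hp, hp'⟩)
  simpa [Set.sInter_range] using key

end Forms

/-! ### Smoothness of the invariant quartics -/

section Equations

variable {K : Type*} [Field K]

/-- The value of the quartic form with coefficients `c` at the vector `x`. -/
def quarticVal (c : Fin 5 → K) (x : Fin 4 → K) : K :=
  c 0 * (x 0 ^ 4 + x 1 ^ 4 + x 2 ^ 4 + x 3 ^ 4) + c 1 * (x 0 * x 1 * x 2 * x 3)
    + c 2 * (x 0 ^ 2 * x 1 ^ 2 + x 2 ^ 2 * x 3 ^ 2)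
    + c 3 * (x 0 ^ 2 * x 2 ^ 2 + x 1 ^ 2 * x 3 ^ 2)
    + c 4 * (x 0 ^ 2 * x 3 ^ 2 + x 1 ^ 2 * x 2 ^ 2)

/-- The gradient of the quartic form with coefficients `c` at the vector `x`. -/
def quarticGrad (c : Fin 5 → K) (x : Fin 4 → K) : Fin 4 → K :=
  ![4 * c 0 * x 0 ^ 3 + c 1 * (x 1 * x 2 * x 3)
      + 2 * x 0 * (c 2 * x 1 ^ 2 + c 3 * x 2 ^ 2 + c 4 * x 3 ^ 2),
    4 * c 0 * x 1 ^ 3 + c 1 * (x 0 * x 2 * x 3)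
      + 2 * x 1 * (c 2 * x 0 ^ 2 + c 3 * x 3 ^ 2 + c 4 * x 2 ^ 2),
    4 * c 0 * x 2 ^ 3 + c 1 * (x 0 * x 1 * x 3)
      + 2 * x 2 * (c 2 * x 3 ^ 2 + c 3 * x 0 ^ 2 + c 4 * x 1 ^ 2),
    4 * c 0 * x 3 ^ 3 + c 1 * (x 0 * x 1 * x 2)
      + 2 * x 3 * (c 2 * x 2 ^ 2 + c 3 * x 1 ^ 2 + c 4 * x 0 ^ 2)]

theorem eval_quarticForm (c : Fin 5 → K) (x : Fin 4 → K) :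
    MvPolynomial.eval x (quarticForm c) = quarticVal c x := by
  simp [quarticForm, quarticVal]

theorem eval_pderiv_quarticForm (c : Fin 5 → K) (x : Fin 4 → K) (i : Fin 4) :
    MvPolynomial.eval x (MvPolynomial.pderiv i (quarticForm c)) = quarticGrad c x i := by
  fin_cases i <;>
    simp [quarticForm, quarticGrad, Derivation.leibniz, MvPolynomial.pderiv_X,
      Derivation.leibniz_pow] <;> ring

theorem quarticVal_smul_left (a : K) (c : Fin 5 → K) (x : Fin 4 → K) :
    quarticVal (a • c) x = a * quarticVal c x := by
  simp [quarticVal]; ring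

theorem quarticVal_smul_right (a : K) (c : Fin 5 → K) (x : Fin 4 → K) :
    quarticVal c (a • x) = a ^ 4 * quarticVal c x := by
  simp [quarticVal]; ring

theorem quarticGrad_smul_left (a : K) (c : Fin 5 → K) (x : Fin 4 → K) (i : Fin 4) :
    quarticGrad (a • c) x i = a * quarticGrad c x i := by
  fin_cases i <;> simp [quarticGrad] <;> ring

theorem quarticGrad_smul_right (a : K) (c : Fin 5 → K) (x : Fin 4 → K) (i : Fin 4) :
    quarticGrad c (a • x) i = a ^ 3 * quarticGrad c x i := by
  fin_cases i <;> simp [quarticGrad] <;> ring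

theorem mk_mem_surface_mk_iff (c : Fin 5 → K) (hc : c ≠ 0) (x : Fin 4 → K) (hx : x ≠ 0) :
    Projectivization.mk K x hx ∈ surface (Projectivization.mk K c hc) ↔ quarticVal c x = 0 := by
  obtain ⟨a, ha⟩ := Projectivization.exists_smul_eq_mk_rep K c hc
  obtain ⟨b, hb⟩ := Projectivization.exists_smul_eq_mk_rep K x hx
  simp only [surface, Set.mem_ofPred_eq]
  rw [eval_quarticForm, ← ha, ← hb, Units.smul_def, Units.smul_def, quarticVal_smul_left,
    quarticVal_smul_right]
  simp

theorem mem_linesOn_mk_iff (c : Fin 5 → K) (hc : c ≠ 0) (L : Submodule K (Fin 4 → K)) :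
    L ∈ linesOn (Projectivization.mk K c hc) ↔
      Module.finrank K L = 2 ∧ ∀ x ∈ L, quarticVal c x = 0 := by
  refine and_congr_right fun _ => ⟨fun h x hx => ?_, fun h x => ?_⟩
  · by_cases hx0 : x = 0
    · simp [hx0, quarticVal]
    · refine (mk_mem_surface_mk_iff c hc x hx0).1 (h _ ?_)
      rwa [Projectivization.submodule_mk, Submodule.span_singleton_le_iff_mem]
  · induction x using Projectivization.ind with
    | h x hx =>
      rw [Projectivization.submodule_mk, Submodule.span_singleton_le_iff_mem,
        mk_mem_surface_mk_iff]
      exact h x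

theorem isSmooth_mk_iff (c : Fin 5 → K) (hc : c ≠ 0) :
    IsSmooth (Projectivization.mk K c hc) ↔
      ∀ x : Fin 4 → K, x ≠ 0 → quarticVal c x = 0 → ∃ i, quarticGrad c x i ≠ 0 := by
  have key : ∀ (x : Fin 4 → K) (hx : x ≠ 0) (i : Fin 4),
      MvPolynomial.eval (Projectivization.mk K x hx).rep
        (MvPolynomial.pderiv i (quarticForm (Projectivization.mk K c hc).rep)) ≠ 0 ↔
      quarticGrad c x i ≠ 0 := by
    intro x hx i
    obtain ⟨a, ha⟩ := Projectivization.exists_smul_eq_mk_rep K c hc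
    obtain ⟨b, hb⟩ := Projectivization.exists_smul_eq_mk_rep K x hx
    rw [eval_pderiv_quarticForm, ← ha, ← hb, Units.smul_def, Units.smul_def,
      quarticGrad_smul_left, quarticGrad_smul_right]
    simp
  refine ⟨fun h x hx h0 => ?_, fun h x => ?_⟩
  · obtain ⟨i, hi⟩ := h _ ((mk_mem_surface_mk_iff c hc x hx).2 h0)
    exact ⟨i, (key x hx i).1 hi⟩
  · induction x using Projectivization.ind with
    | h x hx =>
      intro h0
      obtain ⟨i, hi⟩ := h x hx ((mk_mem_surface_mk_iff c hc x hx).1 h0)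
      exact ⟨i, (key x hx i).2 hi⟩

end Equations

section Smoothness

variable {K : Type*} [Field K]

/-- The six linear forms on the parameter space, with sum zero, that the group `Ω` permutes. In
these coordinates the Segre cubic is `∑ λᵢ³ = 0`. -/
def lam (c : Fin 5 → K) : Fin 6 → K :=
  ![-8 * c 0 + c 1, -8 * c 0 - c 1, 4 * c 0 - 2 * c 2 - 2 * c 3 - 2 * c 4,
    4 * c 0 - 2 * c 2 + 2 * c 3 + 2 * c 4, 4 * c 0 + 2 * c 2 - 2 * c 3 + 2 * c 4,
    4 * c 0 + 2 * c 2 + 2 * c 3 - 2 * c 4]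

/-- The value of the Segre cubic. -/
def segreVal (c : Fin 5 → K) : K :=
  16 * c 0 ^ 3 + c 0 * c 1 ^ 2 - 4 * c 0 * (c 2 ^ 2 + c 3 ^ 2 + c 4 ^ 2) + 4 * c 2 * c 3 * c 4

theorem not_isSmooth_of_critical [CharZero K] {c : Fin 5 → K} (hc : c ≠ 0) (u v t : K)
    (h0 : 4 * c 0 + c 1 * (u * v * t) + 2 * (c 2 * u ^ 2 + c 3 * v ^ 2 + c 4 * t ^ 2) = 0)
    (h1 : 4 * c 0 * u ^ 3 + c 1 * (v * t) + 2 * u * (c 2 + c 3 * t ^ 2 + c 4 * v ^ 2) = 0)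
    (h2 : 4 * c 0 * v ^ 3 + c 1 * (u * t) + 2 * v * (c 2 * t ^ 2 + c 3 + c 4 * u ^ 2) = 0)
    (h3 : 4 * c 0 * t ^ 3 + c 1 * (u * v) + 2 * t * (c 2 * v ^ 2 + c 3 * u ^ 2 + c 4) = 0) :
    ¬IsSmooth (Projectivization.mk K c hc) := by
  intro h
  rw [isSmooth_mk_iff] at h
  -- The value of the form is obtained from the gradient by Euler's formula.
  obtain ⟨k, hk⟩ := h ![1, u, v, t] (fun h => by simpa using congrFun h 0) (by
    simp only [quarticVal, Matrix.cons_val]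
    linear_combination (h0 + u * h1 + v * h2 + t * h3) / 4)
  apply hk
  fin_cases k
  · simpa [quarticGrad] using h0
  · simpa [quarticGrad] using h1
  · simpa [quarticGrad] using h2
  · simpa [quarticGrad] using h3

/-- The fifteen hyperplanes `λᵢ + λⱼ = 0`: one is `A = 0`, six involve `A` and one more coordinate,
eight involve all coordinates. -/
theorem forall_lam_add_ne_zero_iff [CharZero K] {c : Fin 5 → K} :
    (∀ i j : Fin 6, i < j → lam c i + lam c j ≠ 0) ↔
      c 0 ≠ 0 ∧ (∀ k : Fin 3, ∀ u : K, u ^ 2 = 1 → 2 * c 0 + u * c k.succ.succ ≠ 0) ∧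
      ∀ u v t : K, u ^ 2 = 1 → v ^ 2 = 1 → t ^ 2 = 1 →
        4 * c 0 + t * c 1 + 2 * (u * v * c 2 + u * c 3 + v * c 4) ≠ 0 := by
  have sq1 : ∀ {u : K}, u ^ 2 = 1 → u = 1 ∨ u = -1 := fun h =>
    sq_eq_sq_iff_eq_or_eq_neg.1 (h.trans (one_pow 2).symm)
  constructor
  · intro h
    refine ⟨fun h0 => h 0 1 (by decide) ?_, fun k u hu h0 => ?_, fun u v t hu hv ht h0 => ?_⟩
    · simp [lam, h0]
    · fin_cases k <;> rcases sq1 hu with rfl | rfl <;>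
        simp only [Fin.zero_eta, Fin.mk_one, Fin.reduceFinMk, Fin.reduceSucc] at h0
      · exact h 4 5 (by decide) (by simp only [lam, Matrix.cons_val]; linear_combination 4 * h0)
      · exact h 2 3 (by decide) (by simp only [lam, Matrix.cons_val]; linear_combination 4 * h0)
      · exact h 3 5 (by decide) (by simp only [lam, Matrix.cons_val]; linear_combination 4 * h0)
      · exact h 2 4 (by decide) (by simp only [lam, Matrix.cons_val]; linear_combination 4 * h0)
      · exact h 3 4 (by decide) (by simp only [lam, Matrix.cons_val]; linear_combination 4 * h0)
      · exact h 2 5 (by decide) (by simp only [lam, Matrix.cons_val]; linear_combination 4 * h0)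
    · rcases sq1 hu with rfl | rfl <;> rcases sq1 hv with rfl | rfl <;>
        rcases sq1 ht with rfl | rfl
      · exact h 1 2 (by decide) (by simp only [lam, Matrix.cons_val]; linear_combination -h0)
      · exact h 0 2 (by decide) (by simp only [lam, Matrix.cons_val]; linear_combination -h0)
      · exact h 1 4 (by decide) (by simp only [lam, Matrix.cons_val]; linear_combination -h0)
      · exact h 0 4 (by decide) (by simp only [lam, Matrix.cons_val]; linear_combination -h0)
      · exact h 1 5 (by decide) (by simp only [lam, Matrix.cons_val]; linear_combination -h0)
      · exact h 0 5 (by decide) (by simp only [lam, Matrix.cons_val]; linear_combination -h0)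
      · exact h 1 3 (by decide) (by simp only [lam, Matrix.cons_val]; linear_combination -h0)
      · exact h 0 3 (by decide) (by simp only [lam, Matrix.cons_val]; linear_combination -h0)
  · rintro ⟨hA, h6, h8⟩ i j hij h0
    have m1 : (-1 : K) ^ 2 = 1 := by norm_num
    have p1 : (1 : K) ^ 2 = 1 := by norm_num
    fin_cases i <;> fin_cases j <;> first | exact absurd hij (by decide) | skip
    all_goals simp only [lam, Matrix.cons_val, Fin.zero_eta, Fin.mk_one, Fin.reduceFinMk] at h0
    · exact hA (by linear_combination -h0 / 16)
    · exact h8 1 1 (-1) p1 p1 m1 (by linear_combination -h0)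
    · exact h8 (-1) (-1) (-1) m1 m1 m1 (by linear_combination -h0)
    · exact h8 1 (-1) (-1) p1 m1 m1 (by linear_combination -h0)
    · exact h8 (-1) 1 (-1) m1 p1 m1 (by linear_combination -h0)
    · exact h8 1 1 1 p1 p1 p1 (by linear_combination -h0)
    · exact h8 (-1) (-1) 1 m1 m1 p1 (by linear_combination -h0)
    · exact h8 1 (-1) 1 p1 m1 p1 (by linear_combination -h0)
    · exact h8 (-1) 1 1 m1 p1 p1 (by linear_combination -h0)
    · exact h6 0 (-1) m1 (by simp only [Fin.reduceSucc]; linear_combination h0 / 4)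
    · exact h6 1 (-1) m1 (by simp only [Fin.reduceSucc]; linear_combination h0 / 4)
    · exact h6 2 (-1) m1 (by simp only [Fin.reduceSucc]; linear_combination h0 / 4)
    · exact h6 2 1 p1 (by simp only [Fin.reduceSucc]; linear_combination h0 / 4)
    · exact h6 1 1 p1 (by simp only [Fin.reduceSucc]; linear_combination h0 / 4)
    · exact h6 0 1 p1 (by simp only [Fin.reduceSucc]; linear_combination h0 / 4)

/-- On each of the fifteen hyperplanes `λᵢ + λⱼ = 0` the quartics are singular, at a point with
coordinates `0, ±1, ±√-1`. -/
theorem lam_add_ne_zero_of_isSmooth [CharZero K] [IsAlgClosed K] {c : Fin 5 → K}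
    (hc : c ≠ 0) (h : IsSmooth (Projectivization.mk K c hc)) :
    ∀ i j : Fin 6, i < j → lam c i + lam c j ≠ 0 := by
  have hsqrt : ∀ u : K, ∃ r : K, r ^ 2 = u := fun u =>
    IsAlgClosed.exists_pow_nat_eq u two_pos
  refine forall_lam_add_ne_zero_iff.2 ⟨fun h0 => ?_, fun k u hu h0 => ?_,
    fun U V τ hU hV hτ h0 => ?_⟩
  · obtain ⟨k, hk⟩ := (isSmooth_mk_iff c hc).1 h ![1, 0, 0, 0]
      (fun h => by simpa using congrFun h 0) (by simp [quarticVal, h0])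
    fin_cases k <;> simp [quarticGrad, h0] at hk
  · obtain ⟨r, hr⟩ := hsqrt u
    fin_cases k <;> simp only [Fin.zero_eta, Fin.mk_one, Fin.reduceFinMk, Fin.reduceSucc] at h0
    · refine not_isSmooth_of_critical hc r 0 0 ?_ ?_ ?_ ?_ h
      · linear_combination 2 * h0 + 2 * c 2 * hr
      · linear_combination 2 * r * u * h0 + 4 * c 0 * r * hr - 2 * r * c 2 * hu
      · ring
      · ring
    · refine not_isSmooth_of_critical hc 0 r 0 ?_ ?_ ?_ ?_ h
      · linear_combination 2 * h0 + 2 * c 3 * hr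
      · ring
      · linear_combination 2 * r * u * h0 + 4 * c 0 * r * hr - 2 * r * c 3 * hu
      · ring
    · refine not_isSmooth_of_critical hc 0 0 r ?_ ?_ ?_ ?_ h
      · linear_combination 2 * h0 + 2 * c 4 * hr
      · ring
      · ring
      · linear_combination 2 * r * u * h0 + 4 * c 0 * r * hr - 2 * r * c 4 * hu
  · -- The coordinates `v`, `t` are square roots of `U`, `V`; the sign `τ` is the product `uvt`.
    obtain ⟨v, hv⟩ := hsqrt U
    obtain ⟨t, ht⟩ := hsqrt V
    have hu : (τ * v * t * U * V) ^ 2 = U * V := by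
      linear_combination (v * t * U * V) ^ 2 * hτ + U ^ 2 * V ^ 2 * (hv * t ^ 2 + U * ht) +
        U * V * (hU * V ^ 2 + hV)
    obtain ⟨u, hu'⟩ : ∃ u, u = τ * v * t * U * V := ⟨_, rfl⟩
    rw [← hu'] at hu
    have huvt : u * v * t = τ := by
      rw [hu']
      linear_combination τ * U * V * (hv * t ^ 2 + U * ht) + τ * (hU * V ^ 2 + hV)
    have hvt : v * t = τ * (u * (U * V)) := by
      rw [hu']
      linear_combination -v * t * U ^ 2 * V ^ 2 * hτ - v * t * (hU * V ^ 2 + hV)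
    have hut : u * t = τ * (v * U) := by
      rw [hu']
      linear_combination τ * v * U * V * ht + τ * v * U * hV
    have huv : u * v = τ * (t * V) := by
      rw [hu']
      linear_combination τ * t * U * V * hv + τ * t * V * hU
    refine not_isSmooth_of_critical hc u v t ?_ ?_ ?_ ?_ h
    · rw [huvt, hu, hv, ht]
      linear_combination h0
    · rw [hvt, pow_succ, hu, hv, ht]
      linear_combination u * (U * V) * h0 - 2 * u * c 2 * (hU * V ^ 2 + hV) - 2 * u * c 3 * V * hU
        - 2 * u * c 4 * U * hV
    · rw [hut, pow_succ, hu, hv, ht]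
      linear_combination v * U * h0 - 2 * v * (c 2 * V + c 3) * hU
    · rw [huv, pow_succ, hu, hv, ht]
      linear_combination t * V * h0 - 2 * t * (c 2 * U + c 4) * hV

theorem eq_zero_of_binary_critical [CharZero K] {A C x y : K} (hA : A ≠ 0) (h1 : 2 * A - C ≠ 0)
    (h2 : 2 * A + C ≠ 0) (hx : 4 * A * x ^ 3 + 2 * x * (C * y ^ 2) = 0)
    (hy : 4 * A * y ^ 3 + 2 * y * (C * x ^ 2) = 0) : x = 0 ∧ y = 0 := by
  by_cases hx0 : x = 0
  · subst hx0
    simpa [hA] using hy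
  by_cases hy0 : y = 0
  · subst hy0
    simp [hA, hx0] at hx
  have e1 : 2 * A * x ^ 2 + C * y ^ 2 = 0 := by
    apply mul_left_cancel₀ (mul_ne_zero two_ne_zero hx0); linear_combination hx
  have e2 : 2 * A * y ^ 2 + C * x ^ 2 = 0 := by
    apply mul_left_cancel₀ (mul_ne_zero two_ne_zero hy0); linear_combination hy
  exfalso
  have : (2 * A - C) * ((2 * A + C) * x ^ 2) = 0 := by linear_combination 2 * A * e1 - C * e2
  simp [h1, h2, hx0] at this

/-- In the squares `a, b, c, d` of the coordinates of a singular point off the coordinate planes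
(`m` being the product of the coordinates), the case `ab = cd`. -/
theorem critical_degenerate [CharZero K] {A B C D E a b c d m : K} (hA : A ≠ 0) (ha : a ≠ 0)
    (hD1 : 2 * A - D ≠ 0) (hD2 : 2 * A + D ≠ 0) (hE1 : 2 * A - E ≠ 0) (hE2 : 2 * A + E ≠ 0)
    (h8 : ∀ u v t : K, u ^ 2 = 1 → v ^ 2 = 1 → t ^ 2 = 1 →
      4 * A + t * B + 2 * (u * v * C + u * D + v * E) ≠ 0)
    (e1 : A * (a ^ 2 + c ^ 2 - b ^ 2 - d ^ 2) + D * (a * c - b * d) = 0)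
    (e2 : A * (a ^ 2 + d ^ 2 - b ^ 2 - c ^ 2) + E * (a * d - b * c) = 0)
    (e3 : A * (a ^ 2 + b ^ 2 - c ^ 2 - d ^ 2) + C * (a * b - c * d) = 0)
    (e : 4 * A * a ^ 2 + B * m + 2 * (C * a * b + D * a * c + E * a * d) = 0)
    (hm : m ^ 2 = a * b * c * d) (hdeg : a * b = c * d) : False := by
  have hsq : a ^ 2 + b ^ 2 = c ^ 2 + d ^ 2 := by
    apply mul_left_cancel₀ hA; linear_combination e3 - C * hdeg
  -- It suffices that `c = ua`, `d = va` with signs `u`, `v`.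
  suffices h : ∃ u v : K, u ^ 2 = 1 ∧ v ^ 2 = 1 ∧ c = u * a ∧ d = v * a by
    obtain ⟨u, v, hu, hv, rfl, rfl⟩ := h
    have hb : b = u * v * a := by
      apply mul_left_cancel₀ ha; linear_combination hdeg
    have hm2 : m ^ 2 = (a ^ 2) ^ 2 := by
      rw [hm, hb]; linear_combination a ^ 4 * (hu * v ^ 2 + hv)
    have hmt : ∃ t : K, t ^ 2 = 1 ∧ m = t * a ^ 2 := by
      rcases sq_eq_sq_iff_eq_or_eq_neg.1 hm2 with h | h
      · exact ⟨1, by ring, by rw [h]; ring⟩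
      · exact ⟨-1, by ring, by rw [h]; ring⟩
    obtain ⟨t, ht, rfl⟩ := hmt
    apply h8 u v t hu hv ht
    apply mul_left_cancel₀ (pow_ne_zero 2 ha)
    rw [hb] at e
    linear_combination e
  have hp : (a + b) ^ 2 = (c + d) ^ 2 := by linear_combination hsq + 2 * hdeg
  have hn : (a - b) ^ 2 = (c - d) ^ 2 := by linear_combination hsq - 2 * hdeg
  have two : (2 : K) ≠ 0 := two_ne_zero
  have fin : ∀ {b : K}, a ^ 2 = b ^ 2 → ∃ u : K, u ^ 2 = 1 ∧ b = u * a := by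
    intro b h
    rcases sq_eq_sq_iff_eq_or_eq_neg.1 h with h | h
    · exact ⟨1, by ring, by rw [h]; ring⟩
    · exact ⟨-1, by ring, by rw [h]; ring⟩
  suffices h : a ^ 2 = b ^ 2 by
    have hc2 : a ^ 2 = c ^ 2 := by
      rcases sq_eq_sq_iff_eq_or_eq_neg.1 hp with h1 | h1 <;>
      rcases sq_eq_sq_iff_eq_or_eq_neg.1 hn with h2 | h2
      · have : c = a := by apply mul_left_cancel₀ two; linear_combination -h1 - h2
        rw [this]
      · have : c = b := by apply mul_left_cancel₀ two; linear_combination -h1 + h2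
        rw [this, h]
      · have : c = -b := by apply mul_left_cancel₀ two; linear_combination h1 - h2
        rw [this, h]; ring
      · have : c = -a := by apply mul_left_cancel₀ two; linear_combination h1 + h2
        rw [this]; ring
    obtain ⟨u, hu, hu'⟩ := fin hc2
    obtain ⟨v, hv, hv'⟩ := fin (show a ^ 2 = d ^ 2 by linear_combination hsq + h - hc2)
    exact ⟨u, v, hu, hv, hu', hv'⟩
  rcases sq_eq_sq_iff_eq_or_eq_neg.1 hp with h1 | h1 <;>
    rcases sq_eq_sq_iff_eq_or_eq_neg.1 hn with h2 | h2
  · obtain rfl : c = a := by apply mul_left_cancel₀ two; linear_combination -h1 - h2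
    obtain rfl : d = b := by linear_combination -h1
    apply mul_left_cancel₀ hD2; linear_combination e1
  · obtain rfl : c = b := by apply mul_left_cancel₀ two; linear_combination -h1 + h2
    obtain rfl : d = a := by linear_combination -h1
    apply mul_left_cancel₀ hE2; linear_combination e2
  · obtain rfl : c = -b := by apply mul_left_cancel₀ two; linear_combination h1 - h2
    obtain rfl : d = -a := by linear_combination h1
    apply mul_left_cancel₀ hE1; linear_combination e2
  · obtain rfl : c = -a := by apply mul_left_cancel₀ two; linear_combination h1 + h2
    obtain rfl : d = -b := by linear_combination h1
    apply mul_left_cancel₀ hD1; linear_combination e1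

/-- The generic case: the parameters are determined by the singular point and lie on the Segre
cubic. -/
theorem critical_generic [CharZero K] {A B C D E a b c d m : K} (ha : a ≠ 0) (hb : b ≠ 0)
    (hc : c ≠ 0) (hd : d ≠ 0)
    (e1 : A * (a ^ 2 + c ^ 2 - b ^ 2 - d ^ 2) + D * (a * c - b * d) = 0)
    (e2 : A * (a ^ 2 + d ^ 2 - b ^ 2 - c ^ 2) + E * (a * d - b * c) = 0)
    (e3 : A * (a ^ 2 + b ^ 2 - c ^ 2 - d ^ 2) + C * (a * b - c * d) = 0)
    (e : 4 * A * a ^ 2 + B * m + 2 * (C * a * b + D * a * c + E * a * d) = 0)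
    (hm : m ^ 2 = a * b * c * d) (h1 : a * b - c * d ≠ 0) (h2 : a * c - b * d ≠ 0)
    (h3 : a * d - b * c ≠ 0) :
    16 * A ^ 3 + A * B ^ 2 - 4 * A * (C ^ 2 + D ^ 2 + E ^ 2) + 4 * C * D * E = 0 := by
  have hC : C = -A * (a ^ 2 + b ^ 2 - c ^ 2 - d ^ 2) / (a * b - c * d) := by
    rw [eq_div_iff h1]; linear_combination e3
  have hD : D = -A * (a ^ 2 + c ^ 2 - b ^ 2 - d ^ 2) / (a * c - b * d) := by
    rw [eq_div_iff h2]; linear_combination e1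
  have hE : E = -A * (a ^ 2 + d ^ 2 - b ^ 2 - c ^ 2) / (a * d - b * c) := by
    rw [eq_div_iff h3]; linear_combination e2
  have hB : B ^ 2 * (a * b * c * d) =
      (4 * A * a ^ 2 + 2 * (C * a * b + D * a * c + E * a * d)) ^ 2 := by
    rw [← hm]
    linear_combination (B * m - (4 * A * a ^ 2 + 2 * (C * a * b + D * a * c + E * a * d))) * e
  have hbcd : b * c * d ≠ 0 := by simp [hb, hc, hd]
  apply mul_left_cancel₀ (mul_ne_zero ha hbcd)
  have : a * (b * c * d) * (16 * A ^ 3 - 4 * A * (C ^ 2 + D ^ 2 + E ^ 2) + 4 * C * D * E) +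
      A * (4 * A * a ^ 2 + 2 * (C * a * b + D * a * c + E * a * d)) ^ 2 = 0 := by
    rw [hC, hD, hE]
    field_simp
    ring
  linear_combination this + A * hB

/-- A singular point with last coordinate zero forces the parameters onto a hyperplane
`λᵢ + λⱼ = 0` or onto the Segre cubic. -/
theorem critical_on_face [CharZero K] {A B C D E x y z : K} (hA : A ≠ 0)
    (hC1 : 2 * A - C ≠ 0) (hC2 : 2 * A + C ≠ 0) (hD1 : 2 * A - D ≠ 0) (hD2 : 2 * A + D ≠ 0)
    (hE1 : 2 * A - E ≠ 0) (hE2 : 2 * A + E ≠ 0)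
    (hS : 16 * A ^ 3 + A * B ^ 2 - 4 * A * (C ^ 2 + D ^ 2 + E ^ 2) + 4 * C * D * E ≠ 0)
    (g0 : 4 * A * x ^ 3 + 2 * x * (C * y ^ 2 + D * z ^ 2) = 0)
    (g1 : 4 * A * y ^ 3 + 2 * y * (C * x ^ 2 + E * z ^ 2) = 0)
    (g2 : 4 * A * z ^ 3 + 2 * z * (D * x ^ 2 + E * y ^ 2) = 0)
    (g3 : B * (x * y * z) = 0) : x = 0 ∧ y = 0 ∧ z = 0 := by
  by_cases hz : z = 0
  · subst hz
    obtain ⟨h1, h2⟩ := eq_zero_of_binary_critical hA hC1 hC2 (x := x) (y := y)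
      (by linear_combination g0) (by linear_combination g1)
    exact ⟨h1, h2, rfl⟩
  by_cases hy : y = 0
  · subst hy
    obtain ⟨h1, h2⟩ := eq_zero_of_binary_critical hA hD1 hD2 (x := x) (y := z)
      (by linear_combination g0) (by linear_combination g2)
    exact ⟨h1, rfl, h2⟩
  by_cases hx : x = 0
  · subst hx
    obtain ⟨h1, h2⟩ := eq_zero_of_binary_critical hA hE1 hE2 (x := y) (y := z)
      (by linear_combination g1) (by linear_combination g2)
    exact ⟨rfl, h1, h2⟩
  exfalso
  obtain rfl : B = 0 := by simpa [hx, hy, hz] using g3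
  have two : (2 : K) ≠ 0 := two_ne_zero
  have e0 : 2 * A * x ^ 2 + C * y ^ 2 + D * z ^ 2 = 0 := by
    apply mul_left_cancel₀ (mul_ne_zero two hx); linear_combination g0
  have e1 : C * x ^ 2 + 2 * A * y ^ 2 + E * z ^ 2 = 0 := by
    apply mul_left_cancel₀ (mul_ne_zero two hy); linear_combination g1
  have e2 : D * x ^ 2 + E * y ^ 2 + 2 * A * z ^ 2 = 0 := by
    apply mul_left_cancel₀ (mul_ne_zero two hz); linear_combination g2
  -- The determinant of this linear system in `x²`, `y²`, `z²` is half the Segre cubic.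
  apply hS
  apply mul_left_cancel₀ (pow_ne_zero 2 hz)
  linear_combination 2 * ((C * E - 2 * A * D) * e0 + (C * D - 2 * A * E) * e1
    + (4 * A ^ 2 - C ^ 2) * e2)

/-- A singular point off the coordinate planes forces the parameters onto a hyperplane
`λᵢ + λⱼ = 0` or onto the Segre cubic. Here `a, b, c, d` are the squares of its coordinates and `m`
is their product. -/
theorem critical_off_faces [CharZero K] {A B C D E a b c d m : K} (hA : A ≠ 0)
    (hC1 : 2 * A - C ≠ 0) (hC2 : 2 * A + C ≠ 0) (hD1 : 2 * A - D ≠ 0) (hD2 : 2 * A + D ≠ 0)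
    (hE1 : 2 * A - E ≠ 0) (hE2 : 2 * A + E ≠ 0)
    (h8 : ∀ u v t : K, u ^ 2 = 1 → v ^ 2 = 1 → t ^ 2 = 1 →
      4 * A + t * B + 2 * (u * v * C + u * D + v * E) ≠ 0)
    (hS : 16 * A ^ 3 + A * B ^ 2 - 4 * A * (C ^ 2 + D ^ 2 + E ^ 2) + 4 * C * D * E ≠ 0)
    (ha : a ≠ 0) (hb : b ≠ 0) (hc : c ≠ 0) (hd : d ≠ 0)
    (e1 : A * (a ^ 2 + c ^ 2 - b ^ 2 - d ^ 2) + D * (a * c - b * d) = 0)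
    (e2 : A * (a ^ 2 + d ^ 2 - b ^ 2 - c ^ 2) + E * (a * d - b * c) = 0)
    (e3 : A * (a ^ 2 + b ^ 2 - c ^ 2 - d ^ 2) + C * (a * b - c * d) = 0)
    (e : 4 * A * a ^ 2 + B * m + 2 * (C * a * b + D * a * c + E * a * d) = 0)
    (hm : m ^ 2 = a * b * c * d) : False := by
  by_cases d1 : a * b = c * d
  · exact critical_degenerate hA ha hD1 hD2 hE1 hE2 h8 e1 e2 e3 e hm d1
  by_cases d2 : a * c = b * d
  · refine critical_degenerate (B := B) (C := D) (D := C) (E := E) (b := c) (c := b)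
      (m := m) hA ha hC1 hC2 hE1 hE2 (fun u v t hu hv ht h0 => ?_)
      e3 (by linear_combination e2) e1 (by linear_combination e) (by linear_combination hm) d2
    apply h8 (u * v) v t (by rw [mul_pow, hu, hv, one_mul]) hv ht
    linear_combination h0 + 2 * u * C * hv
  by_cases d3 : a * d = b * c
  · refine critical_degenerate (B := B) (C := E) (D := D) (E := C) (b := d) (c := c) (d := b)
      (m := m) hA ha hD1 hD2 hC1 hC2 (fun u v t hu hv ht h0 => ?_)
      (by linear_combination e1) (by linear_combination e3)
      (by linear_combination e2) (by linear_combination e) (by linear_combination hm)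
      (by linear_combination d3)
    apply h8 u (u * v) t hu (by rw [mul_pow, hu, hv, one_mul]) ht
    linear_combination h0 + 2 * v * C * hu
  exact hS (critical_generic ha hb hc hd e1 e2 e3 e hm (sub_ne_zero.2 d1) (sub_ne_zero.2 d2)
    (sub_ne_zero.2 d3))

/-- Off the fifteen hyperplanes `λᵢ + λⱼ = 0` and the Segre cubic the quartics are smooth. -/
theorem isSmooth_of_ne_zero [CharZero K] {c : Fin 5 → K} (hc : c ≠ 0)
    (h : ∀ i j : Fin 6, i < j → lam c i + lam c j ≠ 0) (hS : segreVal c ≠ 0) :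
    IsSmooth (Projectivization.mk K c hc) := by
  rw [isSmooth_mk_iff]
  intro x hx hv
  by_contra! hg
  have g0 := hg 0
  have g1 := hg 1
  have g2 := hg 2
  have g3 := hg 3
  obtain ⟨hA, h6, h8⟩ := forall_lam_add_ne_zero_iff.1 h
  clear h hg
  have m1 : (-1 : K) ^ 2 = 1 := by norm_num
  have p1 : (1 : K) ^ 2 = 1 := by norm_num
  have hC1 : 2 * c 0 - c 2 ≠ 0 := by simpa [sub_eq_add_neg] using h6 0 (-1) m1
  have hC2 : 2 * c 0 + c 2 ≠ 0 := by simpa using h6 0 1 p1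
  have hD1 : 2 * c 0 - c 3 ≠ 0 := by simpa [sub_eq_add_neg] using h6 1 (-1) m1
  have hD2 : 2 * c 0 + c 3 ≠ 0 := by simpa using h6 1 1 p1
  have hE1 : 2 * c 0 - c 4 ≠ 0 := by simpa [sub_eq_add_neg] using h6 2 (-1) m1
  have hE2 : 2 * c 0 + c 4 ≠ 0 := by simpa using h6 2 1 p1
  clear h6
  obtain ⟨A, hA'⟩ : ∃ A, A = c 0 := ⟨_, rfl⟩
  obtain ⟨B, hB'⟩ : ∃ B, B = c 1 := ⟨_, rfl⟩
  obtain ⟨C, hC'⟩ : ∃ C, C = c 2 := ⟨_, rfl⟩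
  obtain ⟨D, hD'⟩ : ∃ D, D = c 3 := ⟨_, rfl⟩
  obtain ⟨E, hE'⟩ : ∃ E, E = c 4 := ⟨_, rfl⟩
  have hx' : ¬(x 0 = 0 ∧ x 1 = 0 ∧ x 2 = 0 ∧ x 3 = 0) := by
    rintro ⟨h0, h1, h2, h3⟩
    apply hx
    funext k
    fin_cases k <;> assumption
  clear hx
  obtain ⟨X, hX⟩ : ∃ X, X = x 0 := ⟨_, rfl⟩
  obtain ⟨Y, hY⟩ : ∃ Y, Y = x 1 := ⟨_, rfl⟩
  obtain ⟨Z, hZ⟩ : ∃ Z, Z = x 2 := ⟨_, rfl⟩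
  obtain ⟨W, hW⟩ : ∃ W, W = x 3 := ⟨_, rfl⟩
  simp only [quarticGrad, Matrix.cons_val, segreVal, ← hA', ← hB', ← hC', ← hD', ← hE', ← hX,
    ← hY, ← hZ, ← hW] at g0 g1 g2 g3 hS hA h8 hC1 hC2 hD1 hD2 hE1 hE2 hx'
  clear hA' hB' hC' hD' hE' hX hY hZ hW hc hv x c
  by_cases hw : W = 0
  · subst hw
    obtain ⟨h0, h1, h2⟩ := critical_on_face (x := X) (y := Y) (z := Z) hA hC1 hC2 hD1 hD2 hE1 hE2
      hS (by linear_combination g0) (by linear_combination g1) (by linear_combination g2)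
      (by linear_combination g3)
    exact hx' ⟨h0, h1, h2, rfl⟩
  by_cases hz : Z = 0
  · subst hz
    obtain ⟨h0, h1, h2⟩ := critical_on_face (x := Y) (y := X) (z := W) hA hC1 hC2 hD1 hD2 hE1 hE2
      hS (by linear_combination g1) (by linear_combination g0) (by linear_combination g3)
      (by linear_combination g2)
    exact hw h2
  by_cases hy : Y = 0
  · subst hy
    obtain ⟨h0, h1, h2⟩ := critical_on_face (x := W) (y := Z) (z := X) hA hC1 hC2
      hE1 hE2 hD1 hD2 (B := B)
      (fun h0 => hS (by linear_combination h0)) (by linear_combination g3)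
      (by linear_combination g2) (by linear_combination g0) (by linear_combination g1)
    exact hw h0
  by_cases hx : X = 0
  · subst hx
    obtain ⟨h0, h1, h2⟩ := critical_on_face (x := Z) (y := W) (z := Y) hA hC1 hC2
      hE1 hE2 hD1 hD2 (B := B)
      (fun h0 => hS (by linear_combination h0)) (by linear_combination g2)
      (by linear_combination g3) (by linear_combination g1) (by linear_combination g0)
    exact hw h1
  refine critical_off_faces (a := X ^ 2) (b := Y ^ 2) (c := Z ^ 2) (d := W ^ 2)
    (m := X * Y * Z * W) hA hC1 hC2 hD1 hD2 hE1 hE2 h8 hS (pow_ne_zero 2 hx) (pow_ne_zero 2 hy)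
    (pow_ne_zero 2 hz) (pow_ne_zero 2 hw) ?_ ?_ ?_ ?_ (by ring)
  · linear_combination (X * g0 - Y * g1 + Z * g2 - W * g3) / 4
  · linear_combination (X * g0 - Y * g1 - Z * g2 + W * g3) / 4
  · linear_combination (X * g0 + Y * g1 - Z * g2 - W * g3) / 4
  · linear_combination X * g0

end Smoothness

/-! ### The tangent cones in the symmetric coordinates -/

section Cones

variable {K : Type*} [Field K]

/-- The signs of the six coordinates `λ` at the nodes, up to a common sign: three are `1` and three
are `-1`. -/
def side : Fin 10 → Fin 6 → ℤ :=
  ![![1, 1, -1, -1, -1, 1], ![1, 1, -1, -1, 1, -1], ![1, 1, -1, 1, -1, -1],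
    ![1, 1, 1, -1, -1, -1], ![1, -1, 1, 1, -1, -1], ![-1, 1, 1, 1, -1, -1],
    ![1, -1, 1, -1, 1, -1], ![-1, 1, 1, -1, 1, -1], ![1, -1, 1, -1, -1, 1],
    ![-1, 1, 1, -1, -1, 1]]

/-- The quadratic form `∑ ± xₖ²` defining the tangent cone at the `i`-th node, in the coordinates
`λ`. -/
def coneVal (i : Fin 10) (x : Fin 6 → K) : K := ∑ k, (side i k : K) * x k ^ 2

/-- The coefficient of `T²` in the Segre cubic at `q + T v`. -/
def segreQuad (q v : Fin 5 → K) : K :=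
  48 * q 0 * v 0 ^ 2 + q 0 * v 1 ^ 2 + 2 * q 1 * v 0 * v 1
    - 4 * q 0 * (v 2 ^ 2 + v 3 ^ 2 + v 4 ^ 2)
    - 8 * v 0 * (q 2 * v 2 + q 3 * v 3 + q 4 * v 4)
    + 4 * (q 2 * v 3 * v 4 + v 2 * q 3 * v 4 + v 2 * v 3 * q 4)

/-- The coefficient of `T` in the Segre cubic at `q + T v`. -/
def segreLin (q v : Fin 5 → K) : K :=
  48 * q 0 ^ 2 * v 0 + v 0 * q 1 ^ 2 + 2 * q 0 * q 1 * v 1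
    - 4 * v 0 * (q 2 ^ 2 + q 3 ^ 2 + q 4 ^ 2)
    - 8 * q 0 * (q 2 * v 2 + q 3 * v 3 + q 4 * v 4)
    + 4 * (v 2 * q 3 * q 4 + q 2 * v 3 * q 4 + q 2 * q 3 * v 4)

theorem expansionAt_segreCubic (q v : Fin 5 → K) :
    expansionAt (segreCubic K) q v = Polynomial.C (segreVal q)
      + Polynomial.C (segreLin q v) * Polynomial.X
      + Polynomial.C (segreQuad q v) * Polynomial.X ^ 2
      + Polynomial.C (segreVal v) * Polynomial.X ^ 3 := by
  simp only [expansionAt, segreCubic, segreVal, segreLin, segreQuad, map_add, map_sub, map_mul,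
    map_pow, MvPolynomial.aeval_X, map_ofNat]
  ring

theorem coeff_expansionAt_segreCubic (q v : Fin 5 → K) :
    (expansionAt (segreCubic K) q v).coeff 0 = segreVal q ∧
    (expansionAt (segreCubic K) q v).coeff 1 = segreLin q v ∧
    (expansionAt (segreCubic K) q v).coeff 2 = segreQuad q v := by
  rw [expansionAt_segreCubic]
  simp [Polynomial.coeff_X, Polynomial.coeff_C, Polynomial.coeff_X_pow]

theorem segre_smul_nodeVec (a : K) (i : Fin 10) (v : Fin 5 → K) :
    segreVal (a • nodeVec K i) = 0 ∧ segreLin (a • nodeVec K i) v = 0 := by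
  fin_cases i <;> constructor <;> simp [nodeVec, segreVal, segreLin] <;> ring

theorem segreQuad_smul_nodeVec [CharZero K] (a : K) (i : Fin 10) (v : Fin 5 → K) :
    segreQuad (a • nodeVec K i) v
      = a * (if i < 4 then 1 / 2 else 1 / 8) * coneVal i (lam v) := by
  fin_cases i <;> simp [nodeVec, segreQuad, coneVal, Fin.sum_univ_six, lam, side] <;> ring

theorem exists_coneVal_lam_ne_zero [CharZero K] (i : Fin 10) :
    ∃ v : Fin 5 → K, coneVal i (lam v) ≠ 0 := by
  refine ⟨![1, 1, 0, 0, 0], ?_⟩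
  fin_cases i <;> simp [coneVal, Fin.sum_univ_six, lam, side] <;> norm_num

theorem mem_nodeCone_iff [CharZero K] (i : Fin 10) (p : P4 K) :
    p ∈ nodeCone i ↔ coneVal i (lam p.rep) = 0 := by
  obtain ⟨a, ha⟩ := Projectivization.exists_smul_eq_mk_rep K _ (nodeVec_ne_zero (K := K) i)
  have hq : (node i : P4 K).rep = (a : K) • nodeVec K i := ha.symm
  have ht : ((a : K) * (if i < 4 then 1 / 2 else 1 / 8)) ≠ 0 := by
    refine mul_ne_zero a.ne_zero ?_
    split_ifs <;> norm_num
  have hmult : multiplicityAt (segreCubic K) (node i : P4 K).rep = 2 := by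
    obtain ⟨v, hv⟩ := exists_coneVal_lam_ne_zero (K := K) i
    have h2 : 2 ∈ {m | ∃ v : Fin 5 → K,
        (expansionAt (segreCubic K) (node i : P4 K).rep v).coeff m ≠ 0} := by
      refine ⟨v, ?_⟩
      rw [(coeff_expansionAt_segreCubic _ _).2.2, hq, segreQuad_smul_nodeVec]
      exact mul_ne_zero ht hv
    refine le_antisymm (Nat.sInf_le h2) ?_
    by_contra! hlt
    obtain ⟨w, hw⟩ := Nat.sInf_mem ⟨2, h2⟩
    change multiplicityAt (segreCubic K) (node i : P4 K).rep < 2 at hlt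
    change (expansionAt _ _ w).coeff (multiplicityAt (segreCubic K) (node i : P4 K).rep) ≠ 0 at hw
    interval_cases multiplicityAt (segreCubic K) (node i : P4 K).rep
    · rw [(coeff_expansionAt_segreCubic _ _).1, hq] at hw
      exact hw (segre_smul_nodeVec _ _ w).1
    · rw [(coeff_expansionAt_segreCubic _ _).2.1, hq] at hw
      exact hw (segre_smul_nodeVec _ _ w).2
  simp only [nodeCone, tangentCone, Set.mem_ofPred_eq, hmult]
  rw [(coeff_expansionAt_segreCubic _ _).2.2, hq, segreQuad_smul_nodeVec]
  exact mul_eq_zero_iff_left ht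

theorem lam_smul (a : K) (v : Fin 5 → K) : lam (a • v) = a • lam v := by
  funext k
  fin_cases k <;> simp [lam] <;> ring

theorem coneVal_smul (i : Fin 10) (a : K) (x : Fin 6 → K) :
    coneVal i (a • x) = a ^ 2 * coneVal i x := by
  simp only [coneVal, Pi.smul_apply, smul_eq_mul, Finset.mul_sum]
  exact Finset.sum_congr rfl fun k _ => by ring

theorem isForm_lam (k : Fin 6) : IsForm (fun v : Fin 5 → K => lam v k) 1 := by
  have h : ∀ a b c d e : K, IsForm (fun v : Fin 5 → K =>
      a * v 0 + b * v 1 + c * v 2 + d * v 3 + e * v 4) 1 := fun a b c d e =>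
    (((((IsForm.coord 0).const_mul a).add ((IsForm.coord 1).const_mul b)).add
      ((IsForm.coord 2).const_mul c)).add ((IsForm.coord 3).const_mul d)).add
      ((IsForm.coord 4).const_mul e)
  fin_cases k
  · convert h (-8) 1 0 0 0 using 2; simp [lam]
  · convert h (-8) (-1) 0 0 0 using 2; simp [lam, sub_eq_add_neg]
  · convert h 4 0 (-2) (-2) (-2) using 2; simp [lam, sub_eq_add_neg]
  · convert h 4 0 (-2) 2 2 using 2; simp [lam, sub_eq_add_neg]
  · convert h 4 0 2 (-2) 2 using 2; simp [lam, sub_eq_add_neg]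
  · convert h 4 0 2 2 (-2) using 2; simp [lam, sub_eq_add_neg]

theorem isForm_coneVal (i : Fin 10) : IsForm (fun v : Fin 5 → K => coneVal i (lam v)) 2 :=
  IsForm.sum _ fun k _ => ((isForm_lam k).pow 2).const_mul _

theorem isClosed_nodeCone [CharZero K] (i : Fin 10) : IsClosed (nodeCone i : Set (P4 K)) := by
  have : (nodeCone i : Set (P4 K)) = {p | coneVal i (lam p.rep) = 0} :=
    Set.ext fun p => mem_nodeCone_iff i p
  rw [this]
  exact (isForm_coneVal i).isClosed_eq

theorem sum_lam (v : Fin 5 → K) : ∑ k, lam v k = 0 := by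
  simp [Fin.sum_univ_six, lam]
  ring

/-- Permuting the coordinates `λ` permutes the tangent cones. -/
theorem exists_coneVal_comp (π : Equiv.Perm (Fin 6)) (i : Fin 10) :
    ∃ j : Fin 10, ∀ x : Fin 6 → K, coneVal i x = 0 ↔ coneVal j (x ∘ π) = 0 := by
  have key : ∀ i : Fin 10, ∃ j : Fin 10, (∀ k, side i (π k) = side j k) ∨
      ∀ k, side i (π k) = -side j k := by
    have hπ : π ∈ Submonoid.closure
        (Set.range fun i : Fin 5 => Equiv.swap i.castSucc i.succ) := by
      rw [Equiv.Perm.mclosure_swap_castSucc_succ]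
      trivial
    induction hπ using Submonoid.closure_induction with
    | mem π h =>
      obtain ⟨t, rfl⟩ := h
      revert t
      decide
    | one => exact fun i => ⟨i, Or.inl fun k => rfl⟩
    | mul π ρ _ _ hπ hρ =>
      intro i
      obtain ⟨j, hj⟩ := hπ i
      obtain ⟨l, hl⟩ := hρ j
      refine ⟨l, ?_⟩
      simp only [Equiv.Perm.coe_mul, Function.comp_apply]
      rcases hj with hj | hj <;> rcases hl with hl | hl <;> simp [hj, hl]
  obtain ⟨j, hj⟩ := key i
  refine ⟨j, fun x => ?_⟩
  have e : coneVal i x = ∑ k, (side i (π k) : K) * x (π k) ^ 2 :=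
    (Equiv.sum_comp π fun k => (side i k : K) * x k ^ 2).symm
  rw [e]
  rcases hj with hj | hj <;> simp [hj, coneVal]

end Cones

/-! ### The action of `Ω` on the symmetric coordinates -/

section Action

variable {K : Type*} [Field K]

theorem continuous_smul_P4 (g : PGL(Fin 5, K)) : Continuous fun p : P4 K => g • p := by
  induction g using Matrix.ProjGenLinGroup.induction_on with
  | mk g =>
    refine continuous_generateFrom_iff.2 ?_
    rintro _ ⟨f, d, hf, rfl⟩
    have hf' : IsForm (fun v : Fin 5 → K => MvPolynomial.eval v f) d := ⟨f, hf, fun _ => rfl⟩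
    convert (hf'.comp_mulVec (g : Matrix (Fin 5) (Fin 5) K)).isOpen_ne using 1
    ext p
    refine not_congr ?_
    induction p using Projectivization.ind with
    | h v hv =>
      rw [(hf'.comp_mulVec (g : Matrix (Fin 5) (Fin 5) K)).mk_rep_eq_zero_iff v hv,
        show (fun p : P4 K => Matrix.ProjGenLinGroup.mk g • p) (Projectivization.mk K v hv) =
          Projectivization.mk K (g • v) ((smul_ne_zero_iff_ne g).2 hv) from rfl]
      exact hf'.mk_rep_eq_zero_iff _ _

/-- The projective transformation `g` permutes the coordinates `λ` by `π`. -/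
def Realizes (g : PGL(Fin 5, K)) (π : Equiv.Perm (Fin 6)) : Prop :=
  ∀ p : P4 K, ∃ a : K, a ≠ 0 ∧ ∀ k, lam (g • p).rep k = a * lam p.rep (π k)

theorem Realizes.mul {g h : PGL(Fin 5, K)} {π ρ : Equiv.Perm (Fin 6)} (hg : Realizes g π)
    (hh : Realizes h ρ) : Realizes (g * h) (ρ * π) := by
  intro p
  obtain ⟨a, ha, ha'⟩ := hh p
  obtain ⟨b, hb, hb'⟩ := hg (h • p)
  refine ⟨b * a, mul_ne_zero hb ha, fun k => ?_⟩
  rw [mul_smul, hb', ha', Equiv.Perm.mul_apply, mul_assoc]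

theorem realizes_mk {g : GL (Fin 5) K} {π : Equiv.Perm (Fin 6)} {a : K} (ha : a ≠ 0)
    (h : ∀ v k, lam ((g : Matrix (Fin 5) (Fin 5) K).mulVec v) k = a * lam v (π k)) :
    Realizes (Matrix.ProjGenLinGroup.mk g) π := by
  intro p
  induction p using Projectivization.ind with
  | h v hv =>
    rw [Projectivization.PGL.mk_smul_mk]
    obtain ⟨b, hb⟩ := Projectivization.exists_smul_eq_mk_rep K v hv
    obtain ⟨c, hc⟩ := Projectivization.exists_smul_eq_mk_rep K (g • v)
      ((smul_ne_zero_iff_ne g).2 hv)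
    refine ⟨c * a * (b : K)⁻¹, by simp [ha], fun k => ?_⟩
    rw [← hb, ← hc, show c • g • v = (c : K) • (g • v) from rfl,
      show b • v = (b : K) • v from rfl, lam_smul, lam_smul]
    have := h v k
    simp only [Pi.smul_apply, smul_eq_mul]
    rw [show g • v = (g : Matrix (Fin 5) (Fin 5) K).mulVec v from rfl, this]
    field_simp

variable [CharZero K]

/-- Every permutation of the six coordinates `λ` is realized by an element of `Ω`. -/
theorem exists_mem_Omega_realizes (i : K) (hi : i ^ 2 = -1) (π : Equiv.Perm (Fin 6)) :
    ∃ g ∈ Omega i hi, Realizes g.2 π := by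
  have gen : ∀ k, generator i hi k ∈ Omega i hi := fun k =>
    Subgroup.subset_closure ⟨k, rfl⟩
  have gmul : ∀ {π ρ : Equiv.Perm (Fin 6)}, (∃ g ∈ Omega i hi, Realizes g.2 π) →
      (∃ g ∈ Omega i hi, Realizes g.2 ρ) → ∃ g ∈ Omega i hi, Realizes g.2 (π * ρ) := by
    rintro π ρ ⟨g, hg, hg'⟩ ⟨h, hh, hh'⟩
    exact ⟨h * g, mul_mem hh hg, hh'.mul hg'⟩
  have e0 : ∃ g ∈ Omega i hi, Realizes g.2 (Equiv.swap 0 1) := by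
    refine ⟨_, gen 0, realizes_mk one_ne_zero fun v k => ?_⟩
    fin_cases k <;>
      simp [Equiv.swap_apply_def, lam, genMat5, Matrix.mulVec, dotProduct, Fin.sum_univ_five]
    ring
  have e1 : ∃ g ∈ Omega i hi, Realizes g.2 (Equiv.swap 4 5) := by
    refine ⟨_, gen 1, realizes_mk one_ne_zero fun v k => ?_⟩
    fin_cases k <;>
      simp [Equiv.swap_apply_def, lam, genMat5, Matrix.mulVec, dotProduct, Fin.sum_univ_five] <;>
      ring
  have e2 : ∃ g ∈ Omega i hi, Realizes g.2 (Equiv.swap 3 4) := by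
    refine ⟨_, gen 2, realizes_mk one_ne_zero fun v k => ?_⟩
    fin_cases k <;>
      simp [Equiv.swap_apply_def, lam, genMat5, Matrix.mulVec, dotProduct, Fin.sum_univ_five] <;>
      ring
  have e3 : ∃ g ∈ Omega i hi,
      Realizes g.2 (Equiv.swap 0 1 * Equiv.swap 2 3 * Equiv.swap 4 5) := by
    refine ⟨_, gen 3, realizes_mk one_ne_zero fun v k => ?_⟩
    fin_cases k <;>
      simp [Equiv.swap_apply_def, lam, genMat5, Matrix.mulVec, dotProduct, Fin.sum_univ_five] <;>
      ring
  have e4 : ∃ g ∈ Omega i hi,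
      Realizes g.2 (Equiv.swap 0 4 * Equiv.swap 1 5 * Equiv.swap 2 3) := by
    refine ⟨_, gen 4, realizes_mk (a := -4) (by norm_num) fun v k => ?_⟩
    fin_cases k <;>
      simp [Equiv.swap_apply_def, lam, genMat5, Matrix.mulVec, dotProduct, Fin.sum_univ_five] <;>
      ring
  have hπ : π ∈ Submonoid.closure
      (Set.range fun i : Fin 5 => Equiv.swap i.castSucc i.succ) := by
    rw [Equiv.Perm.mclosure_swap_castSucc_succ]
    trivial
  induction hπ using Submonoid.closure_induction with
  | mem π h =>
    obtain ⟨t, rfl⟩ := h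
    fin_cases t
    · exact e0
    · have h02 := gmul (gmul e4 e2) e4
      have := gmul (gmul e0 h02) e0
      convert this using 4
      decide
    · have := gmul (gmul e0 e3) e1
      convert this using 4
      decide
    · exact e2
    · exact e1
  | one => exact ⟨1, one_mem _, fun p => ⟨1, one_ne_zero, fun k => by simp⟩⟩
  | mul π ρ _ _ hπ hρ => exact gmul hπ hρ

end Action

/-! ### Intersections of the tangent cones -/

section Flats

variable {K : Type*} [Field K]

/-- The conditions on the coordinates `x = λ` that describe the six families, in the order
`familyCDE`, `familyCD`, `familyB`, `familyC`, `Y`, `F₄`. -/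
def flat (s : K) : Fin 6 → (Fin 6 → K) → Prop :=
  ![fun x => x 0 ^ 2 + x 2 ^ 2 + x 3 ^ 2 = x 1 ^ 2 + x 4 ^ 2 + x 5 ^ 2,
    fun x => x 0 = x 1 ∧ x 2 ^ 2 + x 3 ^ 2 = x 4 ^ 2 + x 5 ^ 2,
    fun x => x 3 = x 4 ∧ x 3 = x 5 ∧ x 1 ^ 2 + x 2 ^ 2 = x 0 ^ 2 + x 3 ^ 2,
    fun x => x 0 = x 1 ∧ x 2 = x 3 ∧ x 4 = x 5,
    fun x => x 0 = x 2 ∧ x 0 = x 3 ∧ x 0 = x 4 ∧ (s - 3) * x 5 = (s + 9) * x 0,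
    fun x => x 0 = x 1 ∧ x 2 = x 3 ∧ x 2 = x 4 ∧ x 2 = x 5]

/-- The nodes whose tangent cones cut out the six families. -/
def flatNodes : Fin 6 → Finset (Fin 10) :=
  ![{4}, {4, 5}, {5, 7, 9}, {6, 7, 8, 9}, {0, 4, 6, 9}, {4, 5, 6, 7, 8, 9}]

/-- The properties of the set of coordinate vectors `λ(p)` of the members `p` of an irreducible set
of parameters that contains a smooth member. -/
structure IsSmoothIrreducible (T : Set (Fin 6 → K)) : Prop where
  sum_eq_zero : ∀ x ∈ T, x 0 + x 1 + x 2 + x 3 + x 4 + x 5 = 0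
  prime : ∀ a b : Fin 6 → K, (∀ x ∈ T, (∑ k, a k * x k) * (∑ k, b k * x k) = 0) →
    (∀ x ∈ T, ∑ k, a k * x k = 0) ∨ ∀ x ∈ T, ∑ k, b k * x k = 0
  smooth : ∃ x ∈ T, ∀ k l, k ≠ l → x k + x l ≠ 0

/-- On such a set, `xₖ² = xₗ²` forces `xₖ = xₗ`, as `xₖ = -xₗ` contains no smooth member. -/
theorem IsSmoothIrreducible.eq_of_sq_eq {T : Set (Fin 6 → K)} (hT : IsSmoothIrreducible T)
    {k l : Fin 6} (hkl : k ≠ l) (h : ∀ x ∈ T, x k ^ 2 = x l ^ 2) : ∀ x ∈ T, x k = x l := by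
  have h1 : ∀ x : Fin 6 → K, ∑ m, (Pi.single k 1 - Pi.single l 1 : Fin 6 → K) m * x m
      = x k - x l := by
    intro x
    simp [sub_mul, Pi.single_apply]
  have h2 : ∀ x : Fin 6 → K, ∑ m, (Pi.single k 1 + Pi.single l 1 : Fin 6 → K) m * x m
      = x k + x l := by
    intro x
    simp [add_mul, Pi.single_apply, Finset.sum_add_distrib]
  rcases hT.prime (Pi.single k 1 - Pi.single l 1) (Pi.single k 1 + Pi.single l 1) (by
    intro x hx
    rw [h1, h2]
    linear_combination h x hx) with h3 | h3
  · intro x hx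
    exact sub_eq_zero.1 ((h1 x).symm.trans (h3 x hx))
  · obtain ⟨x, hx, hx'⟩ := hT.smooth
    exact absurd ((h2 x).symm.trans (h3 x hx)) (hx' k l hkl)

theorem IsSmoothIrreducible.comp {T : Set (Fin 6 → K)} (hT : IsSmoothIrreducible T)
    (π : Equiv.Perm (Fin 6)) : IsSmoothIrreducible ((fun x => x ∘ π) '' T) := by
  have hs : ∀ (a x : Fin 6 → K), ∑ k, a k * (x ∘ π) k = ∑ k, (a ∘ π.symm) k * x k := by
    intro a x
    rw [← Equiv.sum_comp π.symm]
    simp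
  refine ⟨?_, ?_, ?_⟩
  · rintro _ ⟨x, hx, rfl⟩
    have h1 := hT.sum_eq_zero x hx
    rw [← Fin.sum_univ_six] at h1 ⊢
    rw [← h1]
    exact Equiv.sum_comp π x
  · intro a b h
    rcases hT.prime (a ∘ π.symm) (b ∘ π.symm) (fun x hx => by
      rw [← hs, ← hs]; exact h _ ⟨x, hx, rfl⟩) with h | h
    · left
      rintro _ ⟨x, hx, rfl⟩
      simpa only [hs] using h x hx
    · right
      rintro _ ⟨x, hx, rfl⟩
      simpa only [hs] using h x hx
  · obtain ⟨x, hx, hx'⟩ := hT.smooth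
    exact ⟨_, ⟨x, hx, rfl⟩, fun k l hkl => hx' _ _ (π.injective.ne hkl)⟩

variable [CharZero K]

omit [CharZero K] in
theorem coneVal_eq (i : Fin 10) (x : Fin 6 → K) :
    coneVal i x = side i 0 * x 0 ^ 2 + side i 1 * x 1 ^ 2 + side i 2 * x 2 ^ 2
      + side i 3 * x 3 ^ 2 + side i 4 * x 4 ^ 2 + side i 5 * x 5 ^ 2 :=
  Fin.sum_univ_six _

theorem sub_three_ne_zero {s : K} (hs : s ^ 2 = -3) : s - 3 ≠ 0 := by
  intro h
  have : (12 : K) = 0 := by linear_combination hs - (s + 3) * h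
  norm_num at this

/-- On the flat of `Y` all coordinates are determined by the first one. -/
theorem flat_Y_coords {s : K} (hs : s ^ 2 = -3) {x : Fin 6 → K}
    (hsum : x 0 + x 1 + x 2 + x 3 + x 4 + x 5 = 0) (hx : flat s 4 x) :
    x 1 = (s - 2) * x 0 ∧ x 2 = x 0 ∧ x 3 = x 0 ∧ x 4 = x 0 ∧ x 5 = (-s - 2) * x 0 := by
  obtain ⟨h2, h3, h4, h5⟩ := hx
  have e5 : x 5 = (-s - 2) * x 0 := by
    apply mul_left_cancel₀ (sub_three_ne_zero hs)
    linear_combination h5 + x 0 * hs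
  exact ⟨by linear_combination hsum - e5 + h2 + h3 + h4, h2.symm, h3.symm, h4.symm, e5⟩

theorem coneVal_eq_zero_of_flat {s : K} (hs : s ^ 2 = -3) (F : Fin 6) {x : Fin 6 → K}
    (hsum : x 0 + x 1 + x 2 + x 3 + x 4 + x 5 = 0) (hx : flat s F x) {i : Fin 10}
    (hi : i ∈ flatNodes F) : coneVal i x = 0 := by
  rw [coneVal_eq]
  fin_cases F
  · obtain rfl : i = 4 := by simpa [flatNodes] using hi
    have h : _ = _ := hx
    simp [side]
    linear_combination h
  · obtain ⟨h1, h2⟩ := hx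
    have hi' : i = 4 ∨ i = 5 := by simpa [flatNodes] using hi
    rcases hi' with rfl | rfl <;> simp [side] <;> rw [h1] <;> linear_combination h2
  · obtain ⟨h1, h2, h3⟩ := hx
    have hi' : i = 5 ∨ i = 7 ∨ i = 9 := by simpa [flatNodes] using hi
    rcases hi' with rfl | rfl | rfl <;> simp [side] <;> rw [← h1, ← h2] <;>
      linear_combination h3
  · obtain ⟨h1, h2, h3⟩ := hx
    have hi' : i = 6 ∨ i = 7 ∨ i = 8 ∨ i = 9 := by simpa [flatNodes] using hi
    rcases hi' with rfl | rfl | rfl | rfl <;> simp [side] <;> rw [h1, h2, h3] <;> ring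
  · obtain ⟨h1, h2, h3, h4, h5⟩ := flat_Y_coords hs hsum hx
    have hi' : i = 0 ∨ i = 4 ∨ i = 6 ∨ i = 9 := by simpa [flatNodes] using hi
    rcases hi' with rfl | rfl | rfl | rfl <;> simp [side] <;> rw [h1, h2, h3, h4, h5]
    · linear_combination 2 * x 0 ^ 2 * hs
    · linear_combination -2 * x 0 ^ 2 * hs
    · linear_combination -2 * x 0 ^ 2 * hs
    · linear_combination 2 * x 0 ^ 2 * hs
  · obtain ⟨h1, h2, h3, h4⟩ := hx
    have hi' : i = 4 ∨ i = 5 ∨ i = 6 ∨ i = 7 ∨ i = 8 ∨ i = 9 := by simpa [flatNodes] using hi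
    rcases hi' with rfl | rfl | rfl | rfl | rfl | rfl <;> simp [side] <;>
      rw [h1, ← h2, ← h3, ← h4] <;> ring

/-- `T` satisfies the conditions of a later family than the `F`-th, up to a permutation. -/
def Degenerates (s : K) (F : Fin 6) (T : Set (Fin 6 → K)) : Prop :=
  ∃ F' > F, ∃ π : Equiv.Perm (Fin 6), ∀ x ∈ T, flat s F' (x ∘ π)

omit [CharZero K] in
theorem Degenerates.of_map {s : K} {F : Fin 6} {T : Set (Fin 6 → K)} (F' : Fin 6) (hF : F < F')
    (f : Fin 6 → Fin 6) (hf : Function.Bijective f) (h : ∀ x ∈ T, flat s F' (x ∘ f)) :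
    Degenerates s F T :=
  ⟨F', hF, Equiv.ofBijective f hf, h⟩

variable {T : Set (Fin 6 → K)} {s : K}

theorem degenerates_CDE (hT : IsSmoothIrreducible T) (hF : ∀ x ∈ T, flat s 0 x) (i : Fin 10)
    (hi : ∀ x ∈ T, coneVal i x = 0) (hn : i ∉ flatNodes 0) : Degenerates s 0 T := by
  -- The other cones arise from `T_{023}` by exchanging an index `a` in `{0, 2, 3}` with an index
  -- `b` outside, so that `xₐ² = x_b²`.
  have hab : ∀ a b : Fin 6, a ∈ ({0, 2, 3} : Finset (Fin 6)) → b ∈ ({1, 4, 5} : Finset (Fin 6)) →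
      (∀ x ∈ T, x a ^ 2 = x b ^ 2) → Degenerates s 0 T := by
    intro a b ha hb h
    have hne : a ≠ b := by
      rintro rfl
      revert ha hb
      fin_cases a <;> decide
    have e := hT.eq_of_sq_eq hne h
    refine ⟨1, by decide, Equiv.swap 0 a * Equiv.swap 1 b, fun x hx => ⟨?_, ?_⟩⟩
    all_goals
      have e1 := e x hx
      have e2 := h x hx
      have e3 : x 0 ^ 2 + x 2 ^ 2 + x 3 ^ 2 = x 1 ^ 2 + x 4 ^ 2 + x 5 ^ 2 := hF x hx
      simp only [Finset.mem_insert, Finset.mem_singleton] at ha hb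
      rcases ha with rfl | rfl | rfl <;> rcases hb with rfl | rfl | rfl <;>
        simp [Equiv.swap_apply_def] <;> first | exact e1 | linear_combination e3 - e2
  have hP : ∀ x ∈ T, x 0 ^ 2 + x 2 ^ 2 + x 3 ^ 2 = x 1 ^ 2 + x 4 ^ 2 + x 5 ^ 2 := hF
  have hc : ∀ x ∈ T, _ := fun x hx => (coneVal_eq i x).symm.trans (hi x hx)
  fin_cases i <;> simp [side] at hc
  · refine hab 0 4 (by decide) (by decide) fun x hx => ?_
    linear_combination (hP x hx + hc x hx) / 2
  · refine hab 0 5 (by decide) (by decide) fun x hx => ?_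
    linear_combination (hP x hx + hc x hx) / 2
  · refine hab 2 1 (by decide) (by decide) fun x hx => ?_
    linear_combination (hP x hx - hc x hx) / 2
  · refine hab 3 1 (by decide) (by decide) fun x hx => ?_
    linear_combination (hP x hx - hc x hx) / 2
  · exact absurd (by decide) hn
  · refine hab 0 1 (by decide) (by decide) fun x hx => ?_
    linear_combination (hP x hx - hc x hx) / 2
  · refine hab 3 4 (by decide) (by decide) fun x hx => ?_
    linear_combination (hP x hx - hc x hx) / 2
  · refine hab 2 5 (by decide) (by decide) fun x hx => ?_
    linear_combination (hP x hx + hc x hx) / 2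
  · refine hab 3 5 (by decide) (by decide) fun x hx => ?_
    linear_combination (hP x hx - hc x hx) / 2
  · refine hab 2 4 (by decide) (by decide) fun x hx => ?_
    linear_combination (hP x hx + hc x hx) / 2

theorem degenerates_CD (hT : IsSmoothIrreducible T) (hF : ∀ x ∈ T, flat s 1 x) (i : Fin 10)
    (hi : ∀ x ∈ T, coneVal i x = 0) (hn : i ∉ flatNodes 1) : Degenerates s 1 T := by
  have h1 : ∀ x ∈ T, x 0 = x 1 := fun x hx => (hF x hx).1
  have hq : ∀ x ∈ T, x 0 ^ 2 = x 1 ^ 2 := fun x hx => by rw [h1 x hx]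
  have hP : ∀ x ∈ T, x 2 ^ 2 + x 3 ^ 2 = x 4 ^ 2 + x 5 ^ 2 := fun x hx => (hF x hx).2
  have hc : ∀ x ∈ T, _ := fun x hx => (coneVal_eq i x).symm.trans (hi x hx)
  fin_cases i <;> simp [side] at hc
  · have e : ∀ x ∈ T, x 1 ^ 2 = x 4 ^ 2 := fun x hx => by
      linear_combination (hc x hx + hP x hx - hq x hx) / 2
    exact .of_map 2 (by decide) ![5, 2, 3, 1, 0, 4] (by decide) fun x hx =>
      ⟨(h1 x hx).symm, hT.eq_of_sq_eq (by decide) e x hx, by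
        simp only [Function.comp_apply, Matrix.cons_val]
        linear_combination hP x hx - e x hx⟩
  · have e : ∀ x ∈ T, x 1 ^ 2 = x 5 ^ 2 := fun x hx => by
      linear_combination (hc x hx + hP x hx - hq x hx) / 2
    exact .of_map 2 (by decide) ![4, 2, 3, 1, 0, 5] (by decide) fun x hx =>
      ⟨(h1 x hx).symm, hT.eq_of_sq_eq (by decide) e x hx, by
        simp only [Function.comp_apply, Matrix.cons_val]
        linear_combination hP x hx - e x hx⟩
  · have e : ∀ x ∈ T, x 1 ^ 2 = x 2 ^ 2 := fun x hx => by
      linear_combination (hc x hx - hP x hx - hq x hx) / 2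
    exact .of_map 2 (by decide) ![3, 4, 5, 1, 0, 2] (by decide) fun x hx =>
      ⟨(h1 x hx).symm, hT.eq_of_sq_eq (by decide) e x hx, by
        simp only [Function.comp_apply, Matrix.cons_val]
        linear_combination -hP x hx - e x hx⟩
  · have e : ∀ x ∈ T, x 1 ^ 2 = x 3 ^ 2 := fun x hx => by
      linear_combination (hc x hx - hP x hx - hq x hx) / 2
    exact .of_map 2 (by decide) ![2, 4, 5, 1, 0, 3] (by decide) fun x hx =>
      ⟨(h1 x hx).symm, hT.eq_of_sq_eq (by decide) e x hx, by
        simp only [Function.comp_apply, Matrix.cons_val]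
        linear_combination -hP x hx - e x hx⟩
  · exact absurd (by decide) hn
  · exact absurd (by decide) hn
  · have e2 := hT.eq_of_sq_eq (k := 2) (l := 5) (by decide) fun x hx => by
      linear_combination (hP x hx + hc x hx - hq x hx) / 2
    have e3 := hT.eq_of_sq_eq (k := 3) (l := 4) (by decide) fun x hx => by
      linear_combination (hP x hx - hc x hx + hq x hx) / 2
    exact .of_map 3 (by decide) ![0, 1, 2, 5, 3, 4] (by decide) fun x hx =>
      ⟨h1 x hx, e2 x hx, e3 x hx⟩
  · have e2 := hT.eq_of_sq_eq (k := 2) (l := 5) (by decide) fun x hx => by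
      linear_combination (hP x hx + hc x hx + hq x hx) / 2
    have e3 := hT.eq_of_sq_eq (k := 3) (l := 4) (by decide) fun x hx => by
      linear_combination (hP x hx - hc x hx - hq x hx) / 2
    exact .of_map 3 (by decide) ![0, 1, 2, 5, 3, 4] (by decide) fun x hx =>
      ⟨h1 x hx, e2 x hx, e3 x hx⟩
  · have e2 := hT.eq_of_sq_eq (k := 2) (l := 4) (by decide) fun x hx => by
      linear_combination (hP x hx + hc x hx - hq x hx) / 2
    have e3 := hT.eq_of_sq_eq (k := 3) (l := 5) (by decide) fun x hx => by
      linear_combination (hP x hx - hc x hx + hq x hx) / 2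
    exact .of_map 3 (by decide) ![0, 1, 2, 4, 3, 5] (by decide) fun x hx =>
      ⟨h1 x hx, e2 x hx, e3 x hx⟩
  · have e2 := hT.eq_of_sq_eq (k := 2) (l := 4) (by decide) fun x hx => by
      linear_combination (hP x hx + hc x hx + hq x hx) / 2
    have e3 := hT.eq_of_sq_eq (k := 3) (l := 5) (by decide) fun x hx => by
      linear_combination (hP x hx - hc x hx - hq x hx) / 2
    exact .of_map 3 (by decide) ![0, 1, 2, 4, 3, 5] (by decide) fun x hx =>
      ⟨h1 x hx, e2 x hx, e3 x hx⟩

theorem degenerates_B (hs : s ^ 2 = -3) (hT : IsSmoothIrreducible T)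
    (hF : ∀ x ∈ T, flat s 2 x) (i : Fin 10)
    (hi : ∀ x ∈ T, coneVal i x = 0) (hn : i ∉ flatNodes 2) : Degenerates s 2 T := by
  have h4 : ∀ x ∈ T, x 3 = x 4 := fun x hx => (hF x hx).1
  have h5 : ∀ x ∈ T, x 3 = x 5 := fun x hx => (hF x hx).2.1
  have hP : ∀ x ∈ T, x 1 ^ 2 + x 2 ^ 2 = x 0 ^ 2 + x 3 ^ 2 := fun x hx => (hF x hx).2.2
  have q4 : ∀ x ∈ T, x 3 ^ 2 = x 4 ^ 2 := fun x hx => by rw [h4 x hx]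
  have q5 : ∀ x ∈ T, x 3 ^ 2 = x 5 ^ 2 := fun x hx => by rw [h5 x hx]
  -- One of the coordinates `x₁`, `x₂` equals `x₃ = x₄ = x₅`, and the other one equals `x₀`.
  have h012 : (∀ x ∈ T, x 0 ^ 2 + x 1 ^ 2 = x 2 ^ 2 + x 3 ^ 2) → Degenerates s 2 T := by
    intro h
    have e0 := hT.eq_of_sq_eq (k := 0) (l := 2) (by decide) fun x hx => by
      linear_combination (h x hx - hP x hx) / 2
    have e1 := hT.eq_of_sq_eq (k := 1) (l := 3) (by decide) fun x hx => by
      linear_combination (h x hx + hP x hx) / 2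
    exact .of_map 5 (by decide) ![0, 2, 1, 3, 4, 5] (by decide) fun x hx =>
      ⟨e0 x hx, e1 x hx, (e1 x hx).trans (h4 x hx), (e1 x hx).trans (h5 x hx)⟩
  have h021 : (∀ x ∈ T, x 0 ^ 2 + x 2 ^ 2 = x 1 ^ 2 + x 3 ^ 2) → Degenerates s 2 T := by
    intro h
    have e0 := hT.eq_of_sq_eq (k := 0) (l := 1) (by decide) fun x hx => by
      linear_combination (h x hx - hP x hx) / 2
    have e1 := hT.eq_of_sq_eq (k := 2) (l := 3) (by decide) fun x hx => by
      linear_combination (h x hx + hP x hx) / 2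
    exact .of_map 5 (by decide) ![0, 1, 2, 3, 4, 5] (by decide) fun x hx =>
      ⟨e0 x hx, e1 x hx, (e1 x hx).trans (h4 x hx), (e1 x hx).trans (h5 x hx)⟩
  have hc : ∀ x ∈ T, _ := fun x hx => (coneVal_eq i x).symm.trans (hi x hx)
  fin_cases i <;> simp [side] at hc
  · exact h012 fun x hx => by linear_combination hc x hx - q4 x hx + q5 x hx
  · exact h012 fun x hx => by linear_combination hc x hx + q4 x hx - q5 x hx
  · exact h012 fun x hx => by linear_combination hc x hx - q4 x hx - q5 x hx
  · -- Here `x₀ = x₃ = x₄ = x₅ = t`, and `x₁`, `x₂` are the roots of `X² + 4tX + 7t²`.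
    have e0 := hT.eq_of_sq_eq (k := 0) (l := 3) (by decide) fun x hx => by
      linear_combination (hc x hx - q4 x hx - q5 x hx - hP x hx) / 2
    have e1 : ∀ x ∈ T, x 1 = -x 2 - 4 * x 3 := fun x hx => by
      linear_combination hT.sum_eq_zero x hx - e0 x hx + h4 x hx + h5 x hx
    rcases hT.prime ![0, 0, 1, s + 2, 0, 0] ![0, 0, 1, 2 - s, 0, 0] (fun x hx => by
      have h := hP x hx
      rw [e1 x hx, e0 x hx] at h
      simp only [Fin.sum_univ_six, Matrix.cons_val]
      linear_combination h / 2 - x 3 ^ 2 * hs) with h | h <;>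
      simp [Fin.sum_univ_six] at h
    · exact .of_map 4 (by decide) ![3, 1, 0, 4, 5, 2] (by decide) fun x hx =>
        ⟨(e0 x hx).symm, h4 x hx, h5 x hx, by
          simp only [Function.comp_apply, Matrix.cons_val]
          linear_combination (s - 3) * h x hx - x 3 * hs⟩
    · exact .of_map 4 (by decide) ![3, 2, 0, 4, 5, 1] (by decide) fun x hx =>
        ⟨(e0 x hx).symm, h4 x hx, h5 x hx, by
          simp only [Function.comp_apply, Matrix.cons_val]
          linear_combination (s - 3) * e1 x hx - (s - 3) * h x hx - x 3 * hs⟩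
  · exact h021 fun x hx => by linear_combination hc x hx - q4 x hx - q5 x hx
  · exact absurd (by decide) hn
  · exact h021 fun x hx => by linear_combination hc x hx + q4 x hx - q5 x hx
  · exact absurd (by decide) hn
  · exact h021 fun x hx => by linear_combination hc x hx - q4 x hx + q5 x hx
  · exact absurd (by decide) hn

theorem degenerates_C (hT : IsSmoothIrreducible T) (hF : ∀ x ∈ T, flat s 3 x) (i : Fin 10)
    (hi : ∀ x ∈ T, coneVal i x = 0) (hn : i ∉ flatNodes 3) : Degenerates s 3 T := by
  have h0 : ∀ x ∈ T, x 0 = x 1 := fun x hx => (hF x hx).1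
  have h2 : ∀ x ∈ T, x 2 = x 3 := fun x hx => (hF x hx).2.1
  have h4 : ∀ x ∈ T, x 4 = x 5 := fun x hx => (hF x hx).2.2
  have q0 : ∀ x ∈ T, x 0 ^ 2 = x 1 ^ 2 := fun x hx => by rw [h0 x hx]
  have q2 : ∀ x ∈ T, x 2 ^ 2 = x 3 ^ 2 := fun x hx => by rw [h2 x hx]
  have q4 : ∀ x ∈ T, x 4 ^ 2 = x 5 ^ 2 := fun x hx => by rw [h4 x hx]
  -- Two of the three pairs of equal coordinates coincide.
  have h24 : (∀ x ∈ T, x 2 ^ 2 = x 4 ^ 2) → Degenerates s 3 T := fun h => by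
    have e := hT.eq_of_sq_eq (by decide) h
    exact .of_map 5 (by decide) ![0, 1, 2, 3, 4, 5] (by decide) fun x hx =>
      ⟨h0 x hx, h2 x hx, e x hx, (e x hx).trans (h4 x hx)⟩
  have h02 : (∀ x ∈ T, x 0 ^ 2 = x 2 ^ 2) → Degenerates s 3 T := fun h => by
    have e := hT.eq_of_sq_eq (by decide) h
    exact .of_map 5 (by decide) ![4, 5, 0, 1, 2, 3] (by decide) fun x hx =>
      ⟨h4 x hx, h0 x hx, e x hx, (e x hx).trans (h2 x hx)⟩
  have h04 : (∀ x ∈ T, x 0 ^ 2 = x 4 ^ 2) → Degenerates s 3 T := fun h => by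
    have e := hT.eq_of_sq_eq (by decide) h
    exact .of_map 5 (by decide) ![2, 3, 0, 1, 4, 5] (by decide) fun x hx =>
      ⟨h2 x hx, h0 x hx, e x hx, (e x hx).trans (h4 x hx)⟩
  have hc : ∀ x ∈ T, _ := fun x hx => (coneVal_eq i x).symm.trans (hi x hx)
  fin_cases i <;> simp [side] at hc
  · exact h02 fun x hx => by linear_combination (hc x hx + q0 x hx + q4 x hx - q2 x hx) / 2
  · exact h02 fun x hx => by linear_combination (hc x hx + q0 x hx - q4 x hx - q2 x hx) / 2
  · exact h04 fun x hx => by linear_combination (hc x hx + q0 x hx + q2 x hx - q4 x hx) / 2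
  · exact h04 fun x hx => by linear_combination (hc x hx + q0 x hx - q2 x hx - q4 x hx) / 2
  · exact h24 fun x hx => by linear_combination (hc x hx - q0 x hx + q2 x hx - q4 x hx) / 2
  · exact h24 fun x hx => by linear_combination (hc x hx + q0 x hx + q2 x hx - q4 x hx) / 2
  all_goals exact absurd (by decide) hn

/-- The surface `Y` lies on no further tangent cone. -/
theorem not_cone_Y (hs : s ^ 2 = -3) (hT : IsSmoothIrreducible T) (hF : ∀ x ∈ T, flat s 4 x)
    (i : Fin 10) (hi : ∀ x ∈ T, coneVal i x = 0) (hn : i ∉ flatNodes 4) : False := by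
  obtain ⟨x, hx, hx'⟩ := hT.smooth
  obtain ⟨h1, h2, h3, h4, h5⟩ := flat_Y_coords hs (hT.sum_eq_zero x hx) (hF x hx)
  have h0 : x 0 ≠ 0 := fun h => hx' 0 2 (by decide) (by rw [h2, h, add_zero])
  have hc := (coneVal_eq i x).symm.trans (hi x hx)
  rw [h1, h2, h3, h4, h5] at hc
  have h8 : 8 * s * x 0 ^ 2 ≠ 0 :=
    mul_ne_zero (mul_ne_zero (by norm_num) (ne_zero_of_sq_eq hs)) (pow_ne_zero 2 h0)
  fin_cases i <;> first | exact absurd (by decide) hn | simp [side] at hc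
  all_goals first
    | exact h8 (by linear_combination hc)
    | exact h8 (by linear_combination -hc)

/-- The Fermat quartic lies on no further tangent cone. -/
theorem not_cone_F4 (hT : IsSmoothIrreducible T) (hF : ∀ x ∈ T, flat s 5 x)
    (i : Fin 10) (hi : ∀ x ∈ T, coneVal i x = 0) (hn : i ∉ flatNodes 5) : False := by
  have h02 : ∀ x ∈ T, x 0 ^ 2 = x 2 ^ 2 := by
    intro x hx
    obtain ⟨h1, h3, h4, h5⟩ := hF x hx
    have hc := (coneVal_eq i x).symm.trans (hi x hx)
    rw [← h1, ← h3, ← h4, ← h5] at hc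
    fin_cases i <;> first | exact absurd (by decide) hn | simp [side] at hc
    all_goals linear_combination hc / 2
  obtain ⟨x, hx, hx'⟩ := hT.smooth
  have e := hT.eq_of_sq_eq (by decide) h02 x hx
  obtain ⟨h1, h3, h4, h5⟩ := hF x hx
  refine hx' 0 1 (by decide) ?_
  linear_combination (hT.sum_eq_zero x hx + 4 * e + h3 + h4 + h5 - 2 * h1) / 3

/-- If the coordinate vectors satisfy the conditions of the `F`-th family and lie on one more
tangent cone, then they satisfy the conditions of a later family. -/
theorem flat_step (hs : s ^ 2 = -3) (hT : IsSmoothIrreducible T) (F : Fin 6)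
    (hF : ∀ x ∈ T, flat s F x) (i : Fin 10) (hi : ∀ x ∈ T, coneVal i x = 0)
    (hn : i ∉ flatNodes F) : Degenerates s F T := by
  fin_cases F
  · exact degenerates_CDE hT hF i hi hn
  · exact degenerates_CD hT hF i hi hn
  · exact degenerates_B hs hT hF i hi hn
  · exact degenerates_C hT hF i hi hn
  · exact (not_cone_Y hs hT hF i hi hn).elim
  · exact (not_cone_F4 hT hF i hi hn).elim

omit [CharZero K] in
/-- Every tangent cone is a permutation of the first family's cone. -/
theorem exists_flat_CDE_of_cone (i : Fin 10) :
    ∃ π : Equiv.Perm (Fin 6), ∀ x : Fin 6 → K, coneVal i x = 0 → flat s 0 (x ∘ π) := by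
  have key : ∀ f : Fin 6 → Fin 6, Function.Bijective f →
      (∀ x : Fin 6 → K, coneVal i x = 0 → flat s 0 (x ∘ f)) →
      ∃ π : Equiv.Perm (Fin 6), ∀ x : Fin 6 → K, coneVal i x = 0 → flat s 0 (x ∘ π) :=
    fun f hf h => ⟨Equiv.ofBijective f hf, h⟩
  have hflat : ∀ y : Fin 6 → K,
      y 0 ^ 2 + y 2 ^ 2 + y 3 ^ 2 - (y 1 ^ 2 + y 4 ^ 2 + y 5 ^ 2) = 0 → flat s 0 y :=
    fun y hy => sub_eq_zero.1 hy
  simp only [coneVal_eq] at key ⊢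
  fin_cases i <;> simp [side] at key ⊢
  · exact key ![0, 2, 1, 5, 3, 4] (by decide) fun x hx => hflat _ (by
      simp only [Function.comp_apply, Matrix.cons_val]
      linear_combination hx)
  · exact key ![0, 2, 1, 4, 3, 5] (by decide) fun x hx => hflat _ (by
      simp only [Function.comp_apply, Matrix.cons_val]
      linear_combination hx)
  · exact key ![0, 2, 1, 3, 4, 5] (by decide) fun x hx => hflat _ (by
      simp only [Function.comp_apply, Matrix.cons_val]
      linear_combination hx)
  · exact key ![0, 3, 1, 2, 4, 5] (by decide) fun x hx => hflat _ (by
      simp only [Function.comp_apply, Matrix.cons_val]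
      linear_combination hx)
  · exact key ![0, 1, 2, 3, 4, 5] (by decide) fun x hx => hflat _ (by
      simp only [Function.comp_apply, Matrix.cons_val]
      linear_combination hx)
  · exact key ![1, 0, 2, 3, 4, 5] (by decide) fun x hx => hflat _ (by
      simp only [Function.comp_apply, Matrix.cons_val]
      linear_combination hx)
  · exact key ![0, 1, 2, 4, 3, 5] (by decide) fun x hx => hflat _ (by
      simp only [Function.comp_apply, Matrix.cons_val]
      linear_combination hx)
  · exact key ![1, 0, 2, 4, 3, 5] (by decide) fun x hx => hflat _ (by
      simp only [Function.comp_apply, Matrix.cons_val]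
      linear_combination hx)
  · exact key ![0, 1, 2, 5, 3, 4] (by decide) fun x hx => hflat _ (by
      simp only [Function.comp_apply, Matrix.cons_val]
      linear_combination hx)
  · exact key ![1, 0, 2, 5, 3, 4] (by decide) fun x hx => hflat _ (by
      simp only [Function.comp_apply, Matrix.cons_val]
      linear_combination hx)

/-- On the intersection of the tangent cones at the nodes of the `F`-th family the conditions of
that family hold, except that `√-3` may be replaced by `-√-3` in the case of `Y`. -/
theorem flat_of_cones (hs : s ^ 2 = -3) (hT : IsSmoothIrreducible T) (F : Fin 6)
    (hi : ∀ i ∈ flatNodes F, ∀ x ∈ T, coneVal i x = 0) :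
    (∀ x ∈ T, flat s F x) ∨ (F = 4 ∧ ∀ x ∈ T, flat s 4 (x ∘ Equiv.swap 1 5)) := by
  have hc : ∀ i ∈ flatNodes F, ∀ x ∈ T, _ := fun i hiF x hx =>
    (coneVal_eq i x).symm.trans (hi i hiF x hx)
  fin_cases F
  · left
    intro x hx
    have h4 := hc 4 (by decide) x hx
    simp [side] at h4
    exact sub_eq_zero.1 (by linear_combination h4)
  · left
    have h4 := hc 4 (by decide)
    have h5 := hc 5 (by decide)
    simp [side] at h4 h5
    have e := hT.eq_of_sq_eq (k := 0) (l := 1) (by decide) fun x hx => by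
      linear_combination (h4 x hx - h5 x hx) / 2
    exact fun x hx => ⟨e x hx, by linear_combination (h4 x hx + h5 x hx) / 2⟩
  · left
    have h5 := hc 5 (by decide)
    have h7 := hc 7 (by decide)
    have h9 := hc 9 (by decide)
    simp [side] at h5 h7 h9
    have e4 := hT.eq_of_sq_eq (k := 3) (l := 4) (by decide) fun x hx => by
      linear_combination (h5 x hx - h7 x hx) / 2
    have e5 := hT.eq_of_sq_eq (k := 3) (l := 5) (by decide) fun x hx => by
      linear_combination (h5 x hx - h9 x hx) / 2
    exact fun x hx => ⟨e4 x hx, e5 x hx, by linear_combination (h7 x hx + h9 x hx) / 2⟩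
  · left
    have h6 := hc 6 (by decide)
    have h7 := hc 7 (by decide)
    have h8 := hc 8 (by decide)
    simp [side] at h6 h7 h8
    have e0 := hT.eq_of_sq_eq (k := 0) (l := 1) (by decide) fun x hx => by
      linear_combination (h6 x hx - h7 x hx) / 2
    have e2 := hT.eq_of_sq_eq (k := 2) (l := 3) (by decide) fun x hx => by
      linear_combination (h7 x hx + h8 x hx) / 2
    have e4 := hT.eq_of_sq_eq (k := 4) (l := 5) (by decide) fun x hx => by
      linear_combination (h6 x hx - h8 x hx) / 2
    exact fun x hx => ⟨e0 x hx, e2 x hx, e4 x hx⟩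
  · have h0 := hc 0 (by decide)
    have h4 := hc 4 (by decide)
    have h6 := hc 6 (by decide)
    have h9 := hc 9 (by decide)
    simp [side] at h0 h4 h6 h9
    have e2 := hT.eq_of_sq_eq (k := 0) (l := 2) (by decide) fun x hx => by
      linear_combination (h0 x hx - h9 x hx) / 2
    have e3 := hT.eq_of_sq_eq (k := 0) (l := 3) (by decide) fun x hx => by
      linear_combination (h0 x hx + h6 x hx) / 2
    have e4 := hT.eq_of_sq_eq (k := 0) (l := 4) (by decide) fun x hx => by
      linear_combination (h0 x hx + h4 x hx) / 2
    have e1 : ∀ x ∈ T, x 1 = -x 5 - 4 * x 0 := fun x hx => by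
      linear_combination hT.sum_eq_zero x hx + e2 x hx + e3 x hx + e4 x hx
    rcases hT.prime ![s + 2, 0, 0, 0, 0, 1] ![2 - s, 0, 0, 0, 0, 1] (fun x hx => by
      have h := h0 x hx
      rw [e1 x hx, ← e2 x hx, ← e3 x hx, ← e4 x hx] at h
      simp only [Fin.sum_univ_six, Matrix.cons_val]
      linear_combination h / 2 - x 0 ^ 2 * hs) with h | h <;>
      simp [Fin.sum_univ_six] at h
    · exact Or.inl fun x hx => ⟨e2 x hx, e3 x hx, e4 x hx, by
        linear_combination (s - 3) * h x hx - x 0 * hs⟩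
    · refine Or.inr ⟨rfl, fun x hx => ⟨e2 x hx, e3 x hx, e4 x hx, ?_⟩⟩
      simp only [Function.comp_apply, Equiv.swap_apply_right,
        Equiv.swap_apply_of_ne_of_ne (show (0 : Fin 6) ≠ 1 by decide) (show (0 : Fin 6) ≠ 5 by decide)]
      linear_combination (s - 3) * e1 x hx - (s - 3) * h x hx - x 0 * hs
  · left
    have h4 := hc 4 (by decide)
    have h6 := hc 6 (by decide)
    have h7 := hc 7 (by decide)
    have h8 := hc 8 (by decide)
    have h9 := hc 9 (by decide)
    simp [side] at h4 h6 h7 h8 h9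
    have e0 := hT.eq_of_sq_eq (k := 0) (l := 1) (by decide) fun x hx => by
      linear_combination (h6 x hx - h7 x hx) / 2
    have e3 := hT.eq_of_sq_eq (k := 2) (l := 3) (by decide) fun x hx => by
      linear_combination (h7 x hx + h8 x hx) / 2
    have e4 := hT.eq_of_sq_eq (k := 2) (l := 4) (by decide) fun x hx => by
      linear_combination (h4 x hx + h9 x hx) / 2
    have e5 := hT.eq_of_sq_eq (k := 2) (l := 5) (by decide) fun x hx => by
      linear_combination (h4 x hx + h7 x hx) / 2
    exact fun x hx => ⟨e0 x hx, e3 x hx, e4 x hx, e5 x hx⟩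

end Flats

/-! ### The six families -/

section SixFamilies

variable {K : Type*} [Field K]

theorem flat_smul {s : K} {F : Fin 6} {x : Fin 6 → K} (h : flat s F x) (a : K) :
    flat s F (a • x) := by
  fin_cases F
  · have h' : x 0 ^ 2 + x 2 ^ 2 + x 3 ^ 2 = x 1 ^ 2 + x 4 ^ 2 + x 5 ^ 2 := h
    change (a * x 0) ^ 2 + (a * x 2) ^ 2 + (a * x 3) ^ 2
      = (a * x 1) ^ 2 + (a * x 4) ^ 2 + (a * x 5) ^ 2
    linear_combination a ^ 2 * h'
  · obtain ⟨h1, h2⟩ := h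
    refine ⟨congrArg (a * ·) h1, ?_⟩
    simp only [Pi.smul_apply, smul_eq_mul]
    linear_combination a ^ 2 * h2
  · obtain ⟨h1, h2, h3⟩ := h
    refine ⟨congrArg (a * ·) h1, congrArg (a * ·) h2, ?_⟩
    simp only [Pi.smul_apply, smul_eq_mul]
    linear_combination a ^ 2 * h3
  · obtain ⟨h1, h2, h3⟩ := h
    exact ⟨congrArg (a * ·) h1, congrArg (a * ·) h2, congrArg (a * ·) h3⟩
  · obtain ⟨h1, h2, h3, h4⟩ := h
    refine ⟨congrArg (a * ·) h1, congrArg (a * ·) h2, congrArg (a * ·) h3, ?_⟩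
    simp only [Pi.smul_apply, smul_eq_mul]
    linear_combination a * h4
  · obtain ⟨h1, h2, h3, h4⟩ := h
    exact ⟨congrArg (a * ·) h1, congrArg (a * ·) h2, congrArg (a * ·) h3, congrArg (a * ·) h4⟩

theorem flat_lam_mk {s : K} {F : Fin 6} {v : Fin 5 → K} (hv : v ≠ 0) (h : flat s F (lam v)) :
    flat s F (lam (Projectivization.mk K v hv).rep) := by
  obtain ⟨a, ha⟩ := Projectivization.exists_smul_eq_mk_rep K v hv
  rw [← ha, Units.smul_def, lam_smul]
  exact flat_smul h _

theorem vec_ne_zero {v : Fin 5 → K} (h : v 0 ≠ 0) : v ≠ 0 :=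
  fun h0 => h (congrFun h0 0)

theorem point_eq_mk {A B C D E : K} (hA : A ≠ 0) {v : Fin 5 → K} (hv : v ≠ 0) {a : K}
    (ha : a ≠ 0) (h0 : v 0 = a * A) (h1 : v 1 = a * B) (h2 : v 2 = a * C) (h3 : v 3 = a * D)
    (h4 : v 4 = a * E) : point A B C D E hA = Projectivization.mk K v hv := by
  rw [point, Projectivization.mk_eq_mk_iff']
  refine ⟨a⁻¹, funext fun k => ?_⟩
  fin_cases k <;> simp [h0, h1, h2, h3, h4, ha]

theorem isIrreducible_familyCDE [Infinite K] : IsIrreducible (familyCDE K) := by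
  refine isIrreducible_of_param (σ := Fin 4)
    (P := fun a => ![a 0 ^ 2, a 2 * a 3 - 2 * a 0 * a 1, a 0 * a 1, a 0 * a 2, a 0 * a 3])
    (N := fun a => a 0) (fun i => ?_) (IsPoly.coord 0)
    (fun a ha => vec_ne_zero (by simpa using ha)) ⟨point 1 0 0 0 0 one_ne_zero, 1, 0, 0, 0,
      one_ne_zero, by congr 1; norm_num⟩ fun p => ⟨?_, ?_⟩
  · have c : ∀ k, IsPoly (fun v : Fin 4 → K => v k) := IsPoly.coord
    fin_cases i
    · exact (c 0).pow 2
    · exact ((c 2).mul (c 3)).sub (((IsPoly.const 2).mul (c 0)).mul (c 1))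
    · exact (c 0).mul (c 1)
    · exact (c 0).mul (c 2)
    · exact (c 0).mul (c 3)
  · rintro ⟨A, C, D, E, hA, rfl⟩
    refine ⟨![A, C, D, E], hA, point_eq_mk hA _ hA ?_ ?_ ?_ ?_ ?_⟩ <;> simp [sq]
    field_simp
  · rintro ⟨a, ha, rfl⟩
    refine ⟨a 0, a 1, a 2, a 3, ha, (point_eq_mk ha _ ha ?_ ?_ ?_ ?_ ?_).symm⟩ <;> simp [sq]
    field_simp

theorem isIrreducible_familyCD [Infinite K] : IsIrreducible (familyCD K) := by
  refine isIrreducible_of_param (σ := Fin 3)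
    (P := fun a => ![a 0 * a 2, 0, a 1 * a 2, a 2 ^ 2, 2 * a 0 * a 1])
    (N := fun a => a 0 * a 2) (fun i => ?_) ((IsPoly.coord 0).mul (IsPoly.coord 2))
    (fun a ha => vec_ne_zero (by simpa using ha)) ⟨point 1 0 0 1 0 one_ne_zero, 1, 0, 1,
      one_ne_zero, one_ne_zero, by congr 1; norm_num⟩ fun p => ⟨?_, ?_⟩
  · have c : ∀ k, IsPoly (fun v : Fin 3 → K => v k) := IsPoly.coord
    fin_cases i
    · exact (c 0).mul (c 2)
    · exact IsPoly.const 0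
    · exact (c 1).mul (c 2)
    · exact (c 2).pow 2
    · exact ((IsPoly.const 2).mul (c 0)).mul (c 1)
  · rintro ⟨A, C, D, hA, hD, rfl⟩
    refine ⟨![A, C, D], mul_ne_zero hA hD, point_eq_mk hA _ hD ?_ ?_ ?_ ?_ ?_⟩ <;>
      simp [sq, mul_comm]
    field_simp
  · rintro ⟨a, ha, rfl⟩
    refine ⟨a 0, a 1, a 2, left_ne_zero_of_mul ha, right_ne_zero_of_mul ha,
      (point_eq_mk (left_ne_zero_of_mul ha) _ (right_ne_zero_of_mul ha) ?_ ?_ ?_ ?_ ?_).symm⟩ <;>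
      simp [sq, mul_comm]
    have := right_ne_zero_of_mul ha
    field_simp

theorem isIrreducible_familyB [Infinite K] : IsIrreducible (familyB K) := by
  refine isIrreducible_of_param (σ := Fin 2)
    (P := fun a => ![a 0 ^ 2, a 1 * (2 * a 0 - a 1), a 0 * a 1, a 0 * a 1, a 0 * a 1])
    (N := fun a => a 0) (fun i => ?_) (IsPoly.coord 0)
    (fun a ha => vec_ne_zero (by simpa using ha)) ⟨point 1 0 0 0 0 one_ne_zero, 1, 0,
      one_ne_zero, by congr 1; norm_num⟩ fun p => ⟨?_, ?_⟩
  · have c : ∀ k, IsPoly (fun v : Fin 2 → K => v k) := IsPoly.coord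
    fin_cases i
    · exact (c 0).pow 2
    · exact (c 1).mul (((IsPoly.const 2).mul (c 0)).sub (c 1))
    · exact (c 0).mul (c 1)
    · exact (c 0).mul (c 1)
    · exact (c 0).mul (c 1)
  · rintro ⟨A, B, hA, rfl⟩
    refine ⟨![A, B], hA, point_eq_mk hA _ hA ?_ ?_ ?_ ?_ ?_⟩ <;> simp [sq]
    field_simp
  · rintro ⟨a, ha, rfl⟩
    refine ⟨a 0, a 1, ha, (point_eq_mk ha _ ha ?_ ?_ ?_ ?_ ?_).symm⟩ <;> simp [sq]
    field_simp

theorem isIrreducible_familyC [Infinite K] : IsIrreducible (familyC K) := by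
  refine isIrreducible_of_param (σ := Fin 2) (P := fun a => ![a 0, 0, a 1, 0, 0])
    (N := fun a => a 0) (fun i => ?_) (IsPoly.coord 0)
    (fun a ha => vec_ne_zero (by simpa using ha)) ⟨point 1 0 0 0 0 one_ne_zero, 1, 0,
      one_ne_zero, rfl⟩ fun p => ⟨?_, ?_⟩
  · have c : ∀ k, IsPoly (fun v : Fin 2 → K => v k) := IsPoly.coord
    fin_cases i
    · exact c 0
    · exact IsPoly.const 0
    · exact c 1
    · exact IsPoly.const 0
    · exact IsPoly.const 0
  · rintro ⟨A, C, hA, rfl⟩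
    exact ⟨![A, C], hA, rfl⟩
  · rintro ⟨a, ha, rfl⟩
    exact ⟨a 0, a 1, ha, rfl⟩

theorem isForm_segreVal : IsForm (segreVal (K := K)) 3 := by
  have c : ∀ k, IsForm (fun v : Fin 5 → K => v k) 1 := IsForm.coord
  have h := (((((c 0).pow 3).const_mul 16).add ((c 0).mul ((c 1).pow 2))).sub
    (((c 0).mul ((((c 2).pow 2).add ((c 3).pow 2)).add ((c 4).pow 2))).const_mul 4)).add
    ((((c 2).mul (c 3)).mul (c 4)).const_mul 4)
  convert h using 2
  simp only [segreVal]
  ring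

variable [CharZero K] {s : K} (hs : s ^ 2 = -3)

/-- The six families, indexed as the conditions `flat`. -/
def fam (s : K) (hs : s ^ 2 = -3) : Fin 6 → Set (P4 K) :=
  ![familyCDE K, familyCD K, familyB K, familyC K, {pointY s hs}, {pointF4 K}]

theorem mem_listedFamilies_iff (F : Set (P4 K)) :
    F ∈ listedFamilies s hs ↔ ∃ k, F = fam s hs k := by
  simp [listedFamilies, Fin.exists_fin_succ, fam]

theorem isIrreducible_fam (F : Fin 6) : IsIrreducible (fam s hs F) := by
  fin_cases F
  · exact isIrreducible_familyCDE
  · exact isIrreducible_familyCD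
  · exact isIrreducible_familyB
  · exact isIrreducible_familyC
  · exact isIrreducible_singleton
  · exact isIrreducible_singleton

theorem flat_of_mem_fam (F : Fin 6) {p : P4 K} (hp : p ∈ fam s hs F) :
    flat s F (lam p.rep) := by
  fin_cases F
  · obtain ⟨A, C, D, E, hA, rfl⟩ := hp
    refine flat_lam_mk _ ?_
    refine sub_eq_zero.1 ?_
    simp [lam]
    field_simp
    ring
  · obtain ⟨A, C, D, hA, hD, rfl⟩ := hp
    refine flat_lam_mk _ ⟨by simp [lam], ?_⟩
    simp [lam]
    field_simp
    ring
  · obtain ⟨A, B, hA, rfl⟩ := hp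
    refine flat_lam_mk _ ⟨by simp [lam], by simp [lam], ?_⟩
    simp [lam]
    field_simp
    ring
  · obtain ⟨A, C, hA, rfl⟩ := hp
    exact flat_lam_mk _ ⟨by simp [lam], by simp [lam], by simp [lam]⟩
  · obtain rfl : p = pointY s hs := hp
    refine flat_lam_mk _ ⟨?_, ?_, ?_, ?_⟩ <;> simp [lam] <;> ring
  · obtain rfl : p = pointF4 K := hp
    exact flat_lam_mk _ ⟨by simp [lam], by simp [lam], by simp [lam], by simp [lam]⟩

/-- The members with `B = 0` and `DE = 2AC` form an irreducible set, in which `D ≠ 0` is dense. -/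
theorem mem_closure_familyCD {p : P4 K} (hA : p.rep 0 ≠ 0) (hB : p.rep 1 = 0)
    (hDE : p.rep 3 * p.rep 4 = 2 * p.rep 0 * p.rep 2) : p ∈ closure (familyCD K) := by
  have c : ∀ k, IsPoly (fun v : Fin 3 → K => v k) := IsPoly.coord
  have hne : ∀ a : Fin 3 → K, a 0 ≠ 0 → (![2 * a 0 ^ 2, 0, a 1 * a 2, 2 * a 0 * a 1,
    2 * a 0 * a 2] : Fin 5 → K) ≠ 0 := fun a ha => vec_ne_zero (by simpa using ha)
  have hmem : ∀ (a : Fin 3 → K) (ha : a 0 ≠ 0), a 1 ≠ 0 →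
      Projectivization.mk K _ (hne a ha) ∈ familyCD K := by
    intro a ha hD
    refine ⟨2 * a 0 ^ 2, a 1 * a 2, 2 * a 0 * a 1, by simpa using ha, by simp [ha, hD], ?_⟩
    refine (point_eq_mk _ _ one_ne_zero ?_ ?_ ?_ ?_ ?_).symm <;> simp
    field_simp
  have hirr := isIrreducible_of_param (σ := Fin 3)
    (P := fun a => ![2 * a 0 ^ 2, 0, a 1 * a 2, 2 * a 0 * a 1, 2 * a 0 * a 2])
    (N := fun a => a 0) (fun i => by
      fin_cases i
      · exact (IsPoly.const 2).mul ((c 0).pow 2)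
      · exact IsPoly.const 0
      · exact (c 1).mul (c 2)
      · exact ((IsPoly.const 2).mul (c 0)).mul (c 1)
      · exact ((IsPoly.const 2).mul (c 0)).mul (c 2)) (c 0) hne
    (F := {q | ∃ (a : Fin 3 → K) (ha : a 0 ≠ 0), q = Projectivization.mk K _ (hne a ha)})
    ⟨_, ![1, 1, 0], one_ne_zero, rfl⟩ fun q => Iff.rfl
  have hp : p ∈ {q : P4 K | ∃ (a : Fin 3 → K) (ha : a 0 ≠ 0),
      q = Projectivization.mk K _ (hne a ha)} := by
    refine ⟨![p.rep 0, p.rep 3, p.rep 4], hA, ?_⟩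
    refine p.mk_rep.symm.trans ((Projectivization.mk_eq_mk_iff' _ _ _ _ _).2
      ⟨(2 * p.rep 0)⁻¹, funext fun k => ?_⟩)
    fin_cases k <;> simp [hB, hDE] <;> field_simp
  refine closure_mono ?_ (subset_closure_inter_of_isPreirreducible_of_isOpen
    hirr.isPreirreducible (IsForm.coord 3).isOpen_ne ?_ hp)
  · rintro _ ⟨⟨a, ha, rfl⟩, hq⟩
    refine hmem a ha fun h0 => hq ?_
    exact ((IsForm.coord 3).mk_rep_eq_zero_iff _ _).2 (by simp [h0])
  · refine ⟨_, ⟨![1, 1, 0], one_ne_zero, rfl⟩, ?_⟩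
    exact ((IsForm.coord 3).mk_rep_eq_zero_iff _ _).not.2 (by simp)

/-- A parameter with `A ≠ 0` that satisfies the conditions of a family lies in its closure. -/
theorem mem_closure_fam_of_flat (F : Fin 6) {p : P4 K} (hA : p.rep 0 ≠ 0)
    (hp : flat s F (lam p.rep)) : p ∈ closure (fam s hs F) := by
  have hmk : ∀ {B C D E a : K} (hA' : a ≠ 0), p.rep 1 = p.rep 0 / a * B →
      p.rep 2 = p.rep 0 / a * C → p.rep 3 = p.rep 0 / a * D → p.rep 4 = p.rep 0 / a * E →
      p = point a B C D E hA' := by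
    intro B C D E a hA' h1 h2 h3 h4
    rw [point_eq_mk (v := p.rep) hA' p.rep_nonzero (a := p.rep 0 / a)
      (div_ne_zero hA hA') (by field_simp) h1 h2 h3 h4, Projectivization.mk_rep]
  have hself : p.rep 0 / p.rep 0 = 1 := div_self hA
  fin_cases F
  · refine subset_closure ⟨p.rep 0, p.rep 2, p.rep 3, p.rep 4, hA, hmk hA ?_ ?_ ?_ ?_⟩ <;>
      simp only [hself, one_mul]
    have h := sub_eq_zero.2 (show _ = _ from hp)
    simp [lam] at h
    rw [eq_div_iff hA]
    linear_combination -h / 32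
  · obtain ⟨h1, h2⟩ := hp
    simp [lam] at h1 h2
    have hB : p.rep 1 = 0 := by linear_combination h1 / 2
    have hDE : p.rep 3 * p.rep 4 = 2 * p.rep 0 * p.rep 2 := by linear_combination h2 / 32
    exact mem_closure_familyCD hA hB hDE
  · obtain ⟨h1, h2, h3⟩ := hp
    simp [lam] at h1 h2 h3
    have hCD : p.rep 3 = p.rep 2 := by linear_combination h1 / 4
    have hCE : p.rep 4 = p.rep 2 := by linear_combination h2 / 4
    refine subset_closure ⟨p.rep 0, p.rep 2, hA, hmk hA ?_ ?_ ?_ ?_⟩ <;>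
      simp only [hself, one_mul, hCD, hCE]
    rw [eq_div_iff hA]
    rw [hCD, hCE] at h3
    linear_combination h3 / 32
  · obtain ⟨h1, h2, h3⟩ := hp
    simp [lam] at h1 h2 h3
    refine subset_closure ⟨p.rep 0, p.rep 2, hA, hmk hA ?_ ?_ ?_ ?_⟩ <;>
      simp only [hself, one_mul]
    · linear_combination h1 / 2
    · linear_combination -(h2 + h3) / 8
    · linear_combination (h3 - h2) / 8
  · obtain ⟨h1, h2, h3, h4⟩ := hp
    simp [lam] at h1 h2 h3 h4
    have hs0 := ne_zero_of_sq_eq hs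
    have hD : p.rep 3 = p.rep 2 := by linear_combination (h3 - h2) / 4
    have hE : p.rep 4 = -p.rep 2 := by linear_combination (h1 - h3) / 4
    have hC : p.rep 2 = p.rep 0 / s * 6 := by
      rw [hD, hE] at h1 h4
      field_simp
      linear_combination (h4 + (s + 9) * h1) / 8
    refine subset_closure (hmk hs0 ?_ hC (hD.trans hC) ?_)
    · rw [hD, hE, hC] at h1
      field_simp
      field_simp at h1
      linear_combination h1
    · rw [hE, hC]
      ring
  · obtain ⟨h1, h2, h3, h4⟩ := hp
    simp [lam] at h1 h2 h3 h4
    refine subset_closure (hmk one_ne_zero ?_ ?_ ?_ ?_)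
    · linear_combination h1 / 2
    · linear_combination (h2 - h3 - h4) / 8
    · linear_combination (h3 - h2 - h4) / 8
    · linear_combination (h4 - h2 - h3) / 8

/-- Each of the six families has a member off the hyperplanes `λᵢ + λⱼ = 0` and the Segre cubic:
the Fermat quartic, the quartic with `D` as only other nonzero coefficient, or `Y` itself. -/
theorem exists_mem_fam_ne_zero (F : Fin 6) : ∃ p ∈ fam s hs F,
    (∀ i j : Fin 6, i < j → lam p.rep i + lam p.rep j ≠ 0) ∧ segreVal p.rep ≠ 0 := by
  have key : ∀ (v : Fin 5 → K) (hv : v ≠ 0),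
      (∀ i j : Fin 6, i < j → lam v i + lam v j ≠ 0) → segreVal v ≠ 0 →
      (∀ i j : Fin 6, i < j → lam (Projectivization.mk K v hv).rep i
        + lam (Projectivization.mk K v hv).rep j ≠ 0) ∧
      segreVal (Projectivization.mk K v hv).rep ≠ 0 := fun v hv h1 h2 =>
    ⟨fun i j hij => (((isForm_lam i).add (isForm_lam j)).mk_rep_eq_zero_iff v hv).not.2
      (h1 i j hij), (isForm_segreVal.mk_rep_eq_zero_iff v hv).not.2 h2⟩
  have hF4 := key ![1, 0, 0, 0, 0] (vec_ne_zero one_ne_zero) (by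
    intro i j hij
    fin_cases i <;> fin_cases j <;> simp [lam] at hij ⊢ <;> norm_num) (by simp [segreVal])
  have hs0 := ne_zero_of_sq_eq hs
  fin_cases F
  · exact ⟨point 1 0 0 0 0 one_ne_zero, ⟨1, 0, 0, 0, one_ne_zero, by congr 1; norm_num⟩, hF4⟩
  · refine ⟨point 1 0 0 1 0 one_ne_zero, ⟨1, 0, 1, one_ne_zero, one_ne_zero, by
      congr 1; norm_num⟩, key _ _ ?_ ?_⟩
    · intro i j hij
      fin_cases i <;> fin_cases j <;> simp [lam] at hij ⊢ <;> norm_num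
    · simp [segreVal]
      norm_num
  · exact ⟨point 1 0 0 0 0 one_ne_zero, ⟨1, 0, one_ne_zero, by congr 1; norm_num⟩, hF4⟩
  · exact ⟨point 1 0 0 0 0 one_ne_zero, ⟨1, 0, one_ne_zero, rfl⟩, hF4⟩
  · refine ⟨pointY s hs, rfl, key _ _ ?_ ?_⟩
    · have hne : ∀ a b : ℚ, (a ≠ 0 ∨ b ≠ 0) → (a : K) * s + b ≠ 0 := by
        intro a b hab h0
        have h1 : ((3 * a ^ 2 + b ^ 2 : ℚ) : K) = 0 := by
          push_cast
          linear_combination (b - a * s) * h0 + (a : K) ^ 2 * hs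
        have h2 := Rat.cast_eq_zero.1 h1
        rcases hab with h | h
        · have := sq_pos_of_ne_zero h; nlinarith [sq_nonneg b]
        · have := sq_pos_of_ne_zero h; nlinarith [sq_nonneg a]
      have e1 := hne (-16) 0 (by norm_num)
      have e2 := hne 8 (-24) (by norm_num)
      have e3 := hne 8 24 (by norm_num)
      have e4 := hne (-16) 48 (by norm_num)
      push_cast at e1 e2 e3 e4
      intro i j hij
      fin_cases i <;> fin_cases j <;> simp [lam] at hij ⊢ <;> intro h0 <;>
        first
          | exact hs0 h0
          | exact e1 (by linear_combination h0)
          | exact e2 (by linear_combination h0)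
          | exact e3 (by linear_combination h0)
          | exact e4 (by linear_combination h0)
          | exact e2 (by linear_combination 2 * h0)
    · have : segreVal ![s, 12 * (s - 1), 6, 6, -6] = -768 * s := by
        simp [segreVal]
        linear_combination (160 * s - 288) * hs
      rw [this]
      simp [hs0]
  · exact ⟨point 1 0 0 0 0 one_ne_zero, rfl, hF4⟩

theorem isSmooth_of_rep {p : P4 K} (h : ∀ i j : Fin 6, i < j → lam p.rep i + lam p.rep j ≠ 0)
    (hS : segreVal p.rep ≠ 0) : IsSmooth p := by
  rw [← p.mk_rep]
  exact isSmooth_of_ne_zero _ h hS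

theorem forGeneralMember_isSmooth (F : Fin 6) : ForGeneralMember (fam s hs F) IsSmooth := by
  obtain ⟨p, hp, h1, h2⟩ := exists_mem_fam_ne_zero hs F
  refine forGeneralMember_of_forms (isIrreducible_fam hs F)
    (ι := Option {q : Fin 6 × Fin 6 // q.1 < q.2})
    (fun k v => k.elim (segreVal v) fun q => lam v q.1.1 + lam v q.1.2)
    (fun k => k.elim 3 fun _ => 1) ?_ ?_ ?_
  · rintro (_ | q)
    · exact isForm_segreVal
    · exact (isForm_lam _).add (isForm_lam _)
  · rintro (_ | q)
    · exact ⟨p, hp, h2⟩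
    · exact ⟨p, hp, h1 _ _ q.2⟩
  · exact fun p _ h => isSmooth_of_rep (fun i j hij => h (some ⟨(i, j), hij⟩)) (h none)

theorem exists_isSmooth_mem_fam (F : Fin 6) : ∃ p ∈ fam s hs F, IsSmooth p :=
  let ⟨p, hp, h1, h2⟩ := exists_mem_fam_ne_zero hs F
  ⟨p, hp, isSmooth_of_rep h1 h2⟩

theorem closure_fam_subset {F : Fin 6} {i : Fin 10} (hi : i ∈ flatNodes F) :
    closure (fam s hs F) ⊆ nodeCone i := by
  refine closure_minimal (fun p hp => ?_) (isClosed_nodeCone i)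
  rw [mem_nodeCone_iff]
  refine coneVal_eq_zero_of_flat hs F ?_ (flat_of_mem_fam hs F hp) hi
  rw [← Fin.sum_univ_six]
  exact sum_lam _

/-- The condition excludes `A = 0`, as `λ₀ + λ₁ = -16 A`. -/
theorem subset_closure_fam {F : Fin 6} {Z : Set (P4 K)} (hZ : IsIrreducible Z)
    (hA : ∃ p ∈ Z, lam p.rep 0 + lam p.rep 1 ≠ 0) (hflat : ∀ p ∈ Z, flat s F (lam p.rep)) :
    Z ⊆ closure (fam s hs F) := by
  have hopen : IsOpen {p : P4 K | p.rep 0 ≠ 0} := (IsForm.coord 0).isOpen_ne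
  obtain ⟨p, hp, hpA⟩ := hA
  have hp0 : p.rep 0 ≠ 0 := fun h0 => hpA (by simp [lam, h0])
  refine (subset_closure_inter_of_isPreirreducible_of_isOpen hZ.isPreirreducible hopen
    ⟨p, hp, hp0⟩).trans (closure_minimal ?_ isClosed_closure)
  exact fun q hq => mem_closure_fam_of_flat hs F hq.2 (hflat q hq.1)

variable [IsAlgClosed K]

theorem lam_add_ne_zero {p : P4 K} (hp : IsSmooth p) {k l : Fin 6} (hkl : k ≠ l) :
    lam p.rep k + lam p.rep l ≠ 0 := by
  rw [← p.mk_rep] at hp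
  have h := lam_add_ne_zero_of_isSmooth _ hp
  rcases lt_or_gt_of_ne hkl with h' | h'
  · exact h k l h'
  · rw [add_comm]
    exact h l k h'

theorem isSmoothIrreducible_image {Z : Set (P4 K)} (hZ : IsIrreducible Z)
    (hp : ∃ p ∈ Z, IsSmooth p) : IsSmoothIrreducible ((fun p : P4 K => lam p.rep) '' Z) := by
  refine ⟨?_, fun a b hab => ?_, ?_⟩
  · rintro _ ⟨p, -, rfl⟩
    rw [← Fin.sum_univ_six]
    exact sum_lam _
  · have hf : ∀ a : Fin 6 → K, IsForm (fun v : Fin 5 → K => ∑ k, a k * lam v k) 1 := fun a =>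
      IsForm.sum _ fun k _ => (isForm_lam k).const_mul (a k)
    refine (isPreirreducible_iff_isClosed_union_isClosed.1 hZ.isPreirreducible _ _
      (hf a).isClosed_eq (hf b).isClosed_eq fun p hp =>
        mul_eq_zero.1 (hab _ (Set.mem_image_of_mem _ hp))).imp ?_ ?_ <;>
    · rintro h _ ⟨p, hp, rfl⟩
      exact h hp
  · obtain ⟨p, hpZ, hps⟩ := hp
    exact ⟨_, ⟨p, hpZ, rfl⟩, fun k l hkl => lam_add_ne_zero hps hkl⟩

theorem isConeFamily_closure_fam (F : Fin 6) : IsConeFamily (closure (fam s hs F)) := by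
  refine ⟨flatNodes F, by fin_cases F <;> simp [flatNodes],
    ⟨(isIrreducible_fam hs F).closure, Set.subset_iInter₂ fun i hi => closure_fam_subset hs hi⟩,
    fun Z hZ hle => ?_⟩
  obtain ⟨p, hp, hps⟩ := exists_isSmooth_mem_fam hs F
  have hpZ : p ∈ Z := hle (subset_closure hp)
  have hT := isSmoothIrreducible_image hZ.1 ⟨p, hpZ, hps⟩
  rcases flat_of_cones hs hT F (by
    rintro i hi _ ⟨q, hq, rfl⟩
    exact (mem_nodeCone_iff i q).1 (Set.mem_iInter₂.1 (hZ.2 hq) i hi)) with h | ⟨rfl, h⟩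
  · exact subset_closure_fam hs hZ.1
      ⟨p, hpZ, lam_add_ne_zero hps (by decide)⟩ fun q hq => h _ ⟨q, hq, rfl⟩
  · -- The alternative is excluded: `λ₁ ≠ λ₅` at `Y`.
    exfalso
    have hsum := hT.sum_eq_zero _ ⟨p, hpZ, rfl⟩
    have c1 := flat_Y_coords hs hsum (flat_of_mem_fam hs 4 hp)
    have c2 := flat_Y_coords hs (x := lam p.rep ∘ Equiv.swap 1 5) (by
      simp only [Function.comp_apply, Equiv.swap_apply_def]
      simp
      linear_combination hsum) (h _ ⟨p, hpZ, rfl⟩)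
    have h1 : lam p.rep 5 = (s - 2) * lam p.rep 0 := by
      simpa [Equiv.swap_apply_def] using c2.1
    have h0 : lam p.rep 0 = 0 := by
      have : 2 * s * lam p.rep 0 = 0 := by linear_combination c1.2.2.2.2 - h1
      simpa [ne_zero_of_sq_eq hs] using this
    exact lam_add_ne_zero hps (k := 0) (l := 2) (by decide) (by rw [c1.2.1, h0, add_zero])

/-- Choose the last family whose conditions hold on `Z` up to a permutation of the coordinates `λ`.
By `flat_step` the given tangent cones contain the image of its closure under an element of `Ω`,
which in turn contains `Z`, so the maximality of `Z` gives equality. -/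
theorem eq_smul_closure_fam_of_isConeFamily {i : K} (hi : i ^ 2 = -1) {Z : Set (P4 K)}
    (hZ : IsConeFamily Z) (hsm : ∃ p ∈ Z, IsSmooth p) :
    ∃ g ∈ Omega i hi, ∃ F : Fin 6, Z = (fun p => g.2 • p) '' closure (fam s hs F) := by
  obtain ⟨S, ⟨i₀, hi₀⟩, ⟨hZi, hZc⟩, hmax⟩ := hZ
  have hT := isSmoothIrreducible_image hZi hsm
  have hcone : ∀ k ∈ S, ∀ x ∈ (fun p : P4 K => lam p.rep) '' Z, coneVal k x = 0 := by
    rintro k hk _ ⟨q, hq, rfl⟩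
    exact (mem_nodeCone_iff k q).1 (Set.mem_iInter₂.1 (hZc hq) k hk)
  let Q : Fin 6 → Prop := fun F => ∃ π : Equiv.Perm (Fin 6),
    ∀ x ∈ (fun p : P4 K => lam p.rep) '' Z, flat s F (x ∘ π)
  have hQ0 : ∃ F, Q F := by
    obtain ⟨π, hπ⟩ := exists_flat_CDE_of_cone (K := K) (s := s) i₀
    exact ⟨0, π, fun x hx => hπ x (hcone i₀ hi₀ x hx)⟩
  obtain ⟨F, hF, hFmax⟩ := (Set.toFinite {F | Q F}).exists_maximal hQ0
  obtain ⟨π, hπ⟩ := hF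
  -- The tangent cones at `S`, moved by `π`, are among those of the nodes of the family.
  have hnodes : ∀ k ∈ S, ∃ j ∈ flatNodes F, ∀ x : Fin 6 → K,
      coneVal k x = 0 ↔ coneVal j (x ∘ π) = 0 := by
    intro k hk
    obtain ⟨j, hj⟩ := exists_coneVal_comp (K := K) π k
    refine ⟨j, ?_, hj⟩
    by_contra hn
    obtain ⟨F', hF', ρ, hρ⟩ := flat_step hs (hT.comp π) F (by
      rintro _ ⟨x, hx, rfl⟩
      exact hπ x hx) j (by
      rintro _ ⟨x, hx, rfl⟩
      exact (hj x).1 (hcone k hk x hx)) hn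
    have : Q F' := ⟨π * ρ, fun x hx => hρ _ ⟨x, hx, rfl⟩⟩
    exact absurd hF' (not_lt_of_ge (hFmax this hF'.le))
  obtain ⟨g, hg, hgπ⟩ := exists_mem_Omega_realizes i hi π
  have hcl : ∀ h : PGL(Fin 5, K), ∀ {W : Set (P4 K)}, IsIrreducible W →
      IsIrreducible ((fun p => h • p) '' W) := fun h W hW =>
    hW.image _ (continuous_smul_P4 h).continuousOn
  have hZsub : (fun p => g.2 • p) '' Z ⊆ closure (fam s hs F) := by
    obtain ⟨q, hq, hqs⟩ := hsm
    obtain ⟨b, hb, hqb⟩ := hgπ q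
    refine subset_closure_fam hs (hcl _ hZi) ⟨_, ⟨q, hq, rfl⟩, ?_⟩ ?_
    · rw [hqb, hqb, ← mul_add]
      exact mul_ne_zero hb (lam_add_ne_zero hqs (π.injective.ne (by decide)))
    rintro _ ⟨p, hp, rfl⟩
    obtain ⟨a, ha, hpa⟩ := hgπ p
    rw [show lam (g.2 • p).rep = a • (lam p.rep ∘ π) from funext hpa]
    exact flat_smul (hπ _ ⟨p, hp, rfl⟩) a
  refine ⟨g⁻¹, inv_mem hg, F, ?_⟩
  refine Set.Subset.antisymm (fun p hp => ⟨g.2 • p, hZsub ⟨p, hp, rfl⟩, by simp⟩) ?_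
  refine hmax ⟨hcl _ (isIrreducible_fam hs F).closure, ?_⟩
    fun p hp => ⟨g.2 • p, hZsub ⟨p, hp, rfl⟩, by simp⟩
  rintro _ ⟨p, hp, rfl⟩
  refine Set.mem_iInter₂.2 fun k hk => ?_
  obtain ⟨j, hj, hjk⟩ := hnodes k hk
  rw [mem_nodeCone_iff, hjk]
  obtain ⟨a, ha, hpa⟩ := hgπ (g⁻¹.2 • p)
  have h1 := (mem_nodeCone_iff j p).1 (closure_fam_subset hs hj hp)
  have h2 : lam p.rep = a • (lam (g⁻¹.2 • p).rep ∘ π) := by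
    funext m
    have := hpa m
    simpa using this
  rw [h2, coneVal_smul] at h1
  simpa [ha] using h1

end SixFamilies

/-! ### Binary quartics and the quadric `xy = zw` -/

section Lines

variable {K : Type*} [Field K]

/-- The point `a ⊗ b` of the quadric `xy = zw`. -/
def ten (a b : Fin 2 → K) : Fin 4 → K := ![a 0 * b 0, a 1 * b 1, a 0 * b 1, a 1 * b 0]

/-- The quadratic form `xy - zw`. -/
def quad (x : Fin 4 → K) : K := x 0 * x 1 - x 2 * x 3

/-- The determinant of two vectors of the plane. -/
def dt (a b : Fin 2 → K) : K := a 0 * b 1 - a 1 * b 0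

/-- The binary quartic `s⁴ + E s²t² + t⁴`. -/
def bin (E : K) (a : Fin 2 → K) : K := a 0 ^ 4 + a 1 ^ 4 + E * a 0 ^ 2 * a 1 ^ 2

/-- The polarization of `bin E`, with three arguments `a` and one argument `b`. -/
def bin₁ (E : K) (a b : Fin 2 → K) : K :=
  a 0 ^ 3 * b 0 + a 1 ^ 3 * b 1 + E / 2 * (a 0 * b 0 * a 1 ^ 2 + a 0 ^ 2 * (a 1 * b 1))

/-- The polarization of `bin E`, with two arguments `a` and two arguments `b`. -/
def bin₂ (E : K) (a b : Fin 2 → K) : K :=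
  a 0 ^ 2 * b 0 ^ 2 + a 1 ^ 2 * b 1 ^ 2
    + E / 6 * (a 0 ^ 2 * b 1 ^ 2 + 4 * (a 0 * b 0 * a 1 * b 1) + b 0 ^ 2 * a 1 ^ 2)

/-- The coefficient vectors `[1, DE - 2C, C, D, E]`. -/
def vecCDE (C D E : K) : Fin 5 → K := ![1, D * E - 2 * C, C, D, E]

theorem dt_ne_zero_left {a b : Fin 2 → K} (h : dt a b ≠ 0) : a ≠ 0 := by
  rintro rfl
  simp [dt] at h

theorem dt_comm (a b : Fin 2 → K) : dt a b = -dt b a := by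
  simp only [dt]
  ring

theorem dt_ne_zero_symm {a b : Fin 2 → K} (h : dt a b ≠ 0) : dt b a ≠ 0 := by
  rw [dt_comm]
  exact neg_ne_zero.2 h

theorem eq_zero_of_fin_two {a : Fin 2 → K} (h0 : a 0 = 0) (h1 : a 1 = 0) : a = 0 := by
  funext k
  fin_cases k
  · exact h0
  · exact h1

theorem exists_smul_of_dt_eq_zero {a b : Fin 2 → K} (ha : a ≠ 0) (hb : b ≠ 0) (h : dt a b = 0) :
    ∃ m : K, m ≠ 0 ∧ b = m • a := by
  have key : ∃ m : K, b = m • a := by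
    simp only [dt] at h
    by_cases h0 : a 0 = 0
    · have h1 : a 1 ≠ 0 := fun h1 => ha (eq_zero_of_fin_two h0 h1)
      refine ⟨b 1 / a 1, funext fun k => ?_⟩
      fin_cases k <;> simp [h0, h1]
      simpa [h0, h1] using h
    · refine ⟨b 0 / a 0, funext fun k => ?_⟩
      fin_cases k <;> simp [h0]
      field_simp
      linear_combination h
  obtain ⟨m, rfl⟩ := key
  exact ⟨m, fun h0 => hb (by simp [h0]), rfl⟩

theorem exists_dt_eq_one {a : Fin 2 → K} (ha : a ≠ 0) : ∃ b, dt a b = 1 := by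
  by_cases h0 : a 0 = 0
  · have h1 : a 1 ≠ 0 := fun h1 => ha (eq_zero_of_fin_two h0 h1)
    exact ⟨![-(a 1)⁻¹, 0], by simp [dt, h1]⟩
  · exact ⟨![0, (a 0)⁻¹], by simp [dt, h0]⟩

theorem ten_smul_left (m : K) (a b : Fin 2 → K) : ten (m • a) b = m • ten a b := by
  funext k
  fin_cases k <;> simp [ten] <;> ring

theorem ten_smul_right (m : K) (a b : Fin 2 → K) : ten a (m • b) = m • ten a b := by
  funext k
  fin_cases k <;> simp [ten] <;> ring

theorem ten_zero_left (b : Fin 2 → K) : ten 0 b = 0 := by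
  funext k
  fin_cases k <;> simp [ten]

theorem ten_zero_right (a : Fin 2 → K) : ten a 0 = 0 := by
  funext k
  fin_cases k <;> simp [ten]

theorem quad_ten (a b : Fin 2 → K) : quad (ten a b) = 0 := by
  simp [quad, ten]
  ring

theorem quad_comb (a b a' b' : Fin 2 → K) (u v : K) :
    quad (u • ten a b + v • ten a' b') = u * v * (dt a a' * dt b b') := by
  simp [quad, ten, dt]
  ring

theorem exists_ten_of_quad {x : Fin 4 → K} (h : quad x = 0) : ∃ a b, x = ten a b := by
  simp only [quad] at h
  by_cases h0 : x 0 = 0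
  · have : x 2 * x 3 = 0 := by linear_combination x 1 * h0 - h
    rcases mul_eq_zero.1 this with h2 | h3
    · refine ⟨![0, 1], ![x 3, x 1], funext fun k => ?_⟩
      fin_cases k <;> simp [ten, h0, h2]
    · refine ⟨![x 2, x 1], ![0, 1], funext fun k => ?_⟩
      fin_cases k <;> simp [ten, h0, h3]
  · refine ⟨![1, x 3 / x 0], ![x 0, x 2], funext fun k => ?_⟩
    fin_cases k <;> simp [ten, h0]
    field_simp
    linear_combination h

theorem dt_eq_zero_of_ten_eq_smul {a b a' b' : Fin 2 → K} {m : K} (h : ten a b = m • ten a' b')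
    (h0 : ten a b ≠ 0) : dt a a' = 0 ∧ dt b b' = 0 := by
  have e0 := congrFun h 0
  have e1 := congrFun h 1
  have e2 := congrFun h 2
  have e3 := congrFun h 3
  simp [ten] at e0 e1 e2 e3
  have ha : a ≠ 0 := fun ha => h0 (by rw [ha, ten_zero_left])
  have hb : b ≠ 0 := fun hb => h0 (by rw [hb, ten_zero_right])
  constructor
  · by_contra hd
    refine hb (eq_zero_of_fin_two ?_ ?_) <;> refine (mul_eq_zero.1 ?_).resolve_left hd <;>
      simp only [dt]
    · linear_combination a' 1 * e0 - a' 0 * e3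
    · linear_combination a' 1 * e2 - a' 0 * e1
  · by_contra hd
    refine ha (eq_zero_of_fin_two ?_ ?_) <;> refine (mul_eq_zero.1 ?_).resolve_left hd <;>
      simp only [dt]
    · linear_combination b' 1 * e0 - b' 0 * e2
    · linear_combination b' 1 * e3 - b' 0 * e1

/-- A tangent vector of the quadric at `a ⊗ b` has the form `a ⊗ b' + a' ⊗ b`. -/
theorem exists_tangent {a b : Fin 2 → K} (ha : a ≠ 0) (hb : b ≠ 0) {n : Fin 4 → K}
    (h : a 0 * b 0 * n 1 + a 1 * b 1 * n 0 - a 0 * b 1 * n 3 - a 1 * b 0 * n 2 = 0) :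
    ∃ a' b', n = ten a b' + ten a' b := by
  obtain ⟨p, hp⟩ := exists_dt_eq_one ha
  obtain ⟨q, hq⟩ := exists_dt_eq_one hb
  simp only [dt] at hp hq
  -- These are the coefficients of `n` in the basis `a ⊗ b`, `a ⊗ q`, `p ⊗ b`, `p ⊗ q`; the last one is zero.
  refine ⟨(a 0 * n 3 * q 1 - a 0 * n 1 * q 0 - a 1 * n 0 * q 1 + a 1 * n 2 * q 0) • p,
    (p 1 * n 0 * q 1 - p 1 * n 2 * q 0 - p 0 * n 3 * q 1 + p 0 * n 1 * q 0) • b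
      + (p 1 * n 2 * b 0 - p 1 * n 0 * b 1 + p 0 * n 3 * b 1 - p 0 * n 1 * b 0) • q,
    funext fun k => ?_⟩
  fin_cases k
  · simp [ten]
    linear_combination p 0 * q 0 * h - n 0 * (b 0 * q 1 - b 1 * q 0) * hp - n 0 * hq
  · simp [ten]
    linear_combination p 1 * q 1 * h - n 1 * (b 0 * q 1 - b 1 * q 0) * hp - n 1 * hq
  · simp [ten]
    linear_combination p 0 * q 1 * h - n 2 * (b 0 * q 1 - b 1 * q 0) * hp - n 2 * hq
  · simp [ten]
    linear_combination p 1 * q 0 * h - n 3 * (b 0 * q 1 - b 1 * q 0) * hp - n 3 * hq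

section Expansion

theorem bin_smul (E m : K) (a : Fin 2 → K) : bin E (m • a) = m ^ 4 * bin E a := by
  simp [bin]
  ring

variable [CharZero K]

/-- On the plane spanned by two points of the quadric the quartic form is given by the
polarizations of the two binary quartics, up to the term `(C - DE/6) (xy - zw)²`. -/
theorem quarticVal_comb (C D E : K) (a b a' b' : Fin 2 → K) (u v : K) :
    quarticVal (vecCDE C D E) (u • ten a b + v • ten a' b')
      = bin E a * bin D b * u ^ 4 + 4 * (bin₁ E a a' * bin₁ D b b') * u ^ 3 * v
        + (6 * (bin₂ E a a' * bin₂ D b b') + (C - D * E / 6) * (dt a a' * dt b b') ^ 2)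
          * u ^ 2 * v ^ 2
        + 4 * (bin₁ E a' a * bin₁ D b' b) * u * v ^ 3 + bin E a' * bin D b' * v ^ 4 := by
  simp [quarticVal, vecCDE, ten, bin, bin₁, bin₂, dt]
  ring

theorem quarticVal_tangent (C D E : K) (a b a' b' : Fin 2 → K) : ∃ e f : K, ∀ u v : K,
    quarticVal (vecCDE C D E) (u • ten a b + v • (ten a b' + ten a' b))
      = bin E a * bin D b * u ^ 4
        + 4 * (bin E a * bin₁ D b b' + bin₁ E a a' * bin D b) * u ^ 3 * v
        + 6 * (bin E a * bin₂ D b b' + 2 * (bin₁ E a a' * bin₁ D b b') + bin₂ E a a' * bin D b)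
          * u ^ 2 * v ^ 2 + e * u * v ^ 3 + f * v ^ 4 := by
  refine ⟨4 * (bin E a * bin₁ D b' b + 3 * (bin₁ E a a' * bin₂ D b b')
    + 3 * (bin₂ E a a' * bin₁ D b b') + bin₁ E a' a * bin D b),
    bin E a * bin D b' + 4 * (bin₁ E a a' * bin₁ D b' b) + 6 * (bin₂ E a a' * bin₂ D b b')
    + 4 * (bin₁ E a' a * bin₁ D b b') + bin E a' * bin D b
    + (C - D * E / 6) * (dt a a' * dt b b') ^ 2, fun u v => ?_⟩
  simp [quarticVal, vecCDE, ten, bin, bin₁, bin₂, dt]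
  ring

theorem coeffs_eq_zero {c₀ c₁ c₂ c₃ c₄ : K} (h : ∀ u v : K,
    c₀ * u ^ 4 + c₁ * u ^ 3 * v + c₂ * u ^ 2 * v ^ 2 + c₃ * u * v ^ 3 + c₄ * v ^ 4 = 0) :
    c₀ = 0 ∧ c₁ = 0 ∧ c₂ = 0 ∧ c₃ = 0 ∧ c₄ = 0 := by
  have h0 := h 1 0
  have h1 := h 0 1
  have h2 := h 1 1
  have h3 := h 1 (-1)
  have h4 := h 1 2
  have e0 : c₀ = 0 := by linear_combination h0
  have e4 : c₄ = 0 := by linear_combination h1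
  have e2 : c₂ = 0 := by linear_combination (h2 + h3) / 2 - e0 - e4
  have e3 : c₃ = 0 := by
    linear_combination (h4 - e0 - 4 * e2 - 16 * e4 - (h2 - h3)) / 6
  exact ⟨e0, by linear_combination (h2 - h3) / 2 - e3, e2, e3, e4⟩

theorem bin₁_smul_self (E m : K) (a : Fin 2 → K) : bin₁ E a (m • a) = m * bin E a := by
  simp [bin, bin₁]
  ring

/-- The binary quartic has no double root. -/
theorem dt_eq_zero_of_double_root {E : K} (hE : E ^ 2 ≠ 4) {a b : Fin 2 → K} (h0 : bin E a = 0)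
    (h1 : bin₁ E a b = 0) : dt a b = 0 := by
  by_contra hd
  simp only [bin, bin₁] at h0 h1
  have ex : a 0 * (2 * a 0 ^ 2 + E * a 1 ^ 2) = 0 := by
    refine (mul_eq_zero.1 ?_).resolve_left hd
    simp only [dt]
    linear_combination 2 * b 1 * h0 - 2 * a 1 * h1
  have ey : a 1 * (2 * a 1 ^ 2 + E * a 0 ^ 2) = 0 := by
    refine (mul_eq_zero.1 ?_).resolve_left hd
    simp only [dt]
    linear_combination 2 * a 0 * h1 - 2 * b 0 * h0
  by_cases a0 : a 0 = 0
  · have : a 1 = 0 := by simpa [a0] using h0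
    exact hd (by simp [dt, a0, this])
  by_cases a1 : a 1 = 0
  · have : a 0 = 0 := by simpa [a1] using h0
    exact a0 this
  have ex' := (mul_eq_zero.1 ex).resolve_left a0
  have ey' := (mul_eq_zero.1 ey).resolve_left a1
  refine hE (mul_right_cancel₀ (pow_ne_zero 2 a0) ?_)
  linear_combination E * ey' - 2 * ex'

/-- The invariant of degree two of the binary quartic. -/
theorem bin_invariant (E : K) (a b : Fin 2 → K) :
    bin E a * bin E b - 4 * (bin₁ E a b * bin₁ E b a) + 3 * bin₂ E a b ^ 2
      = (1 + E ^ 2 / 12) * dt a b ^ 4 := by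
  simp only [bin, bin₁, bin₂, dt]
  ring

end Expansion

section Roots

/-- The three involutions `θ ↦ -θ`, `1/θ`, `-1/θ` of the roots of `θ⁴ + Eθ² + 1`. -/
def inv3 (θ : K) : Fin 3 → K := ![-θ, θ⁻¹, -θ⁻¹]

/-- The values of `bin₂ E` at pairs of roots. -/
def root3 (E : K) : Fin 3 → K := ![-E / 3, E / 6 - 1, E / 6 + 1]

/-- First members of the three pairs of points at which both odd polarizations vanish. -/
def fstPt (i : K) : Fin 3 → Fin 2 → K := ![![1, 0], ![1, 1], ![1, i]]

/-- Second members of the three pairs of points at which both odd polarizations vanish. -/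
def sndPt (i : K) : Fin 3 → Fin 2 → K := ![![0, 1], ![1, -1], ![1, -i]]

theorem bin_one (E θ : K) : bin E ![1, θ] = 1 + θ ^ 4 + E * θ ^ 2 := by
  simp [bin]

theorem root_ne_zero {E θ : K} (h : bin E ![1, θ] = 0) : θ ≠ 0 := by
  rintro rfl
  simp [bin] at h

theorem exists_smul_of_bin_eq_zero {E : K} {a : Fin 2 → K} (ha : a ≠ 0) (h : bin E a = 0) :
    ∃ (m θ : K), m ≠ 0 ∧ a = m • ![1, θ] ∧ bin E ![1, θ] = 0 := by
  have h0 : a 0 ≠ 0 := by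
    intro h0
    refine ha (eq_zero_of_fin_two h0 ?_)
    simpa [bin, h0] using h
  have e : a = a 0 • ![1, a 1 / a 0] := by
    funext k
    fin_cases k <;> simp
    field_simp
  refine ⟨a 0, a 1 / a 0, h0, e, ?_⟩
  rw [bin_one]
  simp only [bin] at h
  field_simp
  linear_combination h

theorem bin_inv3 {E θ : K} (h : bin E ![1, θ] = 0) (k : Fin 3) : bin E ![1, inv3 θ k] = 0 := by
  have h0 := root_ne_zero h
  rw [bin_one] at h ⊢
  fin_cases k <;> simp [inv3]
  · linear_combination h
  · field_simp
    linear_combination h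
  · field_simp
    linear_combination h

theorem exists_inv3 {E θ η : K} (hθ : bin E ![1, θ] = 0) (hη : bin E ![1, η] = 0) (h : η ≠ θ) :
    ∃ k, η = inv3 θ k := by
  have h0 := root_ne_zero hθ
  rw [bin_one] at hθ hη
  have : (η - θ) * ((η + θ) * ((θ * η - 1) * (θ * η + 1))) = 0 := by
    linear_combination θ ^ 2 * hη - η ^ 2 * hθ
  rcases mul_eq_zero.1 ((mul_eq_zero.1 this).resolve_left (sub_ne_zero.2 h)) with h1 | h1
  · exact ⟨0, eq_neg_of_add_eq_zero_left h1⟩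
  · rcases mul_eq_zero.1 h1 with h2 | h2
    · refine ⟨1, eq_inv_of_mul_eq_one_right ?_⟩
      linear_combination h2
    · refine ⟨2, ?_⟩
      change η = -θ⁻¹
      rw [← neg_eq_iff_eq_neg]
      refine eq_inv_of_mul_eq_one_right ?_
      linear_combination -h2

theorem sq_root_ne {E θ : K} (hE : E ^ 2 ≠ 4) (h : bin E ![1, θ] = 0) :
    θ ^ 2 ≠ 1 ∧ θ ^ 2 ≠ -1 := by
  rw [bin_one] at h
  constructor
  · intro h1
    have : E = -2 := by linear_combination h - (θ ^ 2 + 1 + E) * h1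
    exact hE (by rw [this]; norm_num)
  · intro h1
    have : E = 2 := by linear_combination -h + (θ ^ 2 - 1 + E) * h1
    exact hE (by rw [this]; norm_num)

variable [CharZero K]

theorem inv3_ne_self {E θ : K} (hE : E ^ 2 ≠ 4) (h : bin E ![1, θ] = 0) (k : Fin 3) :
    inv3 θ k ≠ θ := by
  have h0 := root_ne_zero h
  obtain ⟨h1, h2⟩ := sq_root_ne hE h
  intro hk
  fin_cases k
  · have hk' : -θ = θ := hk
    refine h0 ?_
    linear_combination -hk' / 2
  · have hk' : θ⁻¹ = θ := hk
    refine h1 ?_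
    rw [sq]
    nth_rw 1 [← hk']
    exact inv_mul_cancel₀ h0
  · have hk' : -θ⁻¹ = θ := hk
    refine h2 ?_
    rw [sq]
    nth_rw 1 [← hk']
    rw [neg_mul, inv_mul_cancel₀ h0]

theorem inv3_injective {E θ : K} (hE : E ^ 2 ≠ 4) (h : bin E ![1, θ] = 0) :
    Function.Injective (inv3 θ) := by
  have h0 := root_ne_zero h
  obtain ⟨h1, h2⟩ := sq_root_ne hE h
  have e1 : -θ ≠ θ⁻¹ := fun he => h2 (by
    have : -θ * θ = 1 := by rw [he, inv_mul_cancel₀ h0]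
    linear_combination -this)
  have e2 : θ ≠ θ⁻¹ := fun he => h1 (by
    have : θ * θ = 1 := by nth_rw 1 [he]; exact inv_mul_cancel₀ h0
    linear_combination this)
  have e3 : θ⁻¹ ≠ -θ⁻¹ := fun he => inv_ne_zero h0 (by linear_combination he / 2)
  intro k l hkl
  fin_cases k <;> fin_cases l <;> simp [inv3] at hkl ⊢
  · exact e1 hkl
  · exact e2 hkl
  · exact e1 hkl.symm
  · exact e3 hkl
  · exact e2 hkl.symm
  · exact e3 hkl.symm

/-- The binary quartic has four roots. -/
theorem exists_roots [IsAlgClosed K] {E : K} (hE : E ^ 2 ≠ 4) :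
    ∃ ρ : Fin 4 → K, Function.Injective ρ ∧ ∀ θ, bin E ![1, θ] = 0 ↔ ∃ l, ρ l = θ := by
  obtain ⟨t, ht⟩ : ∃ t : K, 1 * (t * t) + E * t + 1 = 0 :=
    exists_quadratic_eq_zero one_ne_zero (by
      obtain ⟨r, hr⟩ := IsAlgClosed.exists_pow_nat_eq (discrim 1 E 1) (n := 2) two_pos
      exact ⟨r, by rw [← hr, sq]⟩)
  obtain ⟨θ, hθ⟩ := IsAlgClosed.exists_pow_nat_eq t (n := 2) two_pos
  have h : bin E ![1, θ] = 0 := by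
    rw [bin_one]
    rw [← hθ] at ht
    linear_combination ht
  refine ⟨Fin.cons θ (inv3 θ), ?_, fun η => ⟨fun hη => ?_, ?_⟩⟩
  · rw [Fin.cons_injective_iff]
    exact ⟨fun ⟨k, hk⟩ => inv3_ne_self hE h k hk, inv3_injective hE h⟩
  · by_cases hηθ : η = θ
    · exact ⟨0, hηθ.symm⟩
    · obtain ⟨k, hk⟩ := exists_inv3 h hη hηθ
      exact ⟨k.succ, hk.symm⟩
  · rintro ⟨l, rfl⟩
    refine Fin.cases h (fun k => ?_) l
    exact bin_inv3 h k

theorem bin₂_inv3 {E θ : K} (h : bin E ![1, θ] = 0) (k : Fin 3) :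
    bin₂ E ![1, θ] ![1, inv3 θ k] = root3 E k * dt ![1, θ] ![1, inv3 θ k] ^ 2 := by
  have h0 := root_ne_zero h
  rw [bin_one] at h
  fin_cases k <;> simp [bin₂, dt, root3, inv3]
  · linear_combination h
  · field_simp
    linear_combination 6 * h
  · field_simp
    linear_combination -6 * h

variable {i : K} (hi : i ^ 2 = -1)

include hi

theorem dt_fstPt_sndPt (j : Fin 3) : dt (fstPt i j) (sndPt i j) ≠ 0 := by
  have hi0 : i ≠ 0 := by
    rintro rfl
    norm_num at hi
  fin_cases j <;> simp [dt, fstPt, sndPt]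
  · norm_num
  · intro h
    exact hi0 (by linear_combination -h / 2)

theorem eq_of_dt_fstPt (j l : Fin 3) (h : dt (fstPt i j) (fstPt i l) = 0) : j = l := by
  have hi0 : i ≠ 0 := by
    rintro rfl
    norm_num at hi
  have hi1 : i ≠ 1 := by
    rintro rfl
    norm_num at hi
  fin_cases j <;> fin_cases l <;> simp [dt, fstPt, hi0] at h ⊢
  · exact hi1 (by linear_combination h)
  · exact hi1 (by linear_combination -h)

theorem dt_fstPt_sndPt_ne (j l : Fin 3) : dt (fstPt i j) (sndPt i l) ≠ 0 := by
  have hi0 : i ≠ 0 := by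
    rintro rfl
    norm_num at hi
  have hi1 : i ≠ 1 := by
    rintro rfl
    norm_num at hi
  have hi2 : i ≠ -1 := by
    rintro rfl
    norm_num at hi
  intro h
  fin_cases j <;> fin_cases l <;> simp [dt, fstPt, sndPt, hi0] at h
  · exact two_ne_zero (α := K) (by linear_combination -h)
  · exact hi2 (by linear_combination -h)
  · exact hi2 (by linear_combination -h)
  · exact hi0 (by linear_combination -h / 2)

theorem bin_fstPt {D : K} (hD : D ^ 2 ≠ 4) (j : Fin 3) : bin D (fstPt i j) ≠ 0 := by
  intro h
  fin_cases j
  · simp [bin, fstPt] at h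
  · simp [bin, fstPt] at h
    have : D = -2 := by linear_combination h
    exact hD (by rw [this]; norm_num)
  · simp [bin, fstPt] at h
    have : D = 2 := by linear_combination -h + (i ^ 2 - 1 + D) * hi
    exact hD (by rw [this]; norm_num)

theorem bin₁_fstPt_sndPt (D : K) (j : Fin 3) :
    bin₁ D (fstPt i j) (sndPt i j) = 0 ∧ bin₁ D (sndPt i j) (fstPt i j) = 0 := by
  refine ⟨?_, ?_⟩ <;> fin_cases j <;> simp [bin₁, fstPt, sndPt]
  · linear_combination (1 - i ^ 2) * hi
  · ring
  · linear_combination (1 - i ^ 2) * hi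

theorem bin₂_fstPt_sndPt (D : K) (j : Fin 3) : 2 * bin₂ D (fstPt i j) (sndPt i j)
    = -root3 D j * dt (fstPt i j) (sndPt i j) ^ 2 := by
  fin_cases j <;> simp [bin₂, dt, root3, fstPt, sndPt]
  · ring
  · ring
  · linear_combination (2 * i ^ 2 + 2) * hi

/-- The odd polarizations of the binary quartic vanish only at three pairs of points. -/
theorem exists_pair {D : K} (hD : D ^ 2 ≠ 4) {a b : Fin 2 → K} (hab : dt a b ≠ 0)
    (h1 : bin₁ D a b = 0) (h3 : bin₁ D b a = 0) :
    ∃ j, (dt (fstPt i j) a = 0 ∧ dt (sndPt i j) b = 0) ∨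
      (dt (sndPt i j) a = 0 ∧ dt (fstPt i j) b = 0) := by
  simp only [bin₁] at h1 h3
  by_cases hs : a 0 * b 1 + a 1 * b 0 = 0
  · -- Here `b` is proportional to `(a₀, -a₁)`, and the polarization is `a₀⁴ - a₁⁴`.
    have hb : dt ![a 0, -a 1] b = 0 := by
      simp [dt]
      exact hs
    have hb0 : b ≠ 0 := dt_ne_zero_left (dt_ne_zero_symm hab)
    have ha0 : (![a 0, -a 1] : Fin 2 → K) ≠ 0 := by
      intro h0
      have e0 := congrFun h0 0
      have e1 := congrFun h0 1
      simp at e0 e1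
      exact hab (by simp [dt, e0, e1])
    obtain ⟨m, hm, rfl⟩ := exists_smul_of_dt_eq_zero ha0 hb0 hb
    have h4 : (a 1 - a 0) * ((a 1 + a 0) * ((a 1 - i * a 0) * (a 1 + i * a 0))) = 0 := by
      refine (mul_eq_zero.1 (?_ : m * _ = 0)).resolve_left hm
      simp at h1
      linear_combination -h1 + m * (a 0 ^ 4 - a 1 ^ 2 * a 0 ^ 2) * hi
    rcases mul_eq_zero.1 h4 with h | h
    · refine ⟨1, Or.inl ⟨?_, ?_⟩⟩ <;> simp [dt, fstPt, sndPt]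
      · linear_combination h
      · linear_combination -m * h
    rcases mul_eq_zero.1 h with h | h
    · refine ⟨1, Or.inr ⟨?_, ?_⟩⟩ <;> simp [dt, fstPt, sndPt]
      · linear_combination h
      · linear_combination -m * h
    rcases mul_eq_zero.1 h with h | h
    · refine ⟨2, Or.inl ⟨?_, ?_⟩⟩ <;> simp [dt, fstPt, sndPt]
      · linear_combination h
      · linear_combination -m * h
    · refine ⟨2, Or.inr ⟨?_, ?_⟩⟩ <;> simp [dt, fstPt, sndPt]
      · linear_combination h
      · linear_combination -m * h
  · -- The two equations are linear in `x + D/2 y` and `y + D/2 x`, for `x = a₀ b₀` and `y = a₁ b₁`.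
    have hne : dt a b * (a 0 * b 1 + a 1 * b 0) ≠ 0 := mul_ne_zero hab hs
    have ex : a 0 * b 0 + D / 2 * (a 1 * b 1) = 0 := by
      refine (mul_eq_zero.1 ?_).resolve_left hne
      simp only [dt]
      linear_combination b 1 ^ 2 * h1 - a 1 ^ 2 * h3
    have ey : a 1 * b 1 + D / 2 * (a 0 * b 0) = 0 := by
      refine (mul_eq_zero.1 ?_).resolve_left hne
      simp only [dt]
      linear_combination a 0 ^ 2 * h3 - b 0 ^ 2 * h1
    have hx : a 0 * b 0 = 0 := by
      refine (mul_eq_zero.1 (?_ : (4 - D ^ 2) * _ = 0)).resolve_left (sub_ne_zero.2 hD.symm)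
      linear_combination 4 * ex - 2 * D * ey
    have hy : a 1 * b 1 = 0 := by linear_combination ey - D / 2 * hx
    rcases mul_eq_zero.1 hx with ha | hb <;> rcases mul_eq_zero.1 hy with ha' | hb'
    · exact absurd (by simp [dt, ha, ha']) hab
    · exact ⟨0, Or.inr ⟨by simp [dt, sndPt, ha], by simp [dt, fstPt, hb']⟩⟩
    · exact ⟨0, Or.inl ⟨by simp [dt, fstPt, ha'], by simp [dt, sndPt, hb]⟩⟩
    · exact absurd (by simp [dt, hb, hb']) hab

end Roots

end Lines

/-! ### The configuration of the lines -/

section CountLines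

variable {K : Type*} [Field K]

/-- The indices `(k, j)` such that, for the roots `(1, θ)` of `bin E`, the line through
`(1, θ) ⊗ fstPt j` and `(1, inv3 θ k) ⊗ sndPt j` lies on the quartic. -/
def matches3 (C D E : K) : Set (Fin 3 × Fin 3) :=
  {q | C - D * E / 6 = 3 * (root3 E q.1 * root3 D q.2)}

/-- The data `η`, `j` of the line `joinLine i θ η j` that belongs to the root `θ` and to a match, or
to `none`, which stands for the line `(1, θ) ⊗ K²` of the quadric `xy = zw`. -/
def lineData (C D E : K) (θ : K) : Option (matches3 C D E) → K × Fin 3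
  | none => (θ, 0)
  | some q => (inv3 θ q.1.1, q.1.2)

/-- The lines through `(1, θ) ⊗ fstPt j` and `(1, η) ⊗ sndPt j`. -/
def joinLine (i θ η : K) (j : Fin 3) : Submodule K (Fin 4 → K) :=
  Submodule.span K {ten ![1, θ] (fstPt i j), ten ![1, η] (sndPt i j)}

/-- One half of the lines on the quartic, those that meet the quadric `xy = zw` in points `a ⊗ b`
with `bin E a = 0`. -/
def halfLines (i C D E : K) : Set (Submodule K (Fin 4 → K)) :=
  {L | ∃ (θ : K) (_ : bin E ![1, θ] = 0) (o : Option (matches3 C D E)),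
    L = joinLine i θ (lineData C D E θ o).1 (lineData C D E θ o).2}

/-- The lines on the quartic, as planes on which the quartic form vanishes. -/
def IsLineOn (C D E : K) (L : Submodule K (Fin 4 → K)) : Prop :=
  Module.finrank K L = 2 ∧ ∀ x ∈ L, quarticVal (vecCDE C D E) x = 0

theorem ten_ne_zero {a b : Fin 2 → K} (ha : a ≠ 0) (hb : b ≠ 0) : ten a b ≠ 0 := by
  intro h
  obtain ⟨c, hc⟩ := exists_dt_eq_one ha
  have e0 := congrFun h 0
  have e1 := congrFun h 1
  have e2 := congrFun h 2
  have e3 := congrFun h 3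
  simp only [ten, dt, Matrix.cons_val, Pi.zero_apply] at e0 e1 e2 e3 hc
  refine hb (eq_zero_of_fin_two ?_ ?_)
  · linear_combination -b 0 * hc + c 1 * e0 - c 0 * e3
  · linear_combination -b 1 * hc + c 1 * e2 - c 0 * e1

theorem linearIndependent_ten {a b a' b' : Fin 2 → K} (ha : a ≠ 0) (ha' : a' ≠ 0) (hb : b ≠ 0)
    (hb' : b' ≠ 0) (h : dt a a' ≠ 0 ∨ dt b b' ≠ 0) :
    LinearIndependent K ![ten a b, ten a' b'] := by
  rw [LinearIndependent.pair_iff' (ten_ne_zero ha hb)]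
  intro m hm
  obtain ⟨h1, h2⟩ := dt_eq_zero_of_ten_eq_smul hm.symm (ten_ne_zero ha' hb')
  rw [dt_comm] at h1 h2
  exact h.elim (fun h => h (neg_eq_zero.1 h1)) fun h => h (neg_eq_zero.1 h2)

theorem span_pair_eq {L : Submodule K (Fin 4 → K)} (hL : Module.finrank K L = 2)
    {x y : Fin 4 → K} (hx : x ∈ L) (hy : y ∈ L) (h : LinearIndependent K ![x, y]) :
    Submodule.span K {x, y} = L := by
  refine Submodule.eq_of_le_of_finrank_eq (Submodule.span_le.2 ?_) ?_
  · rintro z (rfl | rfl)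
    · exact hx
    · exact hy
  · rw [hL, ← Matrix.range_cons_cons_empty x y ![], finrank_span_eq_card h, Fintype.card_fin]

theorem finrank_span_pair {x y : Fin 4 → K} (h : LinearIndependent K ![x, y]) :
    Module.finrank K (Submodule.span K {x, y}) = 2 := by
  rw [← Matrix.range_cons_cons_empty x y ![], finrank_span_eq_card h, Fintype.card_fin]

theorem factors_of_linearIndependent {a b a' b' : Fin 2 → K}
    (h : LinearIndependent K ![ten a b, ten a' b']) :
    a ≠ 0 ∧ b ≠ 0 ∧ a' ≠ 0 ∧ b' ≠ 0 ∧ (dt a a' = 0 → dt b b' ≠ 0) := by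
  have h0 : ten a b ≠ 0 := h.ne_zero 0
  have h1 : ten a' b' ≠ 0 := h.ne_zero 1
  have ha : a ≠ 0 := fun e => h0 (by rw [e, ten_zero_left])
  have hb : b ≠ 0 := fun e => h0 (by rw [e, ten_zero_right])
  have ha' : a' ≠ 0 := fun e => h1 (by rw [e, ten_zero_left])
  have hb' : b' ≠ 0 := fun e => h1 (by rw [e, ten_zero_right])
  refine ⟨ha, hb, ha', hb', fun hda hdb => ?_⟩
  obtain ⟨m, -, rfl⟩ := exists_smul_of_dt_eq_zero ha ha' hda
  obtain ⟨n, -, rfl⟩ := exists_smul_of_dt_eq_zero hb hb' hdb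
  exact (LinearIndependent.pair_iff' h0).1 h (m * n)
    (by rw [ten_smul_left, ten_smul_right, smul_smul])

/-- The bilinear form of `quad`. -/
def quadPolar (x y : Fin 4 → K) : K := x 0 * y 1 + x 1 * y 0 - x 2 * y 3 - x 3 * y 2

theorem quad_smul_add_smul (x y : Fin 4 → K) (u v : K) :
    quad (u • x + v • y) = u ^ 2 * quad x + u * v * quadPolar x y + v ^ 2 * quad y := by
  simp [quad, quadPolar]
  ring

/-- The exchange of `z` and `w`, which exchanges the factors of `a ⊗ b`. -/
def swapZW (K : Type*) [Field K] : (Fin 4 → K) ≃ₗ[K] (Fin 4 → K) :=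
  LinearEquiv.funCongrLeft K K (Equiv.swap 2 3)

theorem swapZW_ten (a b : Fin 2 → K) : swapZW K (ten a b) = ten b a := by
  funext k
  fin_cases k <;> simp [swapZW, ten, LinearEquiv.funCongrLeft_apply, LinearMap.funLeft_apply,
    Equiv.swap_apply_def, mul_comm]

theorem quarticVal_swapZW (C D E : K) (x : Fin 4 → K) :
    quarticVal (vecCDE C E D) (swapZW K x) = quarticVal (vecCDE C D E) x := by
  simp [swapZW, quarticVal, vecCDE, LinearEquiv.funCongrLeft_apply, LinearMap.funLeft_apply,
    Equiv.swap_apply_def]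
  ring

theorem IsLineOn.map_swapZW {C D E : K} {L : Submodule K (Fin 4 → K)} (h : IsLineOn C D E L) :
    IsLineOn C E D (L.map (swapZW K : (Fin 4 → K) →ₗ[K] (Fin 4 → K))) := by
  refine ⟨(LinearEquiv.finrank_map_eq _ _).trans h.1, ?_⟩
  rintro _ ⟨x, hx, rfl⟩
  exact (quarticVal_swapZW C D E x).trans (h.2 x hx)

theorem isLineOn_map_swapZW_iff {C D E : K} {L : Submodule K (Fin 4 → K)} :
    IsLineOn C E D (L.map (swapZW K : (Fin 4 → K) →ₗ[K] (Fin 4 → K))) ↔ IsLineOn C D E L := by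
  refine ⟨fun h => ⟨(LinearEquiv.finrank_map_eq _ _).symm.trans h.1, fun x hx => ?_⟩,
    IsLineOn.map_swapZW⟩
  exact (quarticVal_swapZW C D E x).symm.trans (h.2 _ ⟨x, hx, rfl⟩)

theorem bin_lineData {C D E θ : K} (hθ : bin E ![1, θ] = 0) (o : Option (matches3 C D E)) :
    bin E ![1, (lineData C D E θ o).1] = 0 := by
  rcases o with _ | q
  · exact hθ
  · exact bin_inv3 hθ _

section Classification

variable [CharZero K] {C D E : K}

theorem IsLineOn.equations {L : Submodule K (Fin 4 → K)} (hL : IsLineOn C D E L)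
    {a b a' b' : Fin 2 → K} (h0 : ten a b ∈ L) (h1 : ten a' b' ∈ L) :
    bin E a * bin D b = 0 ∧ bin₁ E a a' * bin₁ D b b' = 0 ∧
      6 * (bin₂ E a a' * bin₂ D b b') + (C - D * E / 6) * (dt a a' * dt b b') ^ 2 = 0 ∧
      bin₁ E a' a * bin₁ D b' b = 0 ∧ bin E a' * bin D b' = 0 := by
  obtain ⟨e0, e1, e2, e3, e4⟩ := coeffs_eq_zero fun u v =>
    (quarticVal_comb C D E a b a' b' u v).symm.trans
      (hL.2 _ (L.add_mem (L.smul_mem u h0) (L.smul_mem v h1)))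
  exact ⟨e0, by simpa using e1, e2, by simpa using e3, e4⟩

/-- A line on the quartic meets the quadric `xy = zw` in two independent points, as it is not
tangent to the quadric. -/
theorem IsLineOn.exists_ten [IsAlgClosed K] (hD : D ^ 2 ≠ 4) (hE : E ^ 2 ≠ 4)
    {L : Submodule K (Fin 4 → K)} (hL : IsLineOn C D E L) : ∃ a b a' b' : Fin 2 → K,
      ten a b ∈ L ∧ ten a' b' ∈ L ∧ LinearIndependent K ![ten a b, ten a' b'] := by
  obtain ⟨e, f, he, hf, hef⟩ : ∃ e f, e ∈ L ∧ f ∈ L ∧ LinearIndependent K ![e, f] := by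
    let B := Module.finBasisOfFinrankEq K L hL.1
    refine ⟨B 0, B 1, (B 0).2, (B 1).2, ?_⟩
    have := B.linearIndependent.map' L.subtype L.ker_subtype
    have hB : L.subtype ∘ B = ![(B 0 : Fin 4 → K), (B 1 : Fin 4 → K)] := by
      funext k
      fin_cases k <;> rfl
    rwa [hB] at this
  obtain ⟨x, y, hx, hy, hxy, hqx⟩ : ∃ x y, x ∈ L ∧ y ∈ L ∧ LinearIndependent K ![x, y] ∧
      quad x = 0 := by
    by_cases h0 : quad e = 0
    · exact ⟨e, f, he, hf, hef, h0⟩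
    obtain ⟨t, ht⟩ := exists_quadratic_eq_zero (b := quadPolar e f) (c := quad f) h0 (by
      obtain ⟨r, hr⟩ := IsAlgClosed.exists_pow_nat_eq
        (discrim (quad e) (quadPolar e f) (quad f)) (n := 2) two_pos
      exact ⟨r, by rw [← hr, sq]⟩)
    refine ⟨t • e + (1 : K) • f, e, L.add_mem (L.smul_mem _ he) (L.smul_mem _ hf), he, ?_, ?_⟩
    · rw [LinearIndependent.pair_iff] at hef ⊢
      intro p q hpq
      obtain ⟨h1, rfl⟩ := hef (p * t + q) p (by rw [← hpq]; module)
      exact ⟨rfl, by simpa using h1⟩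
    · rw [quad_smul_add_smul]
      linear_combination ht
  obtain ⟨a, b, rfl⟩ := exists_ten_of_quad hqx
  obtain ⟨z, hz, hxz, hqz⟩ : ∃ z ∈ L, LinearIndependent K ![ten a b, z] ∧ quad z = 0 := by
    by_cases hp : quadPolar (ten a b) y = 0
    · by_cases hqy : quad y = 0
      · exact ⟨y, hy, hxy, hqy⟩
      exfalso
      have h0 : ten a b ≠ 0 := hxy.ne_zero 0
      have ha : a ≠ 0 := fun e => h0 (by rw [e, ten_zero_left])
      have hb : b ≠ 0 := fun e => h0 (by rw [e, ten_zero_right])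
      obtain ⟨a', b', rfl⟩ := exists_tangent ha hb (n := y) (by
        simp [quadPolar, ten] at hp
        linear_combination hp)
      have hd : dt a a' * dt b' b ≠ 0 := by
        intro h
        refine hqy ?_
        have := quad_comb a b' a' b 1 1
        rw [h] at this
        simpa using this
      have ha' := left_ne_zero_of_mul hd
      have hb' := dt_ne_zero_symm (right_ne_zero_of_mul hd)
      obtain ⟨p, q, hpq⟩ := quarticVal_tangent C D E a b a' b'
      obtain ⟨e0, e1, e2, -, -⟩ := coeffs_eq_zero fun u v =>
        (hpq u v).symm.trans (hL.2 _ (L.add_mem (L.smul_mem u hx) (L.smul_mem v hy)))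
      have hf1 : bin E a = 0 → bin₁ E a a' ≠ 0 := fun h h' =>
        ha' (dt_eq_zero_of_double_root hE h h')
      have hg1 : bin D b = 0 → bin₁ D b b' ≠ 0 := fun h h' =>
        hb' (dt_eq_zero_of_double_root hD h h')
      rcases mul_eq_zero.1 e0 with h | h
      · by_cases h' : bin D b = 0
        · simp [h, h', hf1, hg1] at e2
        · simp [h, h', hf1] at e1
      · by_cases h' : bin E a = 0
        · simp [h, h', hf1, hg1] at e2
        · simp [h, h', hg1] at e1
    · refine ⟨(-quad y) • ten a b + quadPolar (ten a b) y • y,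
        L.add_mem (L.smul_mem _ hx) (L.smul_mem _ hy), ?_, ?_⟩
      · rw [LinearIndependent.pair_iff] at hxy ⊢
        intro p q hpq
        obtain ⟨h1, h2⟩ := hxy (p - q * quad y) (q * quadPolar (ten a b) y) (by
          rw [← hpq]; module)
        have hq : q = 0 := by simpa [hp] using h2
        exact ⟨by simpa [hq] using h1, hq⟩
      · rw [quad_smul_add_smul, hqx]
        ring
  obtain ⟨a', b', rfl⟩ := exists_ten_of_quad hqz
  exact ⟨a, b, a', b', hx, hz, hxz⟩

/-- The two points of a line on the quadric determine its type: if the first factors are roots of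
`bin E`, they coincide or are exchanged by an involution `inv3`, and the second factors are a pair
at which the odd polarizations of `bin D` vanish. The remaining combination of roots occurs only if
`(C - DE/6)²` has the excluded value, by `bin_invariant`. -/
theorem IsLineOn.mem_halfLines {i : K} (hi : i ^ 2 = -1) (hD : D ^ 2 ≠ 4) (hE : E ^ 2 ≠ 4)
    (hC : (C - D * E / 6) ^ 2 ≠ 4 * ((1 + E ^ 2 / 12) * (1 + D ^ 2 / 12)))
    {L : Submodule K (Fin 4 → K)} (hL : IsLineOn C D E L) {a b a' b' : Fin 2 → K}
    (h0 : ten a b ∈ L) (h1 : ten a' b' ∈ L) (hind : LinearIndependent K ![ten a b, ten a' b'])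
    (hf : bin E a = 0) (hg : dt a a' = 0 ∨ bin D b ≠ 0) : L ∈ halfLines i C D E := by
  obtain ⟨ha, hb, ha', hb', hd⟩ := factors_of_linearIndependent hind
  have hone : ∀ θ : K, (![1, θ] : Fin 2 → K) ≠ 0 := fun θ h => one_ne_zero (congrFun h 0)
  have hF : ∀ j, fstPt i j ≠ 0 := fun j => dt_ne_zero_left (dt_fstPt_sndPt hi j)
  have hS : ∀ j, sndPt i j ≠ 0 := fun j =>
    dt_ne_zero_left (dt_ne_zero_symm (dt_fstPt_sndPt hi j))
  have hjoin : ∀ (θ η : K) (j : Fin 3), ten ![1, θ] (fstPt i j) ∈ L →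
      ten ![1, η] (sndPt i j) ∈ L → L = joinLine i θ η j := fun θ η j hx hy =>
    (span_pair_eq hL.1 hx hy (linearIndependent_ten (hone θ) (hone η) (hF j) (hS j)
      (Or.inr (dt_fstPt_sndPt hi j)))).symm
  obtain ⟨m, θ, hm, rfl, hθ⟩ := exists_smul_of_bin_eq_zero ha hf
  have h0' : ten ![1, θ] b ∈ L := (L.smul_mem_iff hm).1 (by rwa [← ten_smul_left])
  by_cases hdt : dt (m • ![1, θ]) a' = 0
  · -- The line is `(1, θ) ⊗ K²`.
    obtain ⟨n, hn, rfl⟩ := exists_smul_of_dt_eq_zero ha ha' hdt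
    have h1' : ten ![1, θ] b' ∈ L := by
      rw [smul_smul, ten_smul_left] at h1
      exact (L.smul_mem_iff (mul_ne_zero hn hm)).1 h1
    have hdb := hd hdt
    have hall : ∀ x, ten ![1, θ] x ∈ L := by
      intro x
      have : ten ![1, θ] x = (dt x b' / dt b b') • ten ![1, θ] b
          + (dt b x / dt b b') • ten ![1, θ] b' := by
        funext k
        fin_cases k <;> simp [ten] <;> field_simp <;> simp only [dt] <;> ring
      rw [this]
      exact L.add_mem (L.smul_mem _ h0') (L.smul_mem _ h1')
    exact ⟨θ, hθ, none, hjoin θ θ 0 (hall _) (hall _)⟩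
  have hg0 : bin D b ≠ 0 := hg.resolve_left hdt
  obtain ⟨-, e1, e2, e3, e4⟩ := hL.equations h0 h1
  have hf1 : bin₁ E (m • ![1, θ]) a' ≠ 0 := fun h => hdt (dt_eq_zero_of_double_root hE hf h)
  have hg1 : bin₁ D b b' = 0 := (mul_eq_zero.1 e1).resolve_left hf1
  have hdb : dt b b' ≠ 0 := by
    intro h
    obtain ⟨n, hn, rfl⟩ := exists_smul_of_dt_eq_zero hb hb' h
    rw [bin₁_smul_self] at hg1
    exact mul_ne_zero hn hg0 hg1
  by_cases hf4 : bin E a' = 0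
  · have hf3 : bin₁ E a' (m • ![1, θ]) ≠ 0 := fun h =>
      dt_ne_zero_symm hdt (dt_eq_zero_of_double_root hE hf4 h)
    have hg3 := (mul_eq_zero.1 e3).resolve_left hf3
    obtain ⟨n, η, hn, rfl, hη⟩ := exists_smul_of_bin_eq_zero ha' hf4
    have h1' : ten ![1, η] b' ∈ L := (L.smul_mem_iff hn).1 (by rwa [← ten_smul_left])
    have hηθ : η ≠ θ := by
      rintro rfl
      refine hdt ?_
      simp [dt]
      ring
    have key : ∀ (θ η : K) (j : Fin 3), bin E ![1, θ] = 0 → bin E ![1, η] = 0 → η ≠ θ →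
        ten ![1, θ] (fstPt i j) ∈ L → ten ![1, η] (sndPt i j) ∈ L → L ∈ halfLines i C D E := by
      intro θ η j hθ hη hηθ hx hy
      obtain ⟨k, rfl⟩ := exists_inv3 hθ hη hηθ
      obtain ⟨-, -, e2, -, -⟩ := hL.equations hx hy
      have hk : (k, j) ∈ matches3 C D E := by
        have d1 : dt ![1, θ] ![1, inv3 θ k] ≠ 0 := by
          simpa [dt, sub_eq_zero] using hηθ
        have d2 := dt_fstPt_sndPt hi j
        have b1 := bin₂_inv3 hθ k
        have b2 := bin₂_fstPt_sndPt hi D j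
        refine mul_right_cancel₀ (pow_ne_zero 2 (mul_ne_zero d1 d2)) ?_
        linear_combination e2 - 6 * bin₂ D (fstPt i j) (sndPt i j) * b1
          - 3 * root3 E k * dt ![1, θ] ![1, inv3 θ k] ^ 2 * b2
      exact ⟨θ, hθ, some ⟨(k, j), hk⟩, hjoin _ _ _ hx hy⟩
    obtain ⟨j, ⟨hj1, hj2⟩ | ⟨hj1, hj2⟩⟩ := exists_pair hi hD hdb hg1 hg3
    · obtain ⟨p, hp, rfl⟩ := exists_smul_of_dt_eq_zero (hF j) hb hj1
      obtain ⟨q, hq, rfl⟩ := exists_smul_of_dt_eq_zero (hS j) hb' hj2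
      rw [ten_smul_right] at h0' h1'
      exact key θ η j hθ hη hηθ ((L.smul_mem_iff hp).1 h0') ((L.smul_mem_iff hq).1 h1')
    · obtain ⟨p, hp, rfl⟩ := exists_smul_of_dt_eq_zero (hS j) hb hj1
      obtain ⟨q, hq, rfl⟩ := exists_smul_of_dt_eq_zero (hF j) hb' hj2
      rw [ten_smul_right] at h0' h1'
      exact key η θ j hη hθ hηθ.symm ((L.smul_mem_iff hq).1 h1') ((L.smul_mem_iff hp).1 h0')
  · exfalso
    have hg4 := (mul_eq_zero.1 e4).resolve_left hf4
    have hg3 : bin₁ D b' b ≠ 0 := fun h =>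
      dt_ne_zero_symm hdb (dt_eq_zero_of_double_root hD hg4 h)
    have hf3 := (mul_eq_zero.1 e3).resolve_right hg3
    have i1 := bin_invariant E (m • ![1, θ]) a'
    have i2 := bin_invariant D b b'
    rw [hf, hf3] at i1
    rw [hg4, hg1] at i2
    refine hC (mul_right_cancel₀ (pow_ne_zero 4 (mul_ne_zero hdt hdb)) ?_)
    generalize dt (m • ![1, θ]) a' = d at *
    generalize dt b b' = d' at *
    generalize bin₂ E (m • ![1, θ]) a' = p at *
    generalize bin₂ D b b' = q at *
    linear_combination ((C - D * E / 6) * (d * d') ^ 2 - 6 * (p * q)) * e2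
      + 12 * q ^ 2 * i1 + 4 * (1 + E ^ 2 / 12) * d ^ 4 * i2

theorem IsLineOn.mem_or [IsAlgClosed K] {i : K} (hi : i ^ 2 = -1) (hD : D ^ 2 ≠ 4) (hE : E ^ 2 ≠ 4)
    (hC : (C - D * E / 6) ^ 2 ≠ 4 * ((1 + E ^ 2 / 12) * (1 + D ^ 2 / 12)))
    {L : Submodule K (Fin 4 → K)} (hL : IsLineOn C D E L) : L ∈ halfLines i C D E ∨
      L.map (swapZW K : (Fin 4 → K) →ₗ[K] (Fin 4 → K)) ∈ halfLines i C E D := by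
  obtain ⟨a, b, a', b', h0, h1, hind⟩ := hL.exists_ten hD hE
  obtain ⟨ha, hb, ha', hb', hd⟩ := factors_of_linearIndependent hind
  have hswap : bin D b = 0 → (dt b b' = 0 ∨ bin E a ≠ 0) →
      L.map (swapZW K : (Fin 4 → K) →ₗ[K] (Fin 4 → K)) ∈ halfLines i C E D := by
    intro hg hf
    refine hL.map_swapZW.mem_halfLines hi hE hD (by rwa [mul_comm E D, mul_comm (1 + D ^ 2 / 12)])
      ⟨_, h0, swapZW_ten a b⟩ ⟨_, h1, swapZW_ten a' b'⟩ (linearIndependent_ten hb hb' ha ha' ?_)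
      hg hf
    by_contra! h
    exact hd h.2 h.1
  obtain ⟨e0, e1, -, -, -⟩ := hL.equations h0 h1
  by_cases hf : bin E a = 0
  · by_cases hg : bin D b = 0
    · rcases mul_eq_zero.1 e1 with h | h
      · exact Or.inl (hL.mem_halfLines hi hD hE hC h0 h1 hind hf
          (Or.inl (dt_eq_zero_of_double_root hE hf h)))
      · exact Or.inr (hswap hg (Or.inl (dt_eq_zero_of_double_root hD hg h)))
    · exact Or.inl (hL.mem_halfLines hi hD hE hC h0 h1 hind hf (Or.inr hg))
  · exact Or.inr (hswap ((mul_eq_zero.1 e0).resolve_left hf) (Or.inr hf))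

theorem isLineOn_of_mem_halfLines {i : K} (hi : i ^ 2 = -1) {L : Submodule K (Fin 4 → K)}
    (h : L ∈ halfLines i C D E) : IsLineOn C D E L := by
  obtain ⟨θ, hθ, o, rfl⟩ := h
  have hone : ∀ θ : K, (![1, θ] : Fin 2 → K) ≠ 0 := fun θ h => one_ne_zero (congrFun h 0)
  refine ⟨finrank_span_pair (linearIndependent_ten (hone _) (hone _)
    (dt_ne_zero_left (dt_fstPt_sndPt hi _))
    (dt_ne_zero_left (dt_ne_zero_symm (dt_fstPt_sndPt hi _))) (Or.inr (dt_fstPt_sndPt hi _))), ?_⟩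
  intro x hx
  obtain ⟨u, v, rfl⟩ := Submodule.mem_span_pair.1 hx
  rw [quarticVal_comb]
  rcases o with _ | ⟨⟨k, j⟩, hkj⟩
  · have e1 : bin₁ E ![1, θ] ![1, θ] = 0 := by
      simpa [hθ] using bin₁_smul_self E 1 ![1, θ]
    have e2 : bin₂ E ![1, θ] ![1, θ] = 0 := by
      rw [← hθ]
      simp [bin₂, bin]
      ring
    have e3 : dt ![1, θ] ![1, θ] = 0 := by simp [dt]
    simp only [lineData, hθ, e1, e2, e3]
    ring
  · obtain ⟨o1, o3⟩ := bin₁_fstPt_sndPt hi D j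
    have b1 := bin₂_inv3 hθ k
    have b2 := bin₂_fstPt_sndPt hi D j
    have hkj' : C - D * E / 6 = 3 * (root3 E k * root3 D j) := hkj
    simp only [lineData, hθ, bin_inv3 hθ, o1, o3]
    rw [hkj', b1]
    linear_combination 3 * root3 E k * dt ![1, θ] ![1, inv3 θ k] ^ 2 * u ^ 2 * v ^ 2 * b2

/-- The points of the line in which it meets the quadric `xy = zw`. -/
theorem factors_of_ten_mem_joinLine {i : K} (hi : i ^ 2 = -1) {θ η : K} {j : Fin 3}
    {a b : Fin 2 → K} (h : ten a b ∈ joinLine i θ η j) (h0 : ten a b ≠ 0) :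
    (dt a ![1, θ] = 0 ∧ (η = θ ∨ dt b (fstPt i j) = 0)) ∨
      (dt a ![1, η] = 0 ∧ (η = θ ∨ dt b (sndPt i j) = 0)) := by
  obtain ⟨u, v, huv⟩ := Submodule.mem_span_pair.1 h
  by_cases hηθ : η = θ
  · subst hηθ
    have : ten a b = (1 : K) • ten ![1, η] (u • fstPt i j + v • sndPt i j) := by
      rw [← huv]
      funext k
      fin_cases k <;> simp [ten] <;> ring
    exact Or.inl ⟨(dt_eq_zero_of_ten_eq_smul this h0).1, Or.inl rfl⟩
  · have hq := quad_comb ![1, θ] (fstPt i j) ![1, η] (sndPt i j) u v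
    rw [huv, quad_ten] at hq
    have hd : dt ![1, θ] ![1, η] ≠ 0 := by simpa [dt, sub_eq_zero] using hηθ
    have huv0 := (mul_eq_zero.1 hq.symm).resolve_right (mul_ne_zero hd (dt_fstPt_sndPt hi j))
    rcases mul_eq_zero.1 huv0 with rfl | rfl
    · obtain ⟨h1, h2⟩ := dt_eq_zero_of_ten_eq_smul (m := v)
        (huv.symm.trans (by rw [zero_smul, zero_add])) h0
      exact Or.inr ⟨h1, Or.inr h2⟩
    · obtain ⟨h1, h2⟩ := dt_eq_zero_of_ten_eq_smul (m := u)
        (huv.symm.trans (by rw [zero_smul, add_zero])) h0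
      exact Or.inl ⟨h1, Or.inr h2⟩

theorem disjoint_halfLines {i : K} (hi : i ^ 2 = -1) (hD : D ^ 2 ≠ 4)
    {L : Submodule K (Fin 4 → K)} (h : L ∈ halfLines i C D E)
    (h' : L.map (swapZW K : (Fin 4 → K) →ₗ[K] (Fin 4 → K)) ∈ halfLines i C E D) : False := by
  have hone : ∀ θ : K, (![1, θ] : Fin 2 → K) ≠ 0 := fun θ h => one_ne_zero (congrFun h 0)
  obtain ⟨θ, hθ, o, rfl⟩ := h
  obtain ⟨θ', hθ', o', hL⟩ := h'
  set j := (lineData C D E θ o).2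
  have hF : fstPt i j ≠ 0 := dt_ne_zero_left (dt_fstPt_sndPt hi j)
  have hmem : ten (fstPt i j) ![1, θ] ∈ joinLine i θ' (lineData C E D θ' o').1
      (lineData C E D θ' o').2 := by
    rw [← hL]
    exact ⟨_, Submodule.subset_span (Set.mem_insert _ _), swapZW_ten _ _⟩
  have key : ∀ η : K, bin D ![1, η] = 0 → dt (fstPt i j) ![1, η] ≠ 0 := by
    intro η hη hdt
    rw [dt_comm, neg_eq_zero] at hdt
    obtain ⟨m, hm, h⟩ := exists_smul_of_dt_eq_zero (hone η) hF hdt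
    refine bin_fstPt hi hD j ?_
    rw [h, bin_smul, hη, mul_zero]
  rcases factors_of_ten_mem_joinLine hi hmem (ten_ne_zero hF (hone θ)) with ⟨h, -⟩ | ⟨h, -⟩
  · exact key _ hθ' h
  · exact key _ (bin_lineData hθ' o') h

theorem joinLine_injective {i : K} (hi : i ^ 2 = -1) (hE : E ^ 2 ≠ 4) {θ θ' : K}
    (hθ : bin E ![1, θ] = 0) (hθ' : bin E ![1, θ'] = 0) {o o' : Option (matches3 C D E)}
    (h : joinLine i θ (lineData C D E θ o).1 (lineData C D E θ o).2
      = joinLine i θ' (lineData C D E θ' o').1 (lineData C D E θ' o').2) : θ = θ' ∧ o = o' := by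
  have hone : ∀ θ : K, (![1, θ] : Fin 2 → K) ≠ 0 := fun θ h => one_ne_zero (congrFun h 0)
  have hF : ∀ j, fstPt i j ≠ 0 := fun j => dt_ne_zero_left (dt_fstPt_sndPt hi j)
  have hS : ∀ j, sndPt i j ≠ 0 := fun j =>
    dt_ne_zero_left (dt_ne_zero_symm (dt_fstPt_sndPt hi j))
  have hdt : ∀ {x y : K}, dt ![1, x] ![1, y] = 0 → x = y := by
    intro x y hxy
    simp [dt] at hxy
    linear_combination -hxy
  -- The lines on the quadric are not among the lines that meet it in two points.
  have hmix : ∀ {x y : K} {q : matches3 C D E}, bin E ![1, y] = 0 →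
      joinLine i x x 0 ≠ joinLine i y (inv3 y q.1.1) q.1.2 := by
    intro x y q hy he
    have hmem : (1 : K) • ten ![1, y] (fstPt i q.1.2) + (1 : K) • ten ![1, inv3 y q.1.1]
        (sndPt i q.1.2) ∈ joinLine i x x 0 := by
      rw [he]
      exact Submodule.mem_span_pair.2 ⟨1, 1, rfl⟩
    obtain ⟨u, v, huv⟩ := Submodule.mem_span_pair.1 hmem
    have q1 := quad_comb ![1, x] (fstPt i 0) ![1, x] (sndPt i 0) u v
    rw [huv, quad_comb] at q1
    have hxx : dt ![1, x] ![1, x] = 0 := by simp [dt]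
    rw [hxx] at q1
    simp only [one_mul, zero_mul, mul_zero] at q1
    rcases mul_eq_zero.1 q1 with h1 | h1
    · exact inv3_ne_self hE hy _ (hdt h1).symm
    · exact dt_fstPt_sndPt hi _ h1
  rcases o with _ | ⟨⟨k, j⟩, hkj⟩ <;> rcases o' with _ | ⟨⟨k', j'⟩, hkj'⟩
  · simp only [lineData] at h
    have hmem : ten ![1, θ] (fstPt i 0) ∈ joinLine i θ' θ' 0 := by
      rw [← h]
      exact Submodule.subset_span (Set.mem_insert _ _)
    refine ⟨?_, rfl⟩
    rcases factors_of_ten_mem_joinLine hi hmem (ten_ne_zero (hone _) (hF _)) with ⟨h, -⟩ | ⟨h, -⟩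
    · exact hdt h
    · exact hdt h
  · exact absurd h (hmix (q := ⟨(k', j'), hkj'⟩) hθ')
  · exact absurd h.symm (hmix (q := ⟨(k, j), hkj⟩) hθ)
  · simp only [lineData] at h
    have hmem : ten ![1, θ] (fstPt i j) ∈ joinLine i θ' (inv3 θ' k') j' := by
      rw [← h]
      exact Submodule.subset_span (Set.mem_insert _ _)
    have hmem' : ten ![1, inv3 θ k] (sndPt i j) ∈ joinLine i θ' (inv3 θ' k') j' := by
      rw [← h]
      exact Submodule.subset_span (Set.mem_insert_of_mem _ rfl)
    have hne := inv3_ne_self hE hθ' k'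
    rcases factors_of_ten_mem_joinLine hi hmem (ten_ne_zero (hone _) (hF _)) with
      ⟨h1, h2⟩ | ⟨-, h2⟩
    · obtain rfl := hdt h1
      obtain rfl := eq_of_dt_fstPt hi _ _ (h2.resolve_left hne)
      rcases factors_of_ten_mem_joinLine hi hmem' (ten_ne_zero (hone _) (hS _)) with
        ⟨-, h4⟩ | ⟨h3, -⟩
      · have := h4.resolve_left hne
        rw [dt_comm, neg_eq_zero] at this
        exact absurd this (dt_fstPt_sndPt_ne hi _ _)
      · obtain rfl := inv3_injective hE hθ (hdt h3)
        exact ⟨rfl, rfl⟩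
    · exact absurd (h2.resolve_left hne) (dt_fstPt_sndPt_ne hi _ _)

theorem encard_halfLines [IsAlgClosed K] {i : K} (hi : i ^ 2 = -1) (hE : E ^ 2 ≠ 4) :
    (halfLines i C D E).encard = 4 * ((matches3 C D E).encard + 1) := by
  obtain ⟨ρ, hρ, hroots⟩ := exists_roots hE
  have hr : ∀ l, bin E ![1, ρ l] = 0 := fun l => (hroots _).2 ⟨l, rfl⟩
  let F : Fin 4 × Option (matches3 C D E) → Submodule K (Fin 4 → K) := fun x =>
    joinLine i (ρ x.1) (lineData C D E (ρ x.1) x.2).1 (lineData C D E (ρ x.1) x.2).2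
  have hF : Function.Injective F := by
    rintro ⟨l, o⟩ ⟨l', o'⟩ h
    obtain ⟨h1, h2⟩ := joinLine_injective hi hE (hr l) (hr l') h
    exact Prod.ext (hρ h1) h2
  have hrange : halfLines i C D E = Set.range F := by
    ext L
    constructor
    · rintro ⟨θ, hθ, o, rfl⟩
      obtain ⟨l, rfl⟩ := (hroots θ).1 hθ
      exact ⟨(l, o), rfl⟩
    · rintro ⟨⟨l, o⟩, rfl⟩
      exact ⟨ρ l, hr l, o, rfl⟩
  rw [hrange, ← Set.image_univ, hF.encard_image, Set.encard_univ]
  rw [ENat.card_prod, ENat.card_eq_coe_natCard (Option _), Finite.card_option, Set.encard,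
    ENat.card_eq_coe_natCard (matches3 C D E)]
  simp

/-- The number of lines on a quartic of the tangent cone, off a few hypersurfaces. -/
theorem encard_setOf_isLineOn [IsAlgClosed K] {i : K} (hi : i ^ 2 = -1) (hD : D ^ 2 ≠ 4)
    (hE : E ^ 2 ≠ 4)
    (hC : (C - D * E / 6) ^ 2 ≠ 4 * ((1 + E ^ 2 / 12) * (1 + D ^ 2 / 12))) :
    {L | IsLineOn C D E L}.encard = 8 * ((matches3 C D E).encard + 1) := by
  let e := (Submodule.orderIsoMapComap (swapZW K)).toEquiv
  have hunion : {L | IsLineOn C D E L} = halfLines i C D E ∪ e ⁻¹' halfLines i C E D := by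
    ext L
    refine ⟨fun h => h.mem_or hi hD hE hC, fun h => ?_⟩
    rcases h with h | h
    · exact isLineOn_of_mem_halfLines hi h
    · exact isLineOn_map_swapZW_iff.1 (isLineOn_of_mem_halfLines hi h)
  have hM : (matches3 C E D).encard = (matches3 C D E).encard := by
    rw [← Set.encard_preimage_of_bijective Prod.swap_bijective]
    congr 1
    ext q
    change (_ = 3 * (root3 D q.2 * root3 E q.1)) ↔ (_ = 3 * (root3 E q.1 * root3 D q.2))
    rw [mul_comm E D, mul_comm (root3 D _)]
  have hdis : Disjoint (halfLines i C D E) (e ⁻¹' halfLines i C E D) :=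
    Set.disjoint_left.2 fun L h h' => disjoint_halfLines hi hD h h'
  rw [hunion, Set.encard_union_eq hdis, Set.encard_preimage_of_bijective e.bijective,
    encard_halfLines hi hE, encard_halfLines hi hD, hM, ← add_mul]
  norm_num

end Classification

end CountLines

/-! ### Lines on the members of the six families -/

section FamilyLines

variable {K : Type*} [Field K] [CharZero K]

/-- The values `root3`, made homogeneous by the coordinate `A`. -/
def homRoot3 (A E : K) : Fin 3 → K := ![-E / 3, E / 6 - A, E / 6 + A]

/-- The equation of `matches3`, made homogeneous by the coordinate `A`. -/
def matchForm (q : Fin 3 × Fin 3) (A C D E : K) : K :=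
  C * A - D * E / 6 - 3 * (homRoot3 A E q.1 * homRoot3 A D q.2)

/-- The forms whose nonvanishing `encard_setOf_isLineOn` requires: with `A = 1`, the binary quartics
`bin D` and `bin E` have no double roots, and the combination of roots excluded by `bin_invariant`
does not occur. -/
def genericForm (A C D E : K) : Fin 3 → K :=
  ![4 * A ^ 2 - D ^ 2, 4 * A ^ 2 - E ^ 2,
    (C * A - D * E / 6) ^ 2 - 4 * ((A ^ 2 + E ^ 2 / 12) * (A ^ 2 + D ^ 2 / 12))]

theorem isForm_homRoot3 (a e : Fin 5) (k : Fin 3) :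
    IsForm (fun v : Fin 5 → K => homRoot3 (v a) (v e) k) 1 := by
  have c : ∀ k, IsForm (fun v : Fin 5 → K => v k) 1 := IsForm.coord
  fin_cases k
  · convert (c e).const_mul (-1 / 3) using 2
    simp [homRoot3]
    ring
  · convert ((c e).const_mul (1 / 6)).sub (c a) using 2
    simp [homRoot3]
    ring
  · convert ((c e).const_mul (1 / 6)).add (c a) using 2
    simp [homRoot3]
    ring

theorem isForm_matchForm (q : Fin 3 × Fin 3) (a c d e : Fin 5) :
    IsForm (fun v : Fin 5 → K => matchForm q (v a) (v c) (v d) (v e)) 2 := by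
  have o : ∀ k, IsForm (fun v : Fin 5 → K => v k) 1 := IsForm.coord
  have h := (((o c).mul (o a)).sub (((o d).mul (o e)).const_mul (1 / 6))).sub
    (((isForm_homRoot3 a e q.1).mul (isForm_homRoot3 a d q.2)).const_mul 3)
  convert h using 2
  simp only [matchForm]
  ring

theorem isForm_genericForm (k : Fin 3) (a c d e : Fin 5) :
    IsForm (fun v : Fin 5 → K => genericForm (v a) (v c) (v d) (v e) k) (![2, 2, 4] k) := by
  have o : ∀ k, IsForm (fun v : Fin 5 → K => v k) 1 := IsForm.coord
  have o2 : ∀ k, IsForm (fun v : Fin 5 → K => v k ^ 2) 2 := fun k => (o k).pow 2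
  fin_cases k
  · exact ((o2 a).const_mul 4).sub (o2 d)
  · exact ((o2 a).const_mul 4).sub (o2 e)
  · have h : IsForm _ 4 := ((((o c).mul (o a)).sub (((o d).mul (o e)).const_mul (1 / 6))).pow 2).sub
      ((((o2 a).add ((o2 e).const_mul (1 / 12))).mul
        ((o2 a).add ((o2 d).const_mul (1 / 12)))).const_mul 4)
    convert h using 2
    · simp [genericForm]
      ring
    · rfl

variable [IsAlgClosed K] {i : K} (hi : i ^ 2 = -1)

include hi

/-- The number of lines on a quartic that the coordinate change `σ` takes to a quartic with coefficients
`vecCDE C D E`. -/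
theorem encard_linesOn_mk {v : Fin 5 → K} (hv : v ≠ 0)
    (σ : (Fin 4 → K) ≃ₗ[K] (Fin 4 → K)) {C D E a : K} (ha : a ≠ 0)
    (hσ : ∀ x, quarticVal v (σ x) = a * quarticVal (vecCDE C D E) x) (hD : D ^ 2 ≠ 4)
    (hE : E ^ 2 ≠ 4) (hC : (C - D * E / 6) ^ 2 ≠ 4 * ((1 + E ^ 2 / 12) * (1 + D ^ 2 / 12)))
    (S : Finset (Fin 3 × Fin 3))
    (hS : ∀ q, C - D * E / 6 = 3 * (root3 E q.1 * root3 D q.2) ↔ q ∈ S) :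
    (linesOn (Projectivization.mk K v hv)).encard = 8 * (S.card + 1) := by
  let e := (Submodule.orderIsoMapComap σ).toEquiv
  have h : e ⁻¹' linesOn (Projectivization.mk K v hv) = {L | IsLineOn C D E L} := by
    ext L
    refine (mem_linesOn_mk_iff v hv _).trans (and_congr ?_ ⟨fun h x hx => ?_, fun h => ?_⟩)
    · exact Eq.congr (LinearEquiv.finrank_map_eq σ L) rfl
    · have := h (σ x) ⟨x, hx, rfl⟩
      rw [hσ] at this
      exact (mul_eq_zero.1 this).resolve_left ha
    · rintro _ ⟨x, hx, rfl⟩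
      exact (hσ x).trans (by rw [h x hx, mul_zero])
  have hM : matches3 C D E = S := Set.ext hS
  rw [← Set.encard_preimage_of_bijective e.bijective, h, encard_setOf_isLineOn hi hD hE hC, hM,
    Set.encard_coe_eq_coe_finsetCard]

/-- The number of lines on a general member of a family that coordinate changes of the parameter
space and of projective 3-space identify with a family in a tangent cone. The set `S` consists of
the matches that occur on the whole family. -/
theorem forGeneralMember_encard_linesOn {F : Set (P4 K)} (hF : IsIrreducible F)
    (S : Finset (Fin 3 × Fin 3)) (σ : (Fin 4 → K) ≃ₗ[K] (Fin 4 → K)) (c d e : Fin 5)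
    (h : ∀ p ∈ F, ∃ (v : Fin 5 → K) (hv : v ≠ 0), p = Projectivization.mk K v hv ∧ v 0 ≠ 0 ∧
      (∀ x, quarticVal v (σ x)
        = v 0 * quarticVal (vecCDE (v c / v 0) (v d / v 0) (v e / v 0)) x) ∧
      ∀ q ∈ S, matchForm q (v 0) (v c) (v d) (v e) = 0)
    {w : Fin 5 → K} (hw : w ≠ 0) (hwF : Projectivization.mk K w hw ∈ F)
    (hw1 : ∀ k, genericForm (w 0) (w c) (w d) (w e) k ≠ 0)
    (hw2 : ∀ q ∉ S, matchForm q (w 0) (w c) (w d) (w e) ≠ 0) :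
    ForGeneralMember F (fun p => (linesOn p).encard = 8 * (S.card + 1)) := by
  refine forGeneralMember_of_forms hF (ι := Fin 3 ⊕ {q // q ∉ S})
    (Sum.elim (fun k v => genericForm (v 0) (v c) (v d) (v e) k)
      fun q v => matchForm q.1 (v 0) (v c) (v d) (v e)) (Sum.elim ![2, 2, 4] fun _ => 2) ?_ ?_ ?_
  · rintro (k | q)
    · exact isForm_genericForm k 0 c d e
    · exact isForm_matchForm q.1 0 c d e
  · rintro (k | q)
    · exact ⟨_, hwF, ((isForm_genericForm k 0 c d e).mk_rep_eq_zero_iff w hw).not.2 (hw1 k)⟩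
    · exact ⟨_, hwF, ((isForm_matchForm q.1 0 c d e).mk_rep_eq_zero_iff w hw).not.2
        (hw2 q.1 q.2)⟩
  · intro p hp hne
    obtain ⟨v, hv, rfl, h0, hσ, hS⟩ := h p hp
    have g : ∀ k, genericForm (v 0) (v c) (v d) (v e) k ≠ 0 := fun k =>
      ((isForm_genericForm k 0 c d e).mk_rep_eq_zero_iff v hv).not.1 (hne (Sum.inl k))
    have m : ∀ q ∉ S, matchForm q (v 0) (v c) (v d) (v e) ≠ 0 := fun q hq =>
      ((isForm_matchForm q 0 c d e).mk_rep_eq_zero_iff v hv).not.1 (hne (Sum.inr ⟨q, hq⟩))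
    refine encard_linesOn_mk hi hv σ h0 hσ (fun h => g 0 ?_) (fun h => g 1 ?_) (fun h => g 2 ?_) S
      fun q => ?_
    · field_simp at h
      simp [genericForm]
      linear_combination -h
    · field_simp at h
      simp [genericForm]
      linear_combination -h
    · field_simp at h
      simp [genericForm]
      linear_combination h / 5184
    · have hr : ∀ (x : Fin 5) (k : Fin 3),
          root3 (v x / v 0) k = homRoot3 (v 0) (v x) k / v 0 := by
        intro x k
        fin_cases k <;> simp [root3, homRoot3] <;> field_simp
      have hq : v c / v 0 - v d / v 0 * (v e / v 0) / 6 = 3 * (root3 (v e / v 0) q.1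
          * root3 (v d / v 0) q.2) ↔ matchForm q (v 0) (v c) (v d) (v e) = 0 := by
        rw [hr, hr, ← sub_eq_zero, matchForm]
        rw [show v c / v 0 - v d / v 0 * (v e / v 0) / 6 - 3 * (homRoot3 (v 0) (v e) q.1 / v 0
          * (homRoot3 (v 0) (v d) q.2 / v 0)) = (v c * v 0 - v d * v e / 6
          - 3 * (homRoot3 (v 0) (v e) q.1 * homRoot3 (v 0) (v d) q.2)) / v 0 ^ 2 by
            field_simp]
        simp [h0]
      rw [hq]
      exact ⟨fun h => by_contra fun hqS => m q hqS h, hS q⟩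

theorem forGeneralMember_familyCDE :
    ForGeneralMember (familyCDE K) (fun p => (linesOn p).encard = 8) := by
  have := forGeneralMember_encard_linesOn hi (isIrreducible_familyCDE (K := K)) ∅
    (LinearEquiv.refl K _) 2 3 4 ?_ (w := ![1, -2, 1, 0, 0]) (vec_ne_zero one_ne_zero) ?_ ?_ ?_
  · simpa using this
  · rintro p ⟨A, C, D, E, hA, rfl⟩
    refine ⟨_, _, rfl, hA, fun x => ?_, by simp⟩
    simp [quarticVal, vecCDE]
    field_simp
  · exact ⟨1, 1, 0, 0, one_ne_zero, by simp [point]⟩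
  · intro k
    fin_cases k <;> simp [genericForm]
    norm_num
  · rintro ⟨k, j⟩ -
    fin_cases k <;> fin_cases j <;> simp [matchForm, homRoot3] <;> norm_num

theorem forGeneralMember_familyCD :
    ForGeneralMember (familyCD K) (fun p => (linesOn p).encard = 16) := by
  have := forGeneralMember_encard_linesOn hi (isIrreducible_familyCD (K := K)) {(0, 0)}
    (LinearEquiv.refl K _) 2 3 4 ?_ (w := ![1, 0, 1 / 2, 1, 1]) (vec_ne_zero one_ne_zero) ?_ ?_ ?_
  · convert this using 3
    norm_num
  · rintro p ⟨A, C, D, hA, hD, rfl⟩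
    refine ⟨_, _, rfl, hA, fun x => ?_, ?_⟩
    · simp [quarticVal, vecCDE]
      field_simp
      ring
    · simp [matchForm, homRoot3]
      field_simp
      ring
  · exact ⟨1, 1 / 2, 1, one_ne_zero, one_ne_zero, by simp [point]⟩
  · intro k
    fin_cases k <;> simp [genericForm] <;> norm_num
  · rintro ⟨k, j⟩ hkj
    fin_cases k <;> fin_cases j <;> simp [matchForm, homRoot3] at hkj ⊢ <;> norm_num

/-- The change of sign of `w`. -/
def negW (K : Type*) [Field K] : (Fin 4 → K) ≃ₗ[K] (Fin 4 → K) :=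
  LinearEquiv.piCongrRight ![LinearEquiv.refl K K, LinearEquiv.refl K K, LinearEquiv.refl K K,
    LinearEquiv.neg K]

theorem forGeneralMember_familyB :
    ForGeneralMember (familyB K) (fun p => (linesOn p).encard = 24) := by
  have := forGeneralMember_encard_linesOn hi (isIrreducible_familyB (K := K)) {(0, 1), (1, 0)}
    (negW K) 2 3 4 ?_ (w := ![1, 1, 1, 1, 1]) (vec_ne_zero one_ne_zero) ?_ ?_ ?_
  · convert this using 3
    norm_num
  · rintro p ⟨A, B, hA, rfl⟩
    refine ⟨_, _, rfl, hA, fun x => ?_, ?_⟩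
    · simp [quarticVal, vecCDE, negW]
      field_simp
      ring
    · simp [matchForm, homRoot3]
      constructor <;> ring
  · exact ⟨1, 1, one_ne_zero, by
      simp only [point]
      congr 1
      norm_num⟩
  · intro k
    fin_cases k <;> simp [genericForm] <;> norm_num
  · rintro ⟨k, j⟩ hkj
    fin_cases k <;> fin_cases j <;> simp [matchForm, homRoot3] at hkj ⊢ <;> norm_num

theorem forGeneralMember_familyC :
    ForGeneralMember (familyC K) (fun p => (linesOn p).encard = 32) := by
  have := forGeneralMember_encard_linesOn hi (isIrreducible_familyC (K := K))
    {(0, 0), (0, 1), (0, 2)} (LinearEquiv.funCongrLeft K K (Equiv.swap 1 2)) 3 2 4 ?_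
    (w := ![1, 0, 1, 0, 0]) (vec_ne_zero one_ne_zero) ?_ ?_ ?_
  · convert this using 3
    rw [show Finset.card _ = 3 from rfl]
    norm_num
  · rintro p ⟨A, C, hA, rfl⟩
    refine ⟨_, _, rfl, hA, fun x => ?_, ?_⟩
    · simp [quarticVal, vecCDE, LinearEquiv.funCongrLeft_apply, LinearMap.funLeft_apply,
        Equiv.swap_apply_def]
      field_simp
      ring
    · simp [matchForm, homRoot3]
  · exact ⟨1, 1, one_ne_zero, rfl⟩
  · intro k
    fin_cases k <;> simp [genericForm] <;> norm_num
  · rintro ⟨k, j⟩ hkj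
    fin_cases k <;> fin_cases j <;> simp [matchForm, homRoot3] at hkj ⊢ <;> norm_num

theorem encard_linesOn_pointY {s : K} (hs : s ^ 2 = -3) :
    (linesOn (pointY s hs)).encard = 32 := by
  have hs0 := ne_zero_of_sq_eq hs
  have hs1 : s ≠ 1 := by
    rintro rfl
    norm_num at hs
  have hs3 : s ≠ -3 := by
    rintro rfl
    norm_num at hs
  have := encard_linesOn_mk hi (v := ![s, 12 * (s - 1), 6, 6, -6]) (vec_ne_zero hs0)
    (LinearEquiv.refl K _) (C := -2 * s) (D := -2 * s) (E := 2 * s) hs0 ?_ ?_ ?_ ?_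
    {(0, 2), (1, 0), (2, 1)} ?_
  · refine (Eq.trans ?_ this).trans ?_
    · rfl
    · rw [show Finset.card _ = 3 from rfl]
      norm_num
  · intro x
    simp [quarticVal, vecCDE]
    linear_combination ((4 * s - 4) * (x 0 * x 1 * x 2 * x 3)
      + 2 * (x 0 ^ 2 * x 1 ^ 2 + x 2 ^ 2 * x 3 ^ 2) + 2 * (x 0 ^ 2 * x 2 ^ 2 + x 1 ^ 2 * x 3 ^ 2)
      - 2 * (x 0 ^ 2 * x 3 ^ 2 + x 1 ^ 2 * x 2 ^ 2)) * hs
  · intro h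
    have : (16 : K) = 0 := by linear_combination 4 * hs - h
    norm_num at this
  · intro h
    have : (16 : K) = 0 := by linear_combination 4 * hs - h
    norm_num at this
  · intro h
    have : 8 * (s - 1) = 0 := by linear_combination h + (8 * s / 3 - 4 / 3) * hs
    simp [sub_eq_zero, hs1] at this
  · have e1 : (4 : K) ≠ -2 * s - 2 := fun h => hs3 (by linear_combination h / 2)
    have e2 : 2 * s - 2 ≠ -2 * s - 2 := fun h => hs0 (by linear_combination h / 4)
    have hκ : -2 * s - -2 * s * (2 * s) / 6 = -2 * s - 2 := by linear_combination 2 / 3 * hs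
    have hr : ∀ k j, 3 * (root3 (2 * s) k * root3 (-2 * s) j)
        = (![![4, 2 * s - 2, -2 * s - 2], ![-2 * s - 2, 4, 2 * s - 2],
          ![2 * s - 2, -2 * s - 2, 4]] : Fin 3 → Fin 3 → K) k j := by
      intro k j
      fin_cases k <;> fin_cases j <;> simp [root3]
      · linear_combination -4 / 3 * hs
      · linear_combination 2 / 3 * hs
      · linear_combination 2 / 3 * hs
      · linear_combination 2 / 3 * hs
      · linear_combination -1 / 3 * hs
      · linear_combination -1 / 3 * hs
      · linear_combination 2 / 3 * hs
      · linear_combination -1 / 3 * hs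
      · linear_combination -1 / 3 * hs
    rintro ⟨k, j⟩
    rw [hκ, hr]
    fin_cases k <;> fin_cases j <;> simp <;>
      first
        | exact fun h => e1 (by linear_combination -h)
        | exact fun h => e2 (by linear_combination -h)

theorem encard_linesOn_pointF4 : (linesOn (pointF4 K)).encard = 48 := by
  have := encard_linesOn_mk hi (v := ![1, 0, 0, 0, 0]) (vec_ne_zero one_ne_zero)
    (LinearEquiv.refl K _) (C := 0) (D := 0) (E := 0) one_ne_zero ?_ (by norm_num) (by norm_num)
    (by norm_num) {(0, 0), (0, 1), (0, 2), (1, 0), (2, 0)} ?_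
  · refine (Eq.trans ?_ this).trans ?_
    · rfl
    · rw [show Finset.card _ = 5 from rfl]
      norm_num
  · intro x
    simp [quarticVal, vecCDE]
  · rintro ⟨k, j⟩
    fin_cases k <;> fin_cases j <;> simp [root3]

end FamilyLines

end InvariantQuartics

theorem mainTheorem4 (K : Type*) [Field K] [IsAlgClosed K] [CharZero K]
    (i : K) (hi : i ^ 2 = -1) (s : K) (hs : s ^ 2 = -3) :
    InvariantQuartics.ForGeneralMember (InvariantQuartics.familyCDE K)
      (fun p => (InvariantQuartics.linesOn p).encard = 8) ∧
    InvariantQuartics.ForGeneralMember (InvariantQuartics.familyCD K)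
      (fun p => (InvariantQuartics.linesOn p).encard = 16) ∧
    InvariantQuartics.ForGeneralMember (InvariantQuartics.familyB K)
      (fun p => (InvariantQuartics.linesOn p).encard = 24) ∧
    InvariantQuartics.ForGeneralMember (InvariantQuartics.familyC K)
      (fun p => (InvariantQuartics.linesOn p).encard = 32) ∧
    (InvariantQuartics.linesOn (InvariantQuartics.pointY s hs)).encard = 32 ∧
    (InvariantQuartics.linesOn (InvariantQuartics.pointF4 K)).encard = 48 ∧
    (∀ F ∈ InvariantQuartics.listedFamilies s hs,
      InvariantQuartics.IsConeFamily (closure F) ∧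
      InvariantQuartics.ForGeneralMember F InvariantQuartics.IsSmooth) ∧
    (∀ Z : Set (InvariantQuartics.P4 K), InvariantQuartics.IsConeFamily Z →
      (∃ p ∈ Z, InvariantQuartics.IsSmooth p) →
      ∃ g ∈ InvariantQuartics.Omega i hi, ∃ F ∈ InvariantQuartics.listedFamilies s hs,
        Z = (fun p => g.2 • p) '' closure F) := by
  refine ⟨InvariantQuartics.forGeneralMember_familyCDE hi,
    InvariantQuartics.forGeneralMember_familyCD hi, InvariantQuartics.forGeneralMember_familyB hi,
    InvariantQuartics.forGeneralMember_familyC hi, InvariantQuartics.encard_linesOn_pointY hi hs,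
    InvariantQuartics.encard_linesOn_pointF4 hi, fun F hF => ?_, fun Z hZ hsm => ?_⟩
  · obtain ⟨k, rfl⟩ := (InvariantQuartics.mem_listedFamilies_iff hs F).1 hF
    exact ⟨InvariantQuartics.isConeFamily_closure_fam hs k,
      InvariantQuartics.forGeneralMember_isSmooth hs k⟩
  · obtain ⟨g, hg, k, hk⟩ :=
      InvariantQuartics.eq_smul_closure_fam_of_isConeFamily hs hi hZ hsm
    exact ⟨g, hg, _, (InvariantQuartics.mem_listedFamilies_iff hs _).2 ⟨k, rfl⟩, hk⟩
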